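/- Let $d\ge 2$, let $\mathbb B^d\subset\mathbb R^d$ be the open unit ball and $\mathbb S^{d-1}$ its boundary, and let $\kappa\in\mathbb C$ not be a Dirichlet eigenvalue of $-\Delta$ on $\mathbb B^d$. For $q\in L^\infty(\mathbb B^d,\mathbb R)$ such that $\kappa$ is not a Dirichlet eigenvalue of $-\Delta+q$, let $\Lambda_{q,\kappa}f=\partial_\nu u|_{\mathbb S^{d-1}}$, $f\in C^\infty(\mathbb S^{d-1})$, be the Dirichlet-to-Neumann map, where $u\in H^1(\mathbb B^d)$ is the solution of $-\Delta u+qu-\kappa u=0$ in $\mathbb B^d$, $u|_{\mathbb S^{d-1}}=f$, and $\partial_\nu u$ is its weak (Green's formula) normal derivative. Then for all $q$ in a neighbourhood of $0$ in $L^\infty(\mathbb B^d,\mathbb R)$, $\kappa$ is not a Dirichlet eigenvalue of $-\Delta+q$ and $\Lambda_{q,\kappa}-\Lambda_{0,\kappa}$ extends uniquely to a bounded operator $\Phi^\kappa(q)$ on $L^2(\mathbb S^{d-1})$; the map $q\mapsto\Phi^\kappa(q)\in\mathcal L(L^2(\mathbb S^{d-1}))$ is Fréchet differentiable at $q=0$;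 and, for every radial $q\in L^\infty(\mathbb B^d,\mathbb R)$, its differential $d\Phi^\kappa_0(q)$ is a bounded operator on $L^2(\mathbb S^{d-1})$ that is invariant under rotations (and reflections) of the sphere and satisfies, for every $\ell\in\mathbb N_0$ and every spherical harmonic $Y$ of degree $\ell$ on $\mathbb S^{d-1}$, $$\varphi_\ell(\sqrt\kappa)^2\, d\Phi^\kappa_0(q)\,Y=\sigma_\ell[q,\kappa]\,Y .$$ Here $$\varphi_\ell(z)=\frac{J_{\ell+\nu_d}(z)}{z^{\nu_d}}=\frac{z^\ell}{2^{\ell+\nu_d}}\sum_{n=0}^\infty\frac{(-1)^n}{n!\,\Gamma(\ell+\nu_d+n+1)}\Big(\frac z2\Big)^{2n},\qquad \nu_d=\frac{d-2}2,$$ $$\sigma_\ell[q,\kappa]=\frac1{|\mathbb S^{d-1}|}\int_{\mathbb B^d}q(x)\,\varphi_\ell(\sqrt\kappa\,|x|)^2\,dx .$$ If $\kappa\ne0$, then moreover $\varphi_\ell(\sqrt\kappa)\neq0$ for all $\ell$, so that $d\Phi^\kappa_0(q)$ acts on spherical harmonics of degree $\ell$ as $\sigma_\ell[q,\kappa]/\varphi_\ell(\sqrt\kappa)^2$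 times the identity. -/

import Mathlib

open MeasureTheory Filter Topology

noncomputable section

namespace RadialCalderon

open scoped ENNReal ContDiff

/-- Euclidean space `ℝ^d`. -/
abbrev E (d : ℕ) : Type := EuclideanSpace ℝ (Fin d)

/-- The open unit ball `𝔹^d`. -/
abbrev ball (d : ℕ) : Set (E d) := Metric.ball (0 : E d) 1

/-- The unit sphere `𝕊^{d-1}`. -/
abbrev Sphere (d : ℕ) : Type := Metric.sphere (0 : E d) 1

/-- Lebesgue measure on the unit ball. -/
abbrev ballMeasure (d : ℕ) : Measure (E d) := volume.restrict (ball d)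

/-- Surface measure on the unit sphere. -/
abbrev sphereMeasure (d : ℕ) : Measure (Sphere d) := (volume : Measure (E d)).toSphere

/-- Real-valued essentially bounded potentials, `L^∞(𝔹^d, ℝ)`. -/
abbrev Potential (d : ℕ) : Type := Lp ℝ ∞ (ballMeasure d)

/-- Complex-valued `L²(𝕊^{d-1})`. -/
abbrev L2Sphere (d : ℕ) : Type := Lp ℂ 2 (sphereMeasure d)

/-- The potential `q` is radial, that is `q(x) = q₀(|x|)` for almost every `x`. -/
def IsRadial {d : ℕ} (q : Potential d) : Prop :=
  ∃ q₀ : ℝ → ℝ, ∀ᵐ x ∂ballMeasure d, q x = q₀ ‖x‖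

/-- The classical partial derivative `∂ᵢ φ`. -/
def partialDeriv {d : ℕ} (i : Fin d) (φ : E d → ℂ) (x : E d) : ℂ :=
  fderiv ℝ φ x (EuclideanSpace.single i 1)

/-- `φ ∈ C_c^∞(𝔹^d)`. -/
structure IsTestFunction {d : ℕ} (φ : E d → ℂ) : Prop where
  smooth : ContDiff ℝ ∞ φ
  compact : HasCompactSupport φ
  support : tsupport φ ⊆ ball d

/-- `u ∈ H¹(𝔹^d)` and `G` is its weak gradient. -/
structure IsH1 {d : ℕ} (u : E d → ℂ) (G : Fin d → E d → ℂ) : Prop where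
  memLp : MemLp u 2 (ballMeasure d)
  memLp_grad : ∀ i, MemLp (G i) 2 (ballMeasure d)
  weak_grad : ∀ (i : Fin d) (φ : E d → ℂ), IsTestFunction φ →
    ∫ x in ball d, u x * partialDeriv i φ x = -∫ x in ball d, G i x * φ x

/-- `u ∈ H¹₀(𝔹^d)`, the closure of `C_c^∞(𝔹^d)` in `H¹(𝔹^d)`, and `G` is its weak gradient. -/
structure IsH10 {d : ℕ} (u : E d → ℂ) (G : Fin d → E d → ℂ) : Prop where
  isH1 : IsH1 u G
  approx : ∃ φ : ℕ → E d → ℂ, (∀ n, IsTestFunction (φ n)) ∧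
    Tendsto (fun n => eLpNorm (fun x => φ n x - u x) 2 (ballMeasure d)) atTop (𝓝 0) ∧
    ∀ i, Tendsto (fun n => eLpNorm (fun x => partialDeriv i (φ n) x - G i x) 2 (ballMeasure d))
      atTop (𝓝 0)

/-- The bilinear form `∫_𝔹 (∇u · ∇h + (q - κ) u h) dx` of `-Δ + q - κ`, where `G` stands for the
weak gradient of `u` and `h` is smooth. -/
def energyForm {d : ℕ} (κ : ℂ) (q : Potential d) (u : E d → ℂ) (G : Fin d → E d → ℂ)
    (h : E d → ℂ) : ℂ :=
  ∫ x in ball d, (∑ i, G i x * partialDeriv i h x + ((q x : ℂ) - κ) * u x * h x)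

/-- `(-Δ + q - κ) u = 0` in `𝔹^d` in the weak sense. -/
def IsWeakSolution {d : ℕ} (κ : ℂ) (q : Potential d) (u : E d → ℂ) (G : Fin d → E d → ℂ) : Prop :=
  ∀ φ : E d → ℂ, IsTestFunction φ → energyForm κ q u G φ = 0

/-- `κ` is a Dirichlet eigenvalue of `-Δ + q` on `𝔹^d`. -/
def IsDirichletEigenvalue {d : ℕ} (κ : ℂ) (q : Potential d) : Prop :=
  ∃ (u : E d → ℂ) (G : Fin d → E d → ℂ), IsH10 u G ∧ IsWeakSolution κ q u G ∧
    ¬ u =ᵐ[ballMeasure d] 0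

/-- `u ∈ H¹(𝔹^d)`, with weak gradient `G`, solves `(-Δ + q - κ) u = 0` in `𝔹^d` with
`u = F` on `𝕊^{d-1}`; the boundary condition means that `u - F ∈ H¹₀(𝔹^d)`. -/
structure IsDirichletSolution {d : ℕ} (κ : ℂ) (q : Potential d) (F : E d → ℂ)
    (u : E d → ℂ) (G : Fin d → E d → ℂ) : Prop where
  isH1 : IsH1 u G
  boundary : IsH10 (fun x => u x - F x) (fun i x => G i x - partialDeriv i F x)
  weak_eq : IsWeakSolution κ q u G

/-- `⟨Λ_{q,κ} F|_𝕊, H|_𝕊⟩ = z` (bilinear pairing), where `Λ_{q,κ} f = ∂_ν u|_𝕊` is the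
Dirichlet-to-Neumann map. The normal derivative of the solution `u` is taken in the weak sense, that
is, through Green's formula `∫_𝕊 (∂_ν u) H dσ = ∫_𝔹 (∇u · ∇H + (q - κ) u H) dx`. -/
def IsDtNPairing {d : ℕ} (κ : ℂ) (q : Potential d) (F H : E d → ℂ) (z : ℂ) : Prop :=
  ∃ (u : E d → ℂ) (G : Fin d → E d → ℂ), IsDirichletSolution κ q F u G ∧ z = energyForm κ q u G H

/-- The bounded operator `T` on `L²(𝕊^{d-1})` extends `Λ_{q,κ} - Λ_{0,κ}` from `C^∞(𝕊^{d-1})`.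
Elements of `C^∞(𝕊^{d-1})` are written as restrictions of smooth functions on `ℝ^d`. -/
def IsDtNDifference {d : ℕ} (κ : ℂ) (q : Potential d) (T : L2Sphere d →L[ℂ] L2Sphere d) : Prop :=
  ∀ (F H : E d → ℂ), ContDiff ℝ ∞ F → ContDiff ℝ ∞ H →
    ∀ f : L2Sphere d, (∀ᵐ y ∂sphereMeasure d, f y = F y) →
      ∃ z₁ z₀ : ℂ, IsDtNPairing κ q F H z₁ ∧ IsDtNPairing κ 0 F H z₀ ∧
        ∫ y, T f y * H y ∂sphereMeasure d = z₁ - z₀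

open scoped Classical in
/-- The map `Φ^κ : q ↦ Λ_{q,κ} - Λ_{0,κ}` with values in the bounded operators on `L²(𝕊^{d-1})`
(with the value `0` where the difference does not define a bounded operator). -/
def Phi (d : ℕ) (κ : ℂ) (q : Potential d) : L2Sphere d →L[ℂ] L2Sphere d :=
  if h : ∃ T : L2Sphere d →L[ℂ] L2Sphere d, IsDtNDifference κ q T then h.choose else 0

/-- `φ_ℓ(z) = J_{ℓ+ν}(z) / z^ν` with `ν = (d-2)/2`, through its everywhere convergent series. -/
def phi (d ℓ : ℕ) (z : ℂ) : ℂ :=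
  z ^ ℓ / (((2 : ℝ) ^ ((ℓ : ℝ) + ((d : ℝ) - 2) / 2) : ℝ) : ℂ) *
    ∑' n : ℕ, (-1 : ℂ) ^ n /
      ((n.factorial : ℂ) * ((Real.Gamma ((ℓ : ℝ) + ((d : ℝ) - 2) / 2 + (n : ℝ) + 1) : ℝ) : ℂ)) *
      (z / 2) ^ (2 * n)

/-- The principal square root. -/
def csqrt (κ : ℂ) : ℂ := κ ^ (1 / 2 : ℂ)

/-- The `κ`-moments `σ_ℓ[q,κ] = |𝕊^{d-1}|⁻¹ ∫_𝔹 q(x) φ_ℓ(√κ |x|)² dx`. -/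
def kappaMoment {d : ℕ} (ℓ : ℕ) (q : Potential d) (κ : ℂ) : ℂ :=
  (((sphereMeasure d).real Set.univ : ℝ) : ℂ)⁻¹ *
    ∫ x in ball d, (q x : ℂ) * phi d ℓ (csqrt κ * (‖x‖ : ℂ)) ^ 2

/-- `Y ∈ L²(𝕊^{d-1})` is a spherical harmonic of degree `ℓ`: the restriction to the sphere of a
complex harmonic homogeneous polynomial of degree `ℓ`. -/
def IsSphericalHarmonic {d : ℕ} (ℓ : ℕ) (Y : L2Sphere d) : Prop :=
  ∃ P : MvPolynomial (Fin d) ℂ, P.IsHomogeneous ℓ ∧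
    ∑ i, MvPolynomial.pderiv i (MvPolynomial.pderiv i P) = 0 ∧
    ∀ᵐ y ∂sphereMeasure d, Y y = MvPolynomial.eval (fun i => ((y : E d) i : ℂ)) P

/-- The action of a linear isometry of `ℝ^d` on the sphere. -/
def sphereMap {d : ℕ} (R : E d ≃ₗᵢ[ℝ] E d) (y : Sphere d) : Sphere d :=
  ⟨R y, by
    have h : ‖(y : E d)‖ = 1 := by simpa using y.2
    simp [h]⟩

/-- The operator `T` commutes with the action `f ↦ f ∘ R` of the rotations (and reflections) `R`. -/
def IsRotationInvariant {d : ℕ} (T : L2Sphere d →L[ℂ] L2Sphere d) : Prop :=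
  ∀ (R : E d ≃ₗᵢ[ℝ] E d) (f g : L2Sphere d),
    (∀ᵐ y ∂sphereMeasure d, g y = f (sphereMap R y)) →
      ∀ᵐ y ∂sphereMeasure d, T g y = T f (sphereMap R y)

end RadialCalderon

end

/-! Everything is moved to bounded operators on `L²` of the ball. Functions with their weak
gradients live in the Hilbert space `JetSpace d`, whose inner product is that of H¹, and `H10 d` is
the closure of the jets of test functions. For -Δ + 1 the Dirichlet problem is then Hilbert space
geometry: the solution of the homogeneous equation with boundary data F is the part of `jet F`
orthogonal to `H10 d` (`poissonJet`), and the solution operator S with zero boundary data is the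
inclusion ι of H¹₀ into L² composed with its adjoint (`solOp`). With P the Poisson operator and V
multiplication by q - κ - 1, a function u solves the problem for q iff (1 + S V) u = P f
(`helmholtzOp`). Since ι is compact (`isCompactOperator_inclH10`), the Fredholm alternative makes 1
+ S V invertible at q = 0, and invertibility is an open condition in q.

In Green's formula the test function may be replaced by its Poisson extension. The form then splits
into a pairing of two Poisson extensions, independent of q, and ⟨P h, V R P f⟩ with R = (1 + S V)⁻¹
(`IsDirichletSolution.energyForm_eq`). The first term cancels in the difference, so Λ_q - Λ_0 = P*(V
R - V₀ R₀)P. This is bounded because P is bounded from L² of the sphere to L² of the ball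
(`norm_sq_le_of_orthogonal`), which follows from testing with (1 - |x|²)u. No trace theory or
elliptic regularity is involved. Differentiating the ring inverse, and using that V₀ is a scalar,
gives the differential P* R₀ M_q R₀ P with M_q multiplication by q (`hasFDerivAt_Phi`).

For a harmonic homogeneous polynomial p of degree ℓ, R₀ P p is the separated Helmholtz solution p(x)
B(κ|x|²)/B(κ), where B is the entire part of the Bessel function (`helmholtzOp_helmholtzSol`). B(κ)
cannot vanish, as this would put a nonzero function in the kernel of 1 + S V₀
(`besselSeries_ne_zero`). Hence the matrix elements of the differential between spherical harmonics
are integrals of q against products of such solutions (`inner_dPhi`). For radial q, polar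
coordinates and the orthogonality of different degrees make them diagonal. Density of the spherical
harmonics finishes both the eigenvalue formula and the rotation invariance. -/

noncomputable section

namespace RadialCalderon

open scoped ENNReal ContDiff ComplexConjugate

variable {d : ℕ}

/-! ### Classes in `L²` -/

section ToL2

variable {α : Type*} [MeasurableSpace α] {μ : Measure α}

open scoped Classical in
/-- The class of `f` in `L²(μ)`, with the value `0` if `f` is not square integrable. -/
def toL2 (μ : Measure α) (f : α → ℂ) : Lp ℂ 2 μ :=
  if h : MemLp f 2 μ then h.toLp f else 0

theorem toL2_eq {f : α → ℂ} (h : MemLp f 2 μ) : toL2 μ f = h.toLp f := dif_pos h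

theorem coeFn_toL2 {f : α → ℂ} (h : MemLp f 2 μ) : toL2 μ f =ᵐ[μ] f := by
  rw [toL2_eq h]; exact h.coeFn_toLp

theorem toL2_coeFn (f : Lp ℂ 2 μ) : toL2 μ f = f := by
  rw [toL2_eq (Lp.memLp f), Lp.toLp_coeFn]

theorem eq_toL2_of_ae_eq {f : Lp ℂ 2 μ} {g : α → ℂ} (h : f =ᵐ[μ] g) : f = toL2 μ g := by
  have hg : MemLp g 2 μ := (memLp_congr_ae h).1 (Lp.memLp f)
  exact Lp.ext (h.trans (coeFn_toL2 hg).symm)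

theorem toL2_congr {f g : α → ℂ} (hf : MemLp f 2 μ) (h : f =ᵐ[μ] g) : toL2 μ f = toL2 μ g :=
  eq_toL2_of_ae_eq ((coeFn_toL2 hf).trans h)

theorem toL2_add {f g : α → ℂ} (hf : MemLp f 2 μ) (hg : MemLp g 2 μ) :
    toL2 μ (f + g) = toL2 μ f + toL2 μ g := by
  rw [toL2_eq hf, toL2_eq hg, toL2_eq (hf.add hg), MemLp.toLp_add]

theorem toL2_sub {f g : α → ℂ} (hf : MemLp f 2 μ) (hg : MemLp g 2 μ) :
    toL2 μ (f - g) = toL2 μ f - toL2 μ g := by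
  rw [toL2_eq hf, toL2_eq hg, toL2_eq (hf.sub hg), MemLp.toLp_sub]

theorem toL2_smul (c : ℂ) {f : α → ℂ} (hf : MemLp f 2 μ) : toL2 μ (c • f) = c • toL2 μ f := by
  rw [toL2_eq hf, toL2_eq (hf.const_smul c), MemLp.toLp_const_smul]

theorem inner_eq_integral_of_ae {f g : Lp ℂ 2 μ} {f' g' : α → ℂ} (hf : f =ᵐ[μ] f')
    (hg : g =ᵐ[μ] g') : inner ℂ f g = ∫ x, conj (f' x) * g' x ∂μ := by
  rw [L2.inner_def]
  refine integral_congr_ae ?_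
  filter_upwards [hf, hg] with x hx hy
  rw [hx, hy, RCLike.inner_apply, mul_comm]

theorem inner_toL2_left {f : α → ℂ} (hf : MemLp f 2 μ) (g : Lp ℂ 2 μ) :
    inner ℂ (toL2 μ f) g = ∫ x, conj (f x) * g x ∂μ :=
  inner_eq_integral_of_ae (coeFn_toL2 hf) (ae_eq_refl _)

theorem inner_toL2 {f g : α → ℂ} (hf : MemLp f 2 μ) (hg : MemLp g 2 μ) :
    inner ℂ (toL2 μ f) (toL2 μ g) = ∫ x, conj (f x) * g x ∂μ :=
  inner_eq_integral_of_ae (coeFn_toL2 hf) (coeFn_toL2 hg)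

theorem memLp_conj {f : α → ℂ} (hf : MemLp f 2 μ) : MemLp (fun x => conj (f x)) 2 μ := hf.star

theorem norm_sq_toL2 {f : α → ℂ} (hf : MemLp f 2 μ) :
    ‖toL2 μ f‖ ^ 2 = ∫ x, ‖f x‖ ^ 2 ∂μ := by
  have h := inner_self_eq_norm_sq_to_K (𝕜 := ℂ) (toL2 μ f)
  rw [inner_toL2 hf hf] at h
  have h2 : ∀ x, conj (f x) * f x = ((‖f x‖ ^ 2 : ℝ) : ℂ) := fun x => by
    rw [mul_comm, Complex.mul_conj, Complex.normSq_eq_norm_sq]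
  simp_rw [h2] at h
  rw [integral_complex_ofReal] at h
  apply Complex.ofReal_injective
  rw [Complex.ofReal_pow]
  exact h.symm

theorem tendsto_toL2_iff {ι : Type*} {l : Filter ι} {f : ι → α → ℂ} {g : α → ℂ}
    (hf : ∀ n, MemLp (f n) 2 μ) (hg : MemLp g 2 μ) :
    Tendsto (fun n => toL2 μ (f n)) l (𝓝 (toL2 μ g)) ↔
      Tendsto (fun n => eLpNorm (fun x => f n x - g x) 2 μ) l (𝓝 0) := by
  have h : ∀ n, toL2 μ (f n) = (hf n).toLp (f n) := fun n => toL2_eq (hf n)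
  simp_rw [h, toL2_eq hg]
  exact Lp.tendsto_Lp_iff_tendsto_eLpNorm'' f hf g hg

/-- Dominated convergence in `L²`. -/
theorem tendsto_toL2_of_dominated [IsFiniteMeasure μ] {f : ℕ → α → ℂ} {g : α → ℂ} (C : ℝ)
    (hf : ∀ n, AEStronglyMeasurable (f n) μ) (hb : ∀ n, ∀ᵐ x ∂μ, ‖f n x‖ ≤ C)
    (hlim : ∀ᵐ x ∂μ, Tendsto (fun n => f n x) atTop (𝓝 (g x))) :
    MemLp g 2 μ ∧ Tendsto (fun n => toL2 μ (f n)) atTop (𝓝 (toL2 μ g)) := by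
  have hgm : AEStronglyMeasurable g μ := aestronglyMeasurable_of_tendsto_ae _ hf hlim
  have hgb : ∀ᵐ x ∂μ, ‖g x‖ ≤ C := by
    filter_upwards [ae_all_iff.2 hb, hlim] with x h1 h2
    exact le_of_tendsto h2.norm (Eventually.of_forall h1)
  have hg : MemLp g 2 μ := MemLp.of_bound hgm C hgb
  have hfm : ∀ n, MemLp (f n) 2 μ := fun n => MemLp.of_bound (hf n) C (hb n)
  refine ⟨hg, ?_⟩
  rw [tendsto_iff_norm_sub_tendsto_zero]
  have key : Tendsto (fun n => ∫ x, ‖f n x - g x‖ ^ 2 ∂μ) atTop (𝓝 (∫ _, 0 ∂μ)) := by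
    refine tendsto_integral_of_dominated_convergence (fun _ => (2 * C) ^ 2) ?_ ?_ ?_ ?_
    · exact fun n => ((hf n).sub hgm).norm.pow 2
    · exact integrable_const _
    · intro n
      filter_upwards [hb n, hgb] with x h1 h2
      rw [Real.norm_of_nonneg (by positivity)]
      have := norm_sub_le (f n x) (g x)
      gcongr
      linarith
    · filter_upwards [hlim] with x hx
      have := ((tendsto_iff_norm_sub_tendsto_zero).1 hx).pow 2
      simpa using this
  have h2 : ∀ n, ‖toL2 μ (f n) - toL2 μ g‖ = Real.sqrt (∫ x, ‖f n x - g x‖ ^ 2 ∂μ) := fun n => by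
    rw [← toL2_sub (hfm n) hg, ← Real.sqrt_sq (norm_nonneg _), norm_sq_toL2 ((hfm n).sub hg)]
    rfl
  simp_rw [h2]
  simpa using key.sqrt

end ToL2

/-! ### Jets -/

/-- The complex space `L²(𝔹^d)`. -/
abbrev L2Ball (d : ℕ) : Type := Lp ℂ 2 (ballMeasure d)

/-- Pairs of a function in `L²(𝔹^d)` and a vector field in `L²(𝔹^d)^d`. -/
abbrev JetSpace (d : ℕ) : Type := PiLp 2 (fun _ : Option (Fin d) => L2Ball d)


instance : IsFiniteMeasure (ballMeasure d) :=
  ⟨by rw [Measure.restrict_apply_univ]; exact measure_ball_lt_top⟩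

/-- The function itself (`none`) or its `i`-th partial derivative (`some i`). -/
def jetComp (F : E d → ℂ) : Option (Fin d) → E d → ℂ
  | none => F
  | some i => partialDeriv i F

/-- The first jet `(F, ∇F)` as an element of `L²`. -/
def jet (F : E d → ℂ) : JetSpace d := WithLp.toLp 2 fun o => toL2 (ballMeasure d) (jetComp F o)

@[simp] theorem jet_none (F : E d → ℂ) : jet F none = toL2 (ballMeasure d) F := rfl

@[simp] theorem jet_some (F : E d → ℂ) (i : Fin d) :
    jet F (some i) = toL2 (ballMeasure d) (partialDeriv i F) := rfl

theorem exists_bound_on_ball {F : E d → ℂ} (hF : Continuous F) :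
    ∃ C, 0 ≤ C ∧ ∀ x ∈ ball d, ‖F x‖ ≤ C := by
  obtain ⟨C, hC⟩ := (isCompact_closedBall (0 : E d) 1).exists_bound_of_continuousOn hF.continuousOn
  exact ⟨max C 0, le_max_right _ _,
    fun x hx => (hC x (Metric.ball_subset_closedBall hx)).trans (le_max_left _ _)⟩

theorem memLp_ball {F : E d → ℂ} (hF : Continuous F) (p : ℝ≥0∞) : MemLp F p (ballMeasure d) := by
  obtain ⟨C, -, hC⟩ := exists_bound_on_ball hF
  exact MemLp.of_bound hF.aestronglyMeasurable C
    ((ae_restrict_mem measurableSet_ball).mono fun x hx => hC x hx)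

theorem integrable_ball {F : E d → ℂ} (hF : Continuous F) : Integrable F (ballMeasure d) :=
  memLp_one_iff_integrable.1 (memLp_ball hF 1)

theorem contDiff_partialDeriv {F : E d → ℂ} (hF : ContDiff ℝ ∞ F) (i : Fin d) :
    ContDiff ℝ ∞ (partialDeriv i F) := by
  have := hF.fderiv_right (m := ∞) (by simp)
  exact this.clm_apply contDiff_const

theorem contDiff_jetComp {F : E d → ℂ} (hF : ContDiff ℝ ∞ F) (o : Option (Fin d)) :
    ContDiff ℝ ∞ (jetComp F o) := by
  cases o with
  | none => exact hF
  | some i => exact contDiff_partialDeriv hF i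

theorem memLp_jetComp {F : E d → ℂ} (hF : ContDiff ℝ ∞ F) (o : Option (Fin d)) :
    MemLp (jetComp F o) 2 (ballMeasure d) :=
  memLp_ball (contDiff_jetComp hF o).continuous 2

theorem memLp_partialDeriv {F : E d → ℂ} (hF : ContDiff ℝ ∞ F) (i : Fin d) :
    MemLp (partialDeriv i F) 2 (ballMeasure d) := memLp_jetComp hF (some i)

theorem memLp_of_contDiff {F : E d → ℂ} (hF : ContDiff ℝ ∞ F) : MemLp F 2 (ballMeasure d) :=
  memLp_ball hF.continuous 2

theorem partialDeriv_add {F H : E d → ℂ} (hF : ContDiff ℝ ∞ F) (hH : ContDiff ℝ ∞ H) (i : Fin d) :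
    partialDeriv i (F + H) = partialDeriv i F + partialDeriv i H := by
  ext x
  simp only [partialDeriv, Pi.add_apply]
  rw [fderiv_add (hF.differentiable (by simp) x) (hH.differentiable (by simp) x)]
  rfl

theorem partialDeriv_smul (c : ℂ) {F : E d → ℂ} (hF : ContDiff ℝ ∞ F) (i : Fin d) :
    partialDeriv i (c • F) = c • partialDeriv i F := by
  ext x
  simp only [partialDeriv, Pi.smul_apply]
  rw [fderiv_const_smul (hF.differentiable (by simp) x)]
  rfl

theorem partialDeriv_mul {F H : E d → ℂ} (hF : ContDiff ℝ ∞ F) (hH : ContDiff ℝ ∞ H) (i : Fin d)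
    (x : E d) : partialDeriv i (fun x => F x * H x) x =
      F x * partialDeriv i H x + H x * partialDeriv i F x := by
  simp only [partialDeriv]
  rw [fderiv_fun_mul (hF.differentiable (by simp) x) (hH.differentiable (by simp) x)]
  rfl

theorem partialDeriv_conj (F : E d → ℂ) (i : Fin d) (x : E d) :
    partialDeriv i (fun x => conj (F x)) x = conj (partialDeriv i F x) := by
  have h : (fun x => conj (F x)) = Complex.conjCLE ∘ F := rfl
  simp only [partialDeriv]
  rw [h, ContinuousLinearEquiv.comp_fderiv]
  rfl

theorem contDiff_conj {F : E d → ℂ} (hF : ContDiff ℝ ∞ F) :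
    ContDiff ℝ ∞ (fun x => conj (F x)) :=
  Complex.conjCLE.contDiff.comp hF

/-- `C^∞(ℝ^d)`. -/
def smoothSpace (d : ℕ) : Submodule ℂ (E d → ℂ) where
  carrier := {F | ContDiff ℝ ∞ F}
  zero_mem' := (contDiff_const : ContDiff ℝ ∞ fun _ : E d => (0 : ℂ))
  add_mem' {F H} (h : ContDiff ℝ ∞ F) (h' : ContDiff ℝ ∞ H) := h.add h'
  smul_mem' c F (h : ContDiff ℝ ∞ F) := h.const_smul c

/-- `C_c^∞(𝔹^d)`. -/
def testSpace (d : ℕ) : Submodule ℂ (E d → ℂ) where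
  carrier := {F | IsTestFunction F}
  zero_mem' := ⟨contDiff_const, HasCompactSupport.zero, by
    have : tsupport (0 : E d → ℂ) = ∅ := by simp [tsupport]
    rw [this]; exact Set.empty_subset _⟩
  add_mem' h h' := ⟨h.smooth.add h'.smooth, h.compact.add h'.compact,
    (tsupport_add _ _).trans (Set.union_subset h.support h'.support)⟩
  smul_mem' c _ h := ⟨h.smooth.const_smul c, h.compact.smul_left (f := fun _ => c),
    (tsupport_smul_subset_right (fun _ => c) _).trans h.support⟩

/-- Taking jets, as a linear map. -/
def jetₗ (d : ℕ) : smoothSpace d →ₗ[ℂ] JetSpace d where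
  toFun F := jet F.1
  map_add' F H := by
    ext1 o
    cases o with
    | none => exact toL2_add (memLp_jetComp F.2 none) (memLp_jetComp H.2 none)
    | some i =>
      simp only [jet_some, PiLp.add_apply, Submodule.coe_add, partialDeriv_add F.2 H.2]
      exact toL2_add (memLp_jetComp F.2 (some i)) (memLp_jetComp H.2 (some i))
  map_smul' c F := by
    ext1 o
    cases o with
    | none => exact toL2_smul c (memLp_jetComp F.2 none)
    | some i =>
      simp only [jet_some, PiLp.smul_apply, Submodule.coe_smul, partialDeriv_smul c F.2,
        RingHom.id_apply]
      exact toL2_smul c (memLp_jetComp F.2 (some i))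

theorem jet_sub {F H : E d → ℂ} (hF : ContDiff ℝ ∞ F) (hH : ContDiff ℝ ∞ H) :
    jet (F - H) = jet F - jet H := (jetₗ d).map_sub ⟨F, hF⟩ ⟨H, hH⟩

/-- Jets of test functions. -/
def testJets (d : ℕ) : Submodule ℂ (JetSpace d) :=
  ((testSpace d).submoduleOf (smoothSpace d)).map (jetₗ d)

/-- `H¹₀(𝔹^d)` as a space of jets. -/
def H10 (d : ℕ) : Submodule ℂ (JetSpace d) := (testJets d).topologicalClosure

theorem mem_testJets {v : JetSpace d} : v ∈ testJets d ↔ ∃ φ, IsTestFunction φ ∧ jet φ = v := by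
  constructor
  · rintro ⟨F, hF, rfl⟩
    exact ⟨F.1, hF, rfl⟩
  · rintro ⟨φ, hφ, rfl⟩
    exact ⟨⟨φ, hφ.smooth⟩, hφ, rfl⟩

theorem jet_mem_H10 {φ : E d → ℂ} (hφ : IsTestFunction φ) : jet φ ∈ H10 d :=
  Submodule.le_topologicalClosure _ (mem_testJets.2 ⟨φ, hφ, rfl⟩)

theorem exists_seq_of_mem_H10 {v : JetSpace d} (hv : v ∈ H10 d) :
    ∃ φ : ℕ → E d → ℂ, (∀ n, IsTestFunction (φ n)) ∧
      Tendsto (fun n => jet (φ n)) atTop (𝓝 v) := by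
  obtain ⟨s, hs, hlim⟩ := mem_closure_iff_seq_limit.1 (show v ∈ closure (testJets d : Set _) from hv)
  choose φ hφ h using fun n => mem_testJets.1 (hs n)
  exact ⟨φ, hφ, by simpa [h] using hlim⟩

theorem mem_H10_of_tendsto {v : JetSpace d} {s : ℕ → JetSpace d} (hs : ∀ n, s n ∈ H10 d)
    (h : Tendsto s atTop (𝓝 v)) : v ∈ H10 d :=
  (Submodule.isClosed_topologicalClosure _).mem_of_tendsto h (Eventually.of_forall hs)

theorem tendsto_jetSpace_iff {ι : Type*} {l : Filter ι} {s : ι → JetSpace d} {v : JetSpace d} :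
    Tendsto s l (𝓝 v) ↔ ∀ o, Tendsto (fun n => s n o) l (𝓝 (v o)) := by
  constructor
  · intro h o
    exact ((PiLp.continuous_apply 2 (fun _ : Option (Fin d) => L2Ball d) o).tendsto v).comp h
  · intro h
    have h1 : Tendsto (fun n => WithLp.ofLp (s n)) l (𝓝 (WithLp.ofLp v)) := tendsto_pi_nhds.2 h
    exact ((PiLp.continuous_toLp 2 (fun _ : Option (Fin d) => L2Ball d)).tendsto _).comp h1

/-- On jets this is the H¹ inner product, that is, the form of -Δ + 1. This is why -Δ + 1 is the
reference operator throughout. -/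
theorem inner_jetSpace (v w : JetSpace d) :
    inner ℂ v w = inner ℂ (v none) (w none) + ∑ i : Fin d, inner ℂ (v (some i)) (w (some i)) := by
  rw [PiLp.inner_apply, Fintype.sum_option]

/-! ### Weak gradients -/

theorem IsTestFunction.conj {φ : E d → ℂ} (hφ : IsTestFunction φ) :
    IsTestFunction (fun x => conj (φ x)) := by
  have h : Function.support (fun x => starRingEnd ℂ (φ x)) = Function.support φ := by
    ext x; simp
  have h' : tsupport (fun x => starRingEnd ℂ (φ x)) = tsupport φ := by rw [tsupport, h, tsupport]
  exact ⟨contDiff_conj hφ.smooth, by rw [HasCompactSupport, h']; exact hφ.compact,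
    by rw [h']; exact hφ.support⟩

theorem IsTestFunction.mul_smooth {φ F : E d → ℂ} (hφ : IsTestFunction φ) (hF : ContDiff ℝ ∞ F) :
    IsTestFunction (fun x => φ x * F x) :=
  ⟨hφ.smooth.mul hF, hφ.compact.mul_right, (tsupport_mul_subset_left).trans hφ.support⟩

theorem partialDeriv_eq_zero_of_notMem {φ : E d → ℂ} {x : E d} (hx : x ∉ tsupport φ) (i : Fin d) :
    partialDeriv i φ x = 0 := by
  have h : fderiv ℝ φ x = 0 := by
    by_contra h
    exact hx (support_fderiv_subset ℝ h)
  simp [partialDeriv, h]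

theorem tsupport_partialDeriv_subset (φ : E d → ℂ) (i : Fin d) :
    tsupport (partialDeriv i φ) ⊆ tsupport φ := by
  refine closure_minimal (fun x hx => ?_) (isClosed_tsupport φ)
  by_contra h
  exact hx (partialDeriv_eq_zero_of_notMem h i)

theorem IsTestFunction.pderiv {φ : E d → ℂ} (hφ : IsTestFunction φ) (i : Fin d) :
    IsTestFunction (partialDeriv i φ) :=
  ⟨contDiff_partialDeriv hφ.smooth i,
    hφ.compact.mono' ((subset_tsupport _).trans (tsupport_partialDeriv_subset φ i)),
    (tsupport_partialDeriv_subset φ i).trans hφ.support⟩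

theorem IsTestFunction.eq_zero {φ : E d → ℂ} (hφ : IsTestFunction φ) {x : E d} (hx : x ∉ ball d) :
    φ x = 0 := image_eq_zero_of_notMem_tsupport fun h => hx (hφ.support h)

theorem integral_mul_partialDeriv {F φ : E d → ℂ} (hF : ContDiff ℝ ∞ F) (hφ : IsTestFunction φ)
    (i : Fin d) : ∫ x in ball d, F x * partialDeriv i φ x =
      -∫ x in ball d, partialDeriv i F x * φ x := by
  rw [setIntegral_eq_integral_of_forall_compl_eq_zero fun x hx => by
      rw [(hφ.pderiv i).eq_zero hx, mul_zero],
    setIntegral_eq_integral_of_forall_compl_eq_zero fun x hx => by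
      rw [hφ.eq_zero hx, mul_zero]]
  refine integral_mul_fderiv_eq_neg_fderiv_mul_of_integrable ?_ ?_ ?_
    (fun x _ => hF.differentiable (by simp) x) (fun x _ => hφ.smooth.differentiable (by simp) x)
  · exact ((contDiff_partialDeriv hF i).continuous.mul hφ.smooth.continuous).integrable_of_hasCompactSupport
      hφ.compact.mul_left
  · exact (hF.continuous.mul (hφ.pderiv i).smooth.continuous).integrable_of_hasCompactSupport
      (hφ.pderiv i).compact.mul_left
  · exact (hF.continuous.mul hφ.smooth.continuous).integrable_of_hasCompactSupport
      hφ.compact.mul_left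

theorem isH1_of_contDiff {F : E d → ℂ} (hF : ContDiff ℝ ∞ F) :
    IsH1 F (fun i => partialDeriv i F) :=
  ⟨memLp_jetComp hF none, fun i => memLp_jetComp hF (some i),
    fun i _ hφ => integral_mul_partialDeriv hF hφ i⟩

theorem IsH1.add {u v : E d → ℂ} {G H : Fin d → E d → ℂ} (h : IsH1 u G) (h' : IsH1 v H) :
    IsH1 (fun x => u x + v x) (fun i x => G i x + H i x) := by
  refine ⟨h.memLp.add h'.memLp, fun i => (h.memLp_grad i).add (h'.memLp_grad i), fun i φ hφ => ?_⟩
  have m1 : MemLp φ 2 (ballMeasure d) := memLp_jetComp hφ.smooth none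
  have m2 : MemLp (partialDeriv i φ) 2 (ballMeasure d) :=
    memLp_jetComp hφ.smooth (some i)
  have e1 := integral_add (h.memLp.integrable_mul m2) (h'.memLp.integrable_mul m2)
  have e2 := integral_add ((h.memLp_grad i).integrable_mul m1) ((h'.memLp_grad i).integrable_mul m1)
  simp only [Pi.mul_apply] at e1 e2
  simp_rw [add_mul]
  rw [e1, e2, h.weak_grad i φ hφ, h'.weak_grad i φ hφ, neg_add]

/-- The jet in `L²` of a function `u` with weak gradient `G`. -/
def weakJet (u : E d → ℂ) (G : Fin d → E d → ℂ) : JetSpace d :=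
  WithLp.toLp 2 fun o => o.elim (toL2 (ballMeasure d) u) fun i => toL2 (ballMeasure d) (G i)

@[simp] theorem weakJet_none (u : E d → ℂ) (G : Fin d → E d → ℂ) :
    weakJet u G none = toL2 (ballMeasure d) u := rfl

@[simp] theorem weakJet_some (u : E d → ℂ) (G : Fin d → E d → ℂ) (i : Fin d) :
    weakJet u G (some i) = toL2 (ballMeasure d) (G i) := rfl

theorem weakJet_coeFn (v : JetSpace d) : weakJet (v none) (fun i => v (some i)) = v := by
  ext1 o
  cases o <;> simp [toL2_coeFn]

theorem inner_toL2_conj_left {f : E d → ℂ} (hf : MemLp f 2 (ballMeasure d)) (g : L2Ball d) :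
    inner ℂ (toL2 (ballMeasure d) fun x => conj (f x)) g = ∫ x in ball d, g x * f x := by
  rw [inner_toL2_left (memLp_conj hf)]
  simp [mul_comm]

/-- Both sides of the weak gradient identity are L² pairings with a fixed test function, so the
identity passes from test functions to their limits. -/
theorem isH10_of_mem_H10 {v : JetSpace d} (hv : v ∈ H10 d) :
    IsH10 (v none) (fun i => v (some i)) := by
  obtain ⟨φ, hφ, hlim⟩ := exists_seq_of_mem_H10 hv
  have h := tendsto_jetSpace_iff.1 hlim
  refine ⟨⟨Lp.memLp _, fun i => Lp.memLp _, fun i ψ hψ => ?_⟩, φ, hφ, ?_, fun i => ?_⟩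
  · have m1 : MemLp ψ 2 (ballMeasure d) := memLp_jetComp hψ.smooth none
    have m2 : MemLp (partialDeriv i ψ) 2 (ballMeasure d) := memLp_partialDeriv hψ.smooth i
    rw [← inner_toL2_conj_left m1, ← inner_toL2_conj_left m2]
    have l1 := (tendsto_const_nhds (x := toL2 (ballMeasure d) fun x => conj (ψ x))).inner
      (𝕜 := ℂ) (h (some i))
    have l2 := (tendsto_const_nhds (x := toL2 (ballMeasure d) fun x => conj (partialDeriv i ψ x))).inner
      (𝕜 := ℂ) (h none)
    refine tendsto_nhds_unique l2 (l1.neg.congr fun n => ?_)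
    rw [inner_toL2_conj_left m1, inner_toL2_conj_left m2]
    have e1 : ∫ x in ball d, (jet (φ n) (some i) : L2Ball d) x * ψ x =
        ∫ x in ball d, partialDeriv i (φ n) x * ψ x := integral_congr_ae
      ((coeFn_toL2 (memLp_partialDeriv (hφ n).smooth i)).mul (ae_eq_refl ψ))
    have e2 : ∫ x in ball d, (jet (φ n) none : L2Ball d) x * partialDeriv i ψ x =
        ∫ x in ball d, φ n x * partialDeriv i ψ x := integral_congr_ae
      ((coeFn_toL2 (memLp_of_contDiff (hφ n).smooth)).mul (ae_eq_refl (partialDeriv i ψ)))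
    rw [e1, e2, integral_mul_partialDeriv (hφ n).smooth hψ i]
  · refine (tendsto_toL2_iff (fun n => memLp_jetComp (hφ n).smooth none) (Lp.memLp _)).1 ?_
    rw [toL2_coeFn]
    exact h none
  · refine (tendsto_toL2_iff (fun n => memLp_jetComp (hφ n).smooth (some i)) (Lp.memLp _)).1 ?_
    rw [toL2_coeFn]
    exact h (some i)

theorem mem_H10_of_isH10 {u : E d → ℂ} {G : Fin d → E d → ℂ} (h : IsH10 u G) :
    weakJet u G ∈ H10 d := by
  obtain ⟨φ, hφ, h1, h2⟩ := h.approx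
  refine mem_H10_of_tendsto (s := fun n => jet (φ n)) (fun n => jet_mem_H10 (hφ n)) ?_
  refine tendsto_jetSpace_iff.2 fun o => ?_
  cases o with
  | none =>
    exact (tendsto_toL2_iff (fun n => memLp_jetComp (hφ n).smooth none) h.isH1.memLp).2 h1
  | some i =>
    exact (tendsto_toL2_iff (fun n => memLp_jetComp (hφ n).smooth (some i)) (h.isH1.memLp_grad i)).2 (h2 i)

/-- The Laplacian `∑ ∂ᵢ²`. -/
def lap (F : E d → ℂ) (x : E d) : ℂ := ∑ i, partialDeriv i (partialDeriv i F) x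

theorem contDiff_lap {F : E d → ℂ} (hF : ContDiff ℝ ∞ F) : ContDiff ℝ ∞ (lap F) := by
  unfold lap
  exact ContDiff.sum fun i _ => contDiff_partialDeriv (contDiff_partialDeriv hF i) i

/-- Green's formula against `H¹₀(𝔹^d)`. -/
theorem inner_jet_of_mem_H10 {v : JetSpace d} (hv : v ∈ H10 d) {F : E d → ℂ}
    (hF : ContDiff ℝ ∞ F) :
    inner ℂ v (jet F) = inner ℂ (v none) (toL2 (ballMeasure d) fun x => F x - lap F x) := by
  obtain ⟨φ, hφ, hlim⟩ := exists_seq_of_mem_H10 hv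
  have l1 := hlim.inner (𝕜 := ℂ) (tendsto_const_nhds (x := jet F))
  have l2 := (tendsto_jetSpace_iff.1 hlim none).inner (𝕜 := ℂ)
    (tendsto_const_nhds (x := toL2 (ballMeasure d) fun x => F x - lap F x))
  refine tendsto_nhds_unique l1 (l2.congr fun n => ?_)
  have hs := (hφ n).smooth
  have hc := (hφ n).conj
  have hFl : ContDiff ℝ ∞ fun x => F x - lap F x := hF.sub (contDiff_lap hF)
  rw [inner_jetSpace]
  simp only [jet_none, jet_some]
  rw [inner_toL2 (memLp_ball hs.continuous 2) (memLp_ball hFl.continuous 2),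
    inner_toL2 (memLp_ball hs.continuous 2) (memLp_ball hF.continuous 2)]
  have e : ∀ i : Fin d, inner ℂ (toL2 (ballMeasure d) (partialDeriv i (φ n)))
      (toL2 (ballMeasure d) (partialDeriv i F)) =
      -∫ x in ball d, partialDeriv i (partialDeriv i F) x * conj (φ n x) := fun i => by
    rw [inner_toL2 (memLp_partialDeriv hs i) (memLp_partialDeriv hF i),
      ← integral_mul_partialDeriv (contDiff_partialDeriv hF i) hc]
    simp only [partialDeriv_conj, mul_comm]
  simp_rw [e]
  rw [Finset.sum_neg_distrib, ← integral_finsetSum, ← sub_eq_add_neg, ← integral_sub]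
  · congr 1
    ext x
    simp only [lap, mul_sub, Finset.mul_sum, mul_comm]
  · exact integrable_ball (hc.smooth.continuous.mul hF.continuous)
  · exact integrable_ball (by
      refine continuous_finsetSum _ fun i _ => Continuous.mul ?_ hc.smooth.continuous
      exact (contDiff_partialDeriv (contDiff_partialDeriv hF i) i).continuous)
  · exact fun i _ => integrable_ball
      ((contDiff_partialDeriv (contDiff_partialDeriv hF i) i).continuous.mul hc.smooth.continuous)

/-! ### Multiplication by the defining function `1 - |x|²` maps into `H¹₀` -/

theorem partialDeriv_comp_normSq {a : ℝ → ℂ} {a' : ℂ} {x : E d} (h : HasDerivAt a a' (‖x‖ ^ 2))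
    (i : Fin d) : partialDeriv i (fun x => a (‖x‖ ^ 2)) x = 2 * (x i : ℂ) * a' := by
  have h1 := h.hasFDerivAt.comp x (hasStrictFDerivAt_norm_sq x).hasFDerivAt
  have h2 : (fun x : E d => a (‖x‖ ^ 2)) = a ∘ fun x => ‖x‖ ^ 2 := rfl
  simp only [partialDeriv]
  rw [h2, h1.fderiv]
  simp [EuclideanSpace.inner_single_right]
  ring

theorem contDiff_comp_normSq {a : ℝ → ℂ} (ha : ContDiff ℝ ∞ a) :
    ContDiff ℝ ∞ (fun x : E d => a (‖x‖ ^ 2)) :=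
  ha.comp (contDiff_norm_sq ℝ)

/-- A smooth approximation of the identity function that vanishes near `(-∞, 0]`. -/
def cutoff (n : ℕ) (t : ℝ) : ℝ := ∫ s in (0 : ℝ)..t, Real.smoothTransition (n * s - 1)

theorem continuous_smoothTransition_comp (n : ℕ) :
    Continuous fun s : ℝ => Real.smoothTransition (n * s - 1) :=
  Real.smoothTransition.continuous.comp (by fun_prop)

theorem hasDerivAt_cutoff (n : ℕ) (t : ℝ) :
    HasDerivAt (cutoff n) (Real.smoothTransition (n * t - 1)) t :=
  intervalIntegral.integral_hasDerivAt_right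
    ((continuous_smoothTransition_comp n).intervalIntegrable _ _)
    ((continuous_smoothTransition_comp n).stronglyMeasurableAtFilter _ _)
    (continuous_smoothTransition_comp n).continuousAt

theorem contDiff_cutoff (n : ℕ) : ContDiff ℝ ∞ (cutoff n) := by
  have h : deriv (cutoff n) = fun s => Real.smoothTransition (n * s - 1) :=
    funext fun t => (hasDerivAt_cutoff n t).deriv
  refine contDiff_infty_iff_deriv.2 ⟨fun t => (hasDerivAt_cutoff n t).differentiableAt, ?_⟩
  rw [h]
  exact Real.smoothTransition.contDiff.comp (by fun_prop)

theorem cutoff_eq_zero {n : ℕ} {t : ℝ} (h : n * t ≤ 1) : cutoff n t = 0 := by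
  have : cutoff n t = ∫ s in (0 : ℝ)..t, (0 : ℝ) := by
    refine intervalIntegral.integral_congr fun s hs => ?_
    refine Real.smoothTransition.zero_of_nonpos ?_
    have hn : (0 : ℝ) ≤ n := n.cast_nonneg
    rcases Set.mem_uIcc.1 hs with h' | h'
    · nlinarith
    · nlinarith
  rw [this, intervalIntegral.integral_zero]

theorem abs_cutoff_le (n : ℕ) (t : ℝ) : |cutoff n t| ≤ |t| := by
  have := intervalIntegral.norm_integral_le_of_norm_le_const (a := 0) (b := t) (C := 1)
    (f := fun s => Real.smoothTransition (n * s - 1)) fun s _ => by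
      rw [Real.norm_of_nonneg (Real.smoothTransition.nonneg _)]
      exact Real.smoothTransition.le_one _
  simpa [cutoff] using this

theorem tendsto_smoothTransition_mul {s : ℝ} (hs : 0 < s) :
    Tendsto (fun n : ℕ => Real.smoothTransition (n * s - 1)) atTop (𝓝 1) := by
  refine tendsto_const_nhds.congr' ?_
  have h : Tendsto (fun n : ℕ => (n : ℝ) * s) atTop atTop :=
    tendsto_natCast_atTop_atTop.atTop_mul_const hs
  filter_upwards [h.eventually_ge_atTop 2] with n hn
  rw [Real.smoothTransition.one_of_one_le (by linarith)]

theorem tendsto_cutoff {t : ℝ} (ht : 0 < t) :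
    Tendsto (fun n => cutoff n t) atTop (𝓝 t) := by
  have h : Tendsto (fun n => cutoff n t) atTop (𝓝 (∫ _ in (0 : ℝ)..t, (1 : ℝ))) := by
    refine intervalIntegral.tendsto_integral_filter_of_dominated_convergence (fun _ => 1) ?_ ?_ ?_ ?_
    · exact Eventually.of_forall fun n =>
        (continuous_smoothTransition_comp n).aestronglyMeasurable
    · refine Eventually.of_forall fun n => Eventually.of_forall fun s _ => ?_
      rw [Real.norm_of_nonneg (Real.smoothTransition.nonneg _)]
      exact Real.smoothTransition.le_one _
    · exact intervalIntegrable_const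
    · refine Eventually.of_forall fun s hs => ?_
      rw [Set.uIoc_of_le ht.le] at hs
      exact tendsto_smoothTransition_mul hs.1
  simpa using h

/-- The function `1 - |x|²`. -/
def defFun (x : E d) : ℂ := ((1 - ‖x‖ ^ 2 : ℝ) : ℂ)

theorem contDiff_defFun : ContDiff ℝ ∞ (defFun (d := d)) :=
  contDiff_comp_normSq (a := fun s => ((1 - s : ℝ) : ℂ))
    (Complex.ofRealCLM.contDiff.comp (contDiff_const.sub contDiff_id))

theorem partialDeriv_defFun (i : Fin d) (x : E d) : partialDeriv i defFun x = -2 * (x i : ℂ) := by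
  have h : HasDerivAt (fun s : ℝ => ((1 - s : ℝ) : ℂ)) ((-1 : ℝ) : ℂ) (‖x‖ ^ 2) :=
    HasDerivAt.ofReal_comp (by simpa using (hasDerivAt_id (‖x‖ ^ 2)).const_sub 1)
  have := partialDeriv_comp_normSq h i
  rw [show defFun = fun x : E d => (((1 - ‖x‖ ^ 2 : ℝ)) : ℂ) from rfl, this]
  push_cast
  ring

theorem contDiff_cutoff_normSq (n : ℕ) :
    ContDiff ℝ ∞ (fun x : E d => ((cutoff n (1 - ‖x‖ ^ 2) : ℝ) : ℂ)) :=
  contDiff_comp_normSq (a := fun s => ((cutoff n (1 - s) : ℝ) : ℂ))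
    (Complex.ofRealCLM.contDiff.comp ((contDiff_cutoff n).comp (contDiff_const.sub contDiff_id)))

theorem isTestFunction_cutoff (n : ℕ) :
    IsTestFunction (fun x : E d => ((cutoff n (1 - ‖x‖ ^ 2) : ℝ) : ℂ)) := by
  have hsub : tsupport (fun x : E d => ((cutoff n (1 - ‖x‖ ^ 2) : ℝ) : ℂ)) ⊆
      {x | 1 ≤ n * (1 - ‖x‖ ^ 2)} := by
    refine closure_minimal (fun x hx => ?_)
      (isClosed_le continuous_const (by fun_prop))
    by_contra h
    exact hx (by simp [cutoff_eq_zero (not_le.1 h).le])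
  have hball : {x : E d | 1 ≤ n * (1 - ‖x‖ ^ 2)} ⊆ ball d := fun x (hx : 1 ≤ n * (1 - ‖x‖ ^ 2)) => by
    rw [mem_ball_zero_iff]
    have hn : (0 : ℝ) ≤ n := n.cast_nonneg
    by_contra h
    have h' : 1 - ‖x‖ ^ 2 ≤ 0 := by nlinarith [not_lt.1 h]
    nlinarith
  refine ⟨contDiff_cutoff_normSq n, ?_, hsub.trans hball⟩
  exact HasCompactSupport.of_support_subset_isCompact (isCompact_closedBall (0 : E d) 1)
    ((subset_tsupport _).trans ((hsub.trans hball).trans Metric.ball_subset_closedBall))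

theorem partialDeriv_cutoff (n : ℕ) (i : Fin d) (x : E d) :
    partialDeriv i (fun x : E d => ((cutoff n (1 - ‖x‖ ^ 2) : ℝ) : ℂ)) x =
      -2 * (x i : ℂ) * ((Real.smoothTransition (n * (1 - ‖x‖ ^ 2) - 1) : ℝ) : ℂ) := by
  have h1 := (hasDerivAt_cutoff n (1 - ‖x‖ ^ 2)).comp (‖x‖ ^ 2)
    ((hasDerivAt_id (‖x‖ ^ 2)).const_sub 1)
  have := partialDeriv_comp_normSq h1.ofReal_comp i
  simp only [Function.comp_def] at this
  rw [this]
  push_cast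
  ring

theorem norm_coord_le (x : E d) (i : Fin d) : ‖(x i : ℂ)‖ ≤ ‖x‖ := by
  rw [Complex.norm_real]
  exact PiLp.norm_apply_le x i

/-- The functions `cutoff n (1 - |x|²)` are test functions that converge to 1 - |x|² inside the
ball, boundedly and together with their gradients. After multiplication by Ψ, dominated convergence
applies to every component of the jet. Ψ need not vanish on the sphere. -/
theorem jet_defFun_mul_mem_H10 {Ψ : E d → ℂ} (hΨ : ContDiff ℝ ∞ Ψ) :
    jet (fun x => defFun x * Ψ x) ∈ H10 d := by
  let φ : ℕ → E d → ℂ := fun n x => ((cutoff n (1 - ‖x‖ ^ 2) : ℝ) : ℂ) * Ψ x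
  have hφ : ∀ n, IsTestFunction (φ n) := fun n => (isTestFunction_cutoff n).mul_smooth hΨ
  refine mem_H10_of_tendsto (s := fun n => jet (φ n)) (fun n => jet_mem_H10 (hφ n)) ?_
  have hpos : ∀ x ∈ ball d, 0 < 1 - ‖x‖ ^ 2 := fun x hx => by
    have := mem_ball_zero_iff.1 hx
    nlinarith [norm_nonneg x]
  have hb : ∀ n, ∀ x ∈ ball d, ‖((cutoff n (1 - ‖x‖ ^ 2) : ℝ) : ℂ)‖ ≤ 1 := fun n x hx => by
    rw [Complex.norm_real, Real.norm_eq_abs]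
    refine (abs_cutoff_le _ _).trans ?_
    rw [abs_of_pos (hpos x hx)]
    nlinarith [norm_nonneg x]
  obtain ⟨C, hC0, hC⟩ := exists_bound_on_ball hΨ.continuous
  have hlim : ∀ x ∈ ball d, Tendsto (fun n => ((cutoff n (1 - ‖x‖ ^ 2) : ℝ) : ℂ)) atTop
      (𝓝 (defFun x)) := fun x hx =>
    (Complex.continuous_ofReal.tendsto _).comp (tendsto_cutoff (hpos x hx))
  refine tendsto_jetSpace_iff.2 fun o => ?_
  cases o with
  | none =>
    refine (tendsto_toL2_of_dominated C
      (fun n => (hφ n).smooth.continuous.aestronglyMeasurable) (fun n => ?_) ?_).2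
    · filter_upwards [ae_restrict_mem measurableSet_ball] with x hx
      rw [norm_mul]
      nlinarith [hb n x hx, hC x hx, norm_nonneg (Ψ x)]
    · filter_upwards [ae_restrict_mem measurableSet_ball] with x hx
      exact (hlim x hx).mul_const _
  | some i =>
    obtain ⟨C', hC0', hC'⟩ := exists_bound_on_ball (contDiff_partialDeriv hΨ i).continuous
    refine (tendsto_toL2_of_dominated (C' + C * 2)
      (fun n => (contDiff_partialDeriv (hφ n).smooth i).continuous.aestronglyMeasurable)
      (fun n => ?_) ?_).2
    · filter_upwards [ae_restrict_mem measurableSet_ball] with x hx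
      simp only [φ]
      rw [partialDeriv_mul (contDiff_cutoff_normSq n) hΨ, partialDeriv_cutoff]
      refine (norm_add_le _ _).trans (add_le_add ?_ ?_)
      · rw [norm_mul]
        nlinarith [hb n x hx, hC' x hx, norm_nonneg (partialDeriv i Ψ x)]
      · rw [norm_mul, norm_mul, norm_mul, Complex.norm_real (Real.smoothTransition _),
          Real.norm_of_nonneg (Real.smoothTransition.nonneg _)]
        have h1 : ‖(x i : ℂ)‖ ≤ 1 := (norm_coord_le x i).trans (mem_ball_zero_iff.1 hx).le
        have h2 := Real.smoothTransition.le_one (n * (1 - ‖x‖ ^ 2) - 1)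
        have h3 := Real.smoothTransition.nonneg (n * (1 - ‖x‖ ^ 2) - 1)
        have h4 : ‖(-2 : ℂ)‖ = 2 := by simp
        rw [h4, mul_assoc 2]
        exact mul_le_mul (hC x hx) (by nlinarith [mul_le_one₀ h1 h3 h2]) (by positivity) hC0
    · filter_upwards [ae_restrict_mem measurableSet_ball] with x hx
      have e : ∀ n, partialDeriv i (φ n) x = ((cutoff n (1 - ‖x‖ ^ 2) : ℝ) : ℂ) * partialDeriv i Ψ x +
          Ψ x * (-2 * (x i : ℂ) * ((Real.smoothTransition (n * (1 - ‖x‖ ^ 2) - 1) : ℝ) : ℂ)) :=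
        fun n => by
          rw [← partialDeriv_cutoff, ← partialDeriv_mul (contDiff_cutoff_normSq n) hΨ]
      have e' : jetComp (fun x => defFun x * Ψ x) (some i) x =
          defFun x * partialDeriv i Ψ x + Ψ x * (-2 * (x i : ℂ)) := by
        rw [← partialDeriv_defFun, ← partialDeriv_mul contDiff_defFun hΨ]
        rfl
      rw [e']
      simp_rw [e]
      refine ((hlim x hx).mul_const _).add (Tendsto.const_mul _ ?_)
      have h5 := (Complex.continuous_ofReal.tendsto _).comp (tendsto_smoothTransition_mul (hpos x hx))
      simpa using h5.const_mul (-2 * (x i : ℂ))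

/-! ### Polar coordinates -/

theorem integral_volumeIoiPow (n : ℕ) (g : ℝ → ℂ) :
    ∫ r : Set.Ioi (0 : ℝ), g r ∂Measure.volumeIoiPow n =
      ∫ r in Set.Ioi (0 : ℝ), ((r ^ n : ℝ) : ℂ) * g r := by
  simp only [Measure.volumeIoiPow, ENNReal.ofReal]
  rw [integral_withDensity_eq_integral_smul,
    integral_subtype_comap measurableSet_Ioi fun a => Real.toNNReal (a ^ n) • g a,
    setIntegral_congr_fun measurableSet_Ioi fun x hx => ?_]
  · rw [NNReal.smul_def, Real.coe_toNNReal _ (pow_nonneg (le_of_lt hx) _), Complex.real_smul]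
  · exact (measurable_subtype_coe.pow_const _).real_toNNReal

theorem smul_mem_ball_iff {y : Sphere d} {r : ℝ} (hr : 0 < r) :
    r • (y : E d) ∈ ball d ↔ r < 1 := by
  have h : ‖(y : E d)‖ = 1 := by simp
  rw [mem_ball_zero_iff, norm_smul, h, mul_one, Real.norm_of_nonneg hr.le]

theorem integral_ball_eq_polar (hd : 0 < d) {f : E d → ℂ} (hf : Integrable f (ballMeasure d)) :
    ∫ x in ball d, f x = ∫ y : Sphere d, (∫ r in Set.Ioo (0 : ℝ) 1,
      ((r ^ (d - 1) : ℝ) : ℂ) * f (r • (y : E d))) ∂sphereMeasure d := by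
  have : Nonempty (Fin d) := ⟨⟨0, hd⟩⟩
  let g : E d → ℂ := (ball d).indicator f
  have hg : Integrable g := (integrable_indicator_iff measurableSet_ball).2 hf
  have hmp := (volume : Measure (E d)).measurePreserving_homeomorphUnitSphereProd
  rw [finrank_euclideanSpace_fin] at hmp
  have hemb := (homeomorphUnitSphereProd (E d)).measurableEmbedding
  let G : Sphere d × Set.Ioi (0 : ℝ) → ℂ := fun p => g ((p.2 : ℝ) • (p.1 : E d))
  have hG : ∀ x : ({(0 : E d)}ᶜ : Set (E d)), G (homeomorphUnitSphereProd (E d) x) = g x := by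
    intro x
    have := congrArg Subtype.val ((homeomorphUnitSphereProd (E d)).symm_apply_apply x)
    rw [homeomorphUnitSphereProd_symm_apply_coe] at this
    simp only [G, this]
  have hGi : Integrable G (Measure.prod (sphereMeasure d) (Measure.volumeIoiPow (d - 1))) := by
    rw [← hmp.integrable_comp_emb hemb]
    have : G ∘ homeomorphUnitSphereProd (E d) = g ∘ Subtype.val := funext hG
    rw [this, ← integrableOn_iff_comap_subtypeVal (measurableSet_singleton _).compl]
    exact hg.integrableOn
  -- The origin, where polar coordinates break down, is a null set because `d > 0`.
  rw [← integral_indicator measurableSet_ball, ← restrict_compl_singleton (μ := volume) (0 : E d),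
    ← integral_subtype_comap (measurableSet_singleton _).compl]
  have h1 := hmp.integral_comp hemb G
  simp_rw [hG] at h1
  rw [h1, integral_prod _ hGi]
  refine integral_congr_ae (Eventually.of_forall fun y => ?_)
  simp only [G]
  rw [integral_volumeIoiPow (d - 1) (fun r => g (r • (y : E d)))]
  rw [← Set.Ioi_inter_Iio, ← setIntegral_indicator measurableSet_Iio]
  refine setIntegral_congr_fun measurableSet_Ioi fun r hr => ?_
  by_cases h : r < 1
  · simp [g, Set.indicator_of_mem ((smul_mem_ball_iff (y := y) hr).2 h),
      Set.indicator_of_mem (show r ∈ Set.Iio (1 : ℝ) from h)]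
  · simp [g, Set.indicator_of_notMem (fun h' => h ((smul_mem_ball_iff (y := y) hr).1 h')),
      Set.indicator_of_notMem (show r ∉ Set.Iio (1 : ℝ) from h)]

/-- Needed because a radial potential is radial only almost everywhere. A null set in the ball meets
almost every ray in a null set: Fubini gives this for the weight r^(d-1), which is positive on the
ray and so can be dropped. -/
theorem ae_polar (hd : 0 < d) {p : E d → Prop} (hp : ∀ᵐ x ∂ballMeasure d, p x) :
    ∀ᵐ y : Sphere d ∂sphereMeasure d, ∀ᵐ r : ℝ ∂volume.restrict (Set.Ioo (0 : ℝ) 1), p (r • (y : E d)) := by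
  have : Nonempty (Fin d) := ⟨⟨0, hd⟩⟩
  have hmp := (volume : Measure (E d)).measurePreserving_homeomorphUnitSphereProd
  rw [finrank_euclideanSpace_fin] at hmp
  have hemb := (homeomorphUnitSphereProd (E d)).measurableEmbedding
  have h0 : ∀ᵐ x : E d, x ∈ ball d → p x := (ae_restrict_iff' measurableSet_ball).1 hp
  have h1 : ∀ᵐ x : ({(0 : E d)}ᶜ : Set (E d)) ∂(volume.comap Subtype.val), (x : E d) ∈ ball d → p x := by
    refine (MeasurableEmbedding.subtype_coe (measurableSet_singleton (0 : E d)).compl).ae_map_iff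
      (p := fun x => x ∈ ball d → p x) |>.1 ?_
    rwa [map_comap_subtype_coe (measurableSet_singleton _).compl, restrict_compl_singleton]
  have h2 : ∀ᵐ z ∂(Measure.prod (sphereMeasure d) (Measure.volumeIoiPow (d - 1))),
      ((z.2 : ℝ) • (z.1 : E d)) ∈ ball d → p ((z.2 : ℝ) • (z.1 : E d)) := by
    rw [← hmp.map_eq, hemb.ae_map_iff]
    filter_upwards [h1] with x hx
    have := congrArg Subtype.val ((homeomorphUnitSphereProd (E d)).symm_apply_apply x)
    rw [homeomorphUnitSphereProd_symm_apply_coe] at this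
    rwa [this]
  filter_upwards [Measure.ae_ae_of_ae_prod h2] with y hy
  rw [Measure.volumeIoiPow, ae_withDensity_iff (by fun_prop)] at hy
  rw [ae_restrict_iff' measurableSet_Ioo]
  have hy' : ∀ᵐ r : Set.Ioi (0 : ℝ) ∂(volume.comap Subtype.val), (r : ℝ) < 1 →
      p ((r : ℝ) • (y : E d)) := by
    filter_upwards [hy] with r hr h
    exact hr (by simpa using pow_pos r.2 _) ((smul_mem_ball_iff r.2).2 h)
  have h3 := ((MeasurableEmbedding.subtype_coe (measurableSet_Ioi (a := (0 : ℝ)))).ae_map_iff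
    (p := fun r => r < 1 → p (r • (y : E d)))).2 hy'
  rw [map_comap_subtype_coe measurableSet_Ioi, ae_restrict_iff' measurableSet_Ioi] at h3
  filter_upwards [h3] with r hr h using hr h.1 h.2

theorem fderiv_apply_eq_sum (F : E d → ℂ) (x v : E d) :
    fderiv ℝ F x v = ∑ i, (v i : ℂ) * partialDeriv i F x := by
  conv_lhs => rw [← (EuclideanSpace.basisFun (Fin d) ℝ).sum_repr v]
  simp [partialDeriv, map_sum]

/-- The divergence theorem on the ball for the vector field `g(x) x`. -/
theorem integral_ball_radial_divergence (hd : 0 < d) {g : E d → ℂ} (hg : ContDiff ℝ ∞ g) :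
    ∫ x in ball d, ((∑ i, (x i : ℂ) * partialDeriv i g x) + d * g x) =
      ∫ y, g y ∂sphereMeasure d := by
  have hcont : Continuous fun x : E d => fderiv ℝ g x x + d * g x :=
    ((hg.continuous_fderiv (by simp)).clm_apply continuous_id).add
      (continuous_const.mul hg.continuous)
  simp_rw [← fderiv_apply_eq_sum]
  rw [integral_ball_eq_polar hd (integrable_ball hcont)]
  refine integral_congr_ae (Eventually.of_forall fun y => ?_)
  simp only
  rw [← integral_Ioc_eq_integral_Ioo, ← intervalIntegral.integral_of_le zero_le_one]
  -- Along a ray the integrand is the derivative of r^d g(ry). The boundary term at r = 0 vanishes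
  -- since `d > 0`.
  have hder : ∀ r ∈ Set.uIcc (0 : ℝ) 1, HasDerivAt (fun r : ℝ => ((r ^ d : ℝ) : ℂ) * g (r • (y : E d)))
      (((r ^ (d - 1) : ℝ) : ℂ) * (fderiv ℝ g (r • (y : E d)) (r • (y : E d)) +
        d * g (r • (y : E d)))) r := fun r _ => by
    have h1 : HasDerivAt (fun r : ℝ => r • (y : E d)) (y : E d) r := by
      simpa using (hasDerivAt_id r).smul_const (y : E d)
    have h2 : HasDerivAt (fun r : ℝ => g (r • (y : E d))) (fderiv ℝ g (r • (y : E d)) (y : E d)) r :=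
      (hg.differentiable (by simp) _).hasFDerivAt.comp_hasDerivAt r h1
    refine (((hasDerivAt_pow d r).ofReal_comp).mul h2).congr_deriv ?_
    rw [map_smul, Complex.real_smul]
    obtain ⟨m, rfl⟩ : ∃ m, d = m + 1 := ⟨d - 1, by omega⟩
    push_cast
    ring
  rw [intervalIntegral.integral_eq_sub_of_hasDerivAt hder]
  · simp [hd.ne']
  · refine Continuous.intervalIntegrable ?_ _ _
    exact (Complex.continuous_ofReal.comp (continuous_id.pow _)).mul
      (hcont.comp (continuous_id.smul continuous_const))

/-! ### Multiplication operators -/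

/-- Multiplication by a real bounded function on `L²(𝔹^d)`. -/
def mulOp (d : ℕ) : Potential d →L[ℝ] (L2Ball d →L[ℂ] L2Ball d) :=
  (((ContinuousLinearMap.mul ℂ ℂ).holderL (ballMeasure d) ∞ 2 2).restrictScalars ℝ).comp
    (Complex.ofRealCLM.compLpL ∞ (ballMeasure d))

theorem coeFn_mulOp (q : Potential d) (f : L2Ball d) :
    mulOp d q f =ᵐ[ballMeasure d] fun x => (q x : ℂ) * f x := by
  have h1 := (ContinuousLinearMap.mul ℂ ℂ).coeFn_holder (r := 2)
    (Complex.ofRealCLM.compLp q : Lp ℂ ∞ (ballMeasure d)) f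
  have h2 := Complex.ofRealCLM.coeFn_compLp q
  filter_upwards [h1, h2] with x hx hy
  rw [hy] at hx
  exact hx

theorem inner_mulOp_left (q : Potential d) (f g : L2Ball d) :
    inner ℂ (mulOp d q f) g = inner ℂ f (mulOp d q g) := by
  rw [inner_eq_integral_of_ae (coeFn_mulOp q f) (ae_eq_refl g),
    inner_eq_integral_of_ae (ae_eq_refl f) (coeFn_mulOp q g)]
  congr 1
  ext x
  simp only [map_mul, Complex.conj_ofReal]
  ring

/-- The class in `L^∞(𝔹^d)` of a continuous function. -/
def toPotential (a : C(E d, ℝ)) : Potential d :=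
  MemLp.toLp a (by
    obtain ⟨C, hC⟩ := (isCompact_closedBall (0 : E d) 1).exists_bound_of_continuousOn
      a.continuous.continuousOn
    exact MemLp.of_bound a.continuous.aestronglyMeasurable C
      ((ae_restrict_mem measurableSet_ball).mono fun x hx => hC x (Metric.ball_subset_closedBall hx)))

theorem coeFn_toPotential (a : C(E d, ℝ)) : toPotential a =ᵐ[ballMeasure d] a :=
  MemLp.coeFn_toLp _

theorem mulOp_toPotential_toL2 (a : C(E d, ℝ)) {f : E d → ℂ} (hf : MemLp f 2 (ballMeasure d)) :
    mulOp d (toPotential a) (toL2 (ballMeasure d) f) =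
      toL2 (ballMeasure d) (fun x => (a x : ℂ) * f x) := by
  refine eq_toL2_of_ae_eq ((coeFn_mulOp _ _).trans ?_)
  filter_upwards [coeFn_toPotential a, coeFn_toL2 hf] with x h1 h2
  rw [h1, h2]

/-! ### The `L²` bound for the Poisson extension -/

instance : CompleteSpace (H10 d) :=
  (Submodule.isClosed_topologicalClosure _).completeSpace_coe

/-- The `i`-th coordinate. -/
def coordMap (i : Fin d) : C(E d, ℝ) := ⟨fun x => x i, by fun_prop⟩

/-- The function `1 - |x|²`. -/
def defMap (d : ℕ) : C(E d, ℝ) := ⟨fun x => 1 - ‖x‖ ^ 2, by fun_prop⟩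

theorem re_inner_mulOp_defMap_nonneg (f : L2Ball d) :
    0 ≤ (inner ℂ f (mulOp d (toPotential (defMap d)) f)).re := by
  rw [inner_eq_integral_of_ae (ae_eq_refl f) (g' := fun x => ((1 - ‖x‖ ^ 2 : ℝ) : ℂ) * f x)]
  · have h : ∀ x : E d, conj (f x) * (((1 - ‖x‖ ^ 2 : ℝ) : ℂ) * f x) =
        (((1 - ‖x‖ ^ 2) * ‖f x‖ ^ 2 : ℝ) : ℂ) := fun x => by
      push_cast
      rw [← Complex.conj_mul' (f x)]
      ring
    simp_rw [h]
    rw [integral_complex_ofReal, Complex.ofReal_re]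
    refine setIntegral_nonneg measurableSet_ball fun x hx => ?_
    have := mem_ball_zero_iff.1 hx
    have : 0 ≤ 1 - ‖x‖ ^ 2 := by nlinarith [norm_nonneg x]
    positivity
  · filter_upwards [coeFn_mulOp (toPotential (defMap d)) f, coeFn_toPotential (defMap d)]
      with x h1 h2
    rw [h1, h2]
    rfl

/-- Let u be the function component of X. As (1 - |x|²)u lies in H¹₀, its H¹ inner product with u is
zero: ∫ (1 - |x|²)(|u|² + |∇u|²) = 2 ∫ ū x·∇u. The left side is nonnegative. The factor 1 - |x|² is
applied to smooth approximations `F - φ n` of u, for which membership in `H10 d` is known. -/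
theorem sum_re_inner_coord_nonneg {F : E d → ℂ} (hF : ContDiff ℝ ∞ F) {X : JetSpace d}
    (hX : ∀ v ∈ H10 d, inner ℂ v X = 0) (hFX : jet F - X ∈ H10 d) :
    0 ≤ (∑ i, inner ℂ (X none) (mulOp d (toPotential (coordMap i)) (X (some i)))).re := by
  obtain ⟨φ, hφ, hlim⟩ := exists_seq_of_mem_H10 hFX
  have hu : ∀ n, ContDiff ℝ ∞ (F - φ n) := fun n => hF.sub (hφ n).smooth
  have hl : Tendsto (fun n => jet (F - φ n)) atTop (𝓝 X) := by
    have := (tendsto_const_nhds (x := jet F)).sub hlim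
    simpa [jet_sub hF (hφ _).smooth] using this
  have hl' := tendsto_jetSpace_iff.1 hl
  set W := mulOp d (toPotential (defMap d)) with hW
  -- Orthogonality of X to the jet of (1 - |x|²)(F - φ n), expanded with ∇((1 - |x|²)w) = (1 -
  -- |x|²)∇w - 2xw.
  have key : ∀ n, inner ℂ (jet (F - φ n) none) (W (X none)) +
      ∑ i, inner ℂ (jet (F - φ n) (some i)) (W (X (some i))) -
      2 * ∑ i, inner ℂ (jet (F - φ n) none) (mulOp d (toPotential (coordMap i)) (X (some i))) = 0 := by
    intro n
    rw [← hX _ (jet_defFun_mul_mem_H10 (hu n)), inner_jetSpace]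
    have e0 : jet (fun x => defFun x * (F - φ n) x) none = W (jet (F - φ n) none) := by
      rw [jet_none, jet_none, hW, mulOp_toPotential_toL2 _ (memLp_of_contDiff (hu n))]
      rfl
    have e1 : ∀ i : Fin d, jet (fun x => defFun x * (F - φ n) x) (some i) =
        W (jet (F - φ n) (some i)) -
          (2 : ℂ) • mulOp d (toPotential (coordMap i)) (jet (F - φ n) none) := fun i => by
      rw [jet_none, jet_some, jet_some, hW, mulOp_toPotential_toL2 _ (memLp_of_contDiff (hu n)),
        mulOp_toPotential_toL2 _ (memLp_partialDeriv (hu n) i), ← toL2_smul, ← toL2_sub]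
      · congr 1
        ext x
        rw [partialDeriv_mul contDiff_defFun (hu n), partialDeriv_defFun]
        simp only [defFun, defMap, coordMap, ContinuousMap.coe_mk, Pi.sub_apply, Pi.smul_apply,
          smul_eq_mul]
        ring
      · exact memLp_ball ((Complex.continuous_ofReal.comp (defMap d).continuous).mul
          (contDiff_partialDeriv (hu n) i).continuous) 2
      · exact (memLp_ball ((Complex.continuous_ofReal.comp (coordMap i).continuous).mul
          (hu n).continuous) 2).const_smul _
      · exact memLp_ball ((Complex.continuous_ofReal.comp (coordMap i).continuous).mul
          (hu n).continuous) 2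
    rw [e0]
    simp_rw [e1, inner_sub_left, inner_smul_left, hW, inner_mulOp_left]
    rw [Finset.sum_sub_distrib, Finset.mul_sum]
    simp only [Complex.conj_ofNat]
    ring
  have hlimit := (((hl' none).inner (𝕜 := ℂ) (tendsto_const_nhds (x := W (X none)))).add
    (tendsto_finsetSum Finset.univ fun i _ =>
      (hl' (some i)).inner (𝕜 := ℂ) (tendsto_const_nhds (x := W (X (some i)))))).sub
    ((tendsto_finsetSum Finset.univ fun i _ => (hl' none).inner (𝕜 := ℂ)
      (tendsto_const_nhds (x := mulOp d (toPotential (coordMap i)) (X (some i))))).const_mul 2)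
  have h0 := tendsto_nhds_unique hlimit (tendsto_const_nhds.congr fun n => (key n).symm)
  have h1 := congrArg Complex.re h0
  simp only [Complex.sub_re, Complex.add_re, Complex.zero_re, Complex.mul_re, Complex.re_ofNat,
    Complex.im_ofNat, zero_mul, sub_zero] at h1
  have h2 := re_inner_mulOp_defMap_nonneg (X none)
  have h3 : 0 ≤ (∑ i, inner ℂ (X (some i)) (W (X (some i)))).re := by
    rw [Complex.re_sum]
    exact Finset.sum_nonneg fun i _ => re_inner_mulOp_defMap_nonneg (X (some i))
  linarith

/-- The divergence theorem for the field |u|² x, whose divergence is 2 Re(ū x·∇u) + d|u|². -/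
theorem integral_sphere_normSq (hd : 0 < d) {u : E d → ℂ} (hu : ContDiff ℝ ∞ u) :
    ∫ y : Sphere d, ‖u y‖ ^ 2 ∂sphereMeasure d =
      2 * (∑ i, inner ℂ (jet u none) (mulOp d (toPotential (coordMap i)) (jet u (some i)))).re +
        d * ‖jet u none‖ ^ 2 := by
  have hc := contDiff_conj hu
  have h := integral_ball_radial_divergence hd (hc.mul hu)
  have e1 : ∀ y : E d, conj (u y) * u y = ((‖u y‖ ^ 2 : ℝ) : ℂ) := fun y => by
    rw [Complex.conj_mul']; push_cast; rfl
  have e2 : ∀ x : E d, (∑ i, (x i : ℂ) * partialDeriv i (fun x => conj (u x) * u x) x) +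
      d * (conj (u x) * u x) = ((2 * (∑ i, conj (u x) * ((x i : ℂ) * partialDeriv i u x)).re +
        d * ‖u x‖ ^ 2 : ℝ) : ℂ) := fun x => by
    rw [e1 x]
    rw [Complex.ofReal_add, ← Complex.add_conj, map_sum, ← Finset.sum_add_distrib]
    push_cast
    congr 1
    refine Finset.sum_congr rfl fun i _ => ?_
    rw [partialDeriv_mul hc hu, partialDeriv_conj]
    simp only [map_mul, Complex.conj_conj, Complex.conj_ofReal]
    ring
  simp_rw [e2, e1] at h
  rw [integral_complex_ofReal, integral_complex_ofReal] at h
  have h' := Complex.ofReal_injective h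
  have hci : ∀ i : Fin d, Continuous fun x => conj (u x) * ((x i : ℂ) * partialDeriv i u x) :=
    fun i => hc.continuous.mul ((Complex.continuous_ofReal.comp (coordMap i).continuous).mul
      (contDiff_partialDeriv hu i).continuous)
  have hcs : Continuous fun x => ∑ i, conj (u x) * ((x i : ℂ) * partialDeriv i u x) :=
    continuous_finsetSum _ fun i _ => hci i
  rw [← h', integral_add, integral_const_mul, integral_const_mul, jet_none,
    norm_sq_toL2 (memLp_of_contDiff hu)]
  · congr 2
    have := integral_re (integrable_ball hcs)
    simp only [RCLike.re_to_complex] at this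
    rw [this, integral_finsetSum _ fun i _ => integrable_ball (hci i)]
    congr 2
    ext i
    rw [jet_some, mulOp_toPotential_toL2 _ (memLp_partialDeriv hu i), inner_toL2 (memLp_of_contDiff hu)]
    · rfl
    · exact memLp_ball ((Complex.continuous_ofReal.comp (coordMap i).continuous).mul
        (contDiff_partialDeriv hu i).continuous) 2
  · exact ((integrable_ball hcs).re).const_mul 2
  · exact (memLp_of_contDiff hu).norm.integrable_sq.const_mul _

/-- An `H¹` function on the ball that is orthogonal to `H¹₀` is controlled by its boundary values. -/
theorem norm_sq_le_of_orthogonal (hd : 0 < d) {F : E d → ℂ} (hF : ContDiff ℝ ∞ F) {X : JetSpace d}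
    (hX : ∀ v ∈ H10 d, inner ℂ v X = 0) (hFX : jet F - X ∈ H10 d) :
    d * ‖X none‖ ^ 2 ≤ ∫ y : Sphere d, ‖F y‖ ^ 2 ∂sphereMeasure d := by
  have h0 := sum_re_inner_coord_nonneg hF hX hFX
  obtain ⟨φ, hφ, hlim⟩ := exists_seq_of_mem_H10 hFX
  have hu : ∀ n, ContDiff ℝ ∞ (F - φ n) := fun n => hF.sub (hφ n).smooth
  have hl : Tendsto (fun n => jet (F - φ n)) atTop (𝓝 X) := by
    have := (tendsto_const_nhds (x := jet F)).sub hlim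
    simpa [jet_sub hF (hφ _).smooth] using this
  have hl' := tendsto_jetSpace_iff.1 hl
  have hlimit := ((Complex.continuous_re.tendsto _).comp
    (tendsto_finsetSum Finset.univ fun i _ => (hl' none).inner (𝕜 := ℂ)
      (((mulOp d (toPotential (coordMap i))).continuous.tendsto _).comp (hl' (some i))))).const_mul 2
    |>.add (((hl' none).norm.pow 2).const_mul (d : ℝ))
  -- Test functions vanish on the sphere, so all approximations share the boundary values of F and
  -- the sphere integral needs no limit.
  have hconst : ∀ n, ∫ y : Sphere d, ‖F y‖ ^ 2 ∂sphereMeasure d =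
      ∫ y : Sphere d, ‖(F - φ n) y‖ ^ 2 ∂sphereMeasure d := fun n => by
    congr 1
    ext y
    have : φ n y = 0 := (hφ n).eq_zero (by simp [ball])
    simp [this]
  have h1 := tendsto_nhds_unique hlimit ((tendsto_const_nhds
      (x := ∫ y : Sphere d, ‖F y‖ ^ 2 ∂sphereMeasure d)).congr fun n => by
    rw [hconst n, integral_sphere_normSq hd (hu n)]; rfl)
  rw [← h1]
  linarith

/-! ### The Rellich compactness theorem -/

theorem enorm_integral_sq_le {α : Type*} [MeasurableSpace α] {μ : Measure α} {f : α → ℂ}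
    (hf : AEStronglyMeasurable f μ) : ‖∫ x, f x ∂μ‖ₑ ^ 2 ≤ μ Set.univ * ∫⁻ x, ‖f x‖ₑ ^ 2 ∂μ := by
  have h1 : ‖∫ x, f x ∂μ‖ₑ ≤ eLpNorm f 1 μ := by
    rw [eLpNorm_one_eq_lintegral_enorm]; exact enorm_integral_le_lintegral_enorm f
  have h2 := eLpNorm_le_eLpNorm_mul_rpow_measure_univ (p := 1) (q := 2) (by norm_num) hf
  have h3 : eLpNorm f 2 μ ^ 2 = ∫⁻ x, ‖f x‖ₑ ^ 2 ∂μ := by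
    have := eLpNorm_nnreal_pow_eq_lintegral (f := f) (μ := μ) (p := 2) (by norm_num)
    simpa using this
  calc ‖∫ x, f x ∂μ‖ₑ ^ 2 ≤ (eLpNorm f 2 μ * μ Set.univ ^ ((1 : ℝ≥0∞).toReal⁻¹ - (2 : ℝ≥0∞).toReal⁻¹)) ^ 2 := by
        gcongr; simpa using h1.trans h2
    _ = _ := by
        rw [mul_pow, h3, ← ENNReal.rpow_natCast, ← ENNReal.rpow_mul, mul_comm]
        norm_num

/-- Write φ(x + z) - φ(x) as the integral of Dφ(x + tz)z over 0 ≤ t ≤ 1, then use Cauchy–Schwarz in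
t, Tonelli, and translation invariance in x. -/
theorem lintegral_translate_sub_sq_le {φ : E d → ℂ} (hφ : ContDiff ℝ ∞ φ) (z : E d) :
    ∫⁻ x, ‖φ (x + z) - φ x‖ₑ ^ 2 ≤ ∫⁻ x, ‖fderiv ℝ φ x z‖ₑ ^ 2 := by
  have hc : Continuous fun x => fderiv ℝ φ x z :=
    (hφ.continuous_fderiv (by simp)).clm_apply continuous_const
  have hc2 : Continuous fun p : E d × ℝ => fderiv ℝ φ (p.1 + p.2 • z) z :=
    hc.comp (continuous_fst.add (continuous_snd.smul continuous_const))
  have hpt : ∀ x, ‖φ (x + z) - φ x‖ₑ ^ 2 ≤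
      ∫⁻ t in Set.Ioc (0 : ℝ) 1, ‖fderiv ℝ φ (x + t • z) z‖ₑ ^ 2 := fun x => by
    have hder : ∀ t ∈ Set.uIcc (0 : ℝ) 1,
        HasDerivAt (fun t : ℝ => φ (x + t • z)) (fderiv ℝ φ (x + t • z) z) t := fun t _ => by
      have h1 : HasDerivAt (fun t : ℝ => x + t • z) z t := by
        simpa using ((hasDerivAt_id t).smul_const z).const_add x
      exact (hφ.differentiable (by simp) _).hasFDerivAt.comp_hasDerivAt t h1
    have hct : Continuous fun t : ℝ => fderiv ℝ φ (x + t • z) z :=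
      hc2.comp (continuous_const.prodMk continuous_id)
    have h := intervalIntegral.integral_eq_sub_of_hasDerivAt hder (hct.intervalIntegrable _ _)
    rw [intervalIntegral.integral_of_le zero_le_one] at h
    simp only [one_smul, zero_smul, add_zero] at h
    rw [← h]
    refine (enorm_integral_sq_le hct.aestronglyMeasurable).trans ?_
    simp
  calc ∫⁻ x, ‖φ (x + z) - φ x‖ₑ ^ 2
      ≤ ∫⁻ x, ∫⁻ t in Set.Ioc (0 : ℝ) 1, ‖fderiv ℝ φ (x + t • z) z‖ₑ ^ 2 := lintegral_mono hpt
    _ = ∫⁻ t in Set.Ioc (0 : ℝ) 1, ∫⁻ x, ‖fderiv ℝ φ (x + t • z) z‖ₑ ^ 2 :=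
        lintegral_lintegral_swap (hc2.enorm.measurable.pow_const 2).aemeasurable
    _ = ∫⁻ _ in Set.Ioc (0 : ℝ) 1, ∫⁻ x, ‖fderiv ℝ φ x z‖ₑ ^ 2 := by
        refine lintegral_congr fun t => ?_
        exact lintegral_add_right_eq_self (fun x => ‖fderiv ℝ φ x z‖ₑ ^ 2) (t • z)
    _ = _ := by simp

theorem norm_fderiv_apply_sq_le (φ : E d → ℂ) (x z : E d) :
    ‖fderiv ℝ φ x z‖ ^ 2 ≤ ‖z‖ ^ 2 * ∑ i, ‖partialDeriv i φ x‖ ^ 2 := by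
  rw [fderiv_apply_eq_sum, EuclideanSpace.norm_sq_eq]
  refine le_trans ?_ (Finset.sum_mul_sq_le_sq_mul_sq _ _ _)
  gcongr
  refine (norm_sum_le _ _).trans (le_of_eq ?_)
  simp

theorem norm_sq_toL2_eq_lintegral {α : Type*} [MeasurableSpace α] {μ : Measure α} {f : α → ℂ}
    (hf : MemLp f 2 μ) : ENNReal.ofReal (‖toL2 μ f‖ ^ 2) = ∫⁻ x, ‖f x‖ₑ ^ 2 ∂μ := by
  rw [norm_sq_toL2 hf, ofReal_integral_eq_lintegral_ofReal hf.norm.integrable_sq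
    (Eventually.of_forall fun x => by positivity)]
  refine lintegral_congr fun x => ?_
  rw [ENNReal.ofReal_pow (norm_nonneg _), ofReal_norm]

theorem norm_sq_jet_eq (v : JetSpace d) : ‖v‖ ^ 2 = ‖v none‖ ^ 2 + ∑ i : Fin d, ‖v (some i)‖ ^ 2 := by
  rw [PiLp.norm_sq_eq_of_L2, Fintype.sum_option]

theorem IsTestFunction.lintegral_fderiv_sq_le {φ : E d → ℂ} (hφ : IsTestFunction φ) (z : E d) :
    ∫⁻ x, ‖fderiv ℝ φ x z‖ₑ ^ 2 ≤ ENNReal.ofReal (‖z‖ ^ 2 * ‖jet φ‖ ^ 2) := by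
  have hsupp : ∀ x ∉ ball d, fderiv ℝ φ x z = 0 := fun x hx => by
    rw [fderiv_apply_eq_sum]
    exact Finset.sum_eq_zero fun i _ => by rw [(hφ.pderiv i).eq_zero hx, mul_zero]
  have h1 : ∫⁻ x, ‖fderiv ℝ φ x z‖ₑ ^ 2 = ∫⁻ x in ball d, ‖fderiv ℝ φ x z‖ₑ ^ 2 := by
    rw [← lintegral_indicator measurableSet_ball]
    refine lintegral_congr fun x => ?_
    by_cases hx : x ∈ ball d
    · rw [Set.indicator_of_mem hx]
    · rw [Set.indicator_of_notMem hx, hsupp x hx]; simp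
  rw [h1]
  calc ∫⁻ x in ball d, ‖fderiv ℝ φ x z‖ₑ ^ 2
      ≤ ∫⁻ x in ball d, ENNReal.ofReal (‖z‖ ^ 2) * ∑ i, ‖partialDeriv i φ x‖ₑ ^ 2 := by
        refine lintegral_mono fun x => ?_
        have := ENNReal.ofReal_le_ofReal (norm_fderiv_apply_sq_le φ x z)
        rw [ENNReal.ofReal_mul (by positivity), ENNReal.ofReal_sum_of_nonneg (fun _ _ => by positivity),
          ENNReal.ofReal_pow (norm_nonneg _), ofReal_norm] at this
        refine this.trans (le_of_eq ?_)
        congr 2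
        ext i
        rw [ENNReal.ofReal_pow (norm_nonneg _), ofReal_norm]
    _ = ENNReal.ofReal (‖z‖ ^ 2) * ∑ i, ENNReal.ofReal (‖jet φ (some i)‖ ^ 2) := by
        have hm : ∀ i : Fin d, Measurable fun x => ‖partialDeriv i φ x‖ₑ ^ 2 := fun i =>
          (contDiff_partialDeriv hφ.smooth i).continuous.enorm.measurable.pow_const 2
        rw [lintegral_const_mul _ (Finset.measurable_sum _ fun i _ => hm i),
          lintegral_finsetSum _ fun i _ => hm i]
        congr 2
        ext i
        rw [jet_some, norm_sq_toL2_eq_lintegral (memLp_partialDeriv hφ.smooth i)]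
    _ ≤ _ := by
        rw [← ENNReal.ofReal_sum_of_nonneg (fun _ _ => by positivity),
          ← ENNReal.ofReal_mul (by positivity)]
        refine ENNReal.ofReal_le_ofReal ?_
        gcongr
        rw [norm_sq_jet_eq]
        have := sq_nonneg ‖jet φ none‖
        linarith

/-- The sum of the averages over the balls of radius `δ` around the points `c i`, each placed on the
part of the ball around `c i` that does not meet the earlier ones. -/
def averaging (d : ℕ) (δ : ℝ) (c : ℕ → E d) (n : ℕ) : L2Ball d →L[ℂ] L2Ball d :=
  ∑ i ∈ Finset.range n,
    (ContinuousLinearMap.toSpanSingleton ℂ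
      (toL2 (ballMeasure d) ((disjointed (fun i => Metric.ball (c i) δ) i).indicator 1))).comp
    ((((volume : Measure (E d)).real (Metric.ball 0 δ) : ℂ)⁻¹) •
      innerSL ℂ (toL2 (ballMeasure d) ((Metric.ball (c i) δ).indicator 1)))

/-- The operator has finite rank: each summand factors through ℂ. -/
theorem isCompactOperator_averaging (δ : ℝ) (c : ℕ → E d) (n : ℕ) :
    IsCompactOperator (averaging d δ c n) := by
  have : averaging d δ c n ∈ compactOperator (RingHom.id ℂ) (L2Ball d) (L2Ball d) := by
    refine Submodule.sum_mem _ fun i _ => ?_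
    let l : L2Ball d →L[ℂ] ℂ := (((volume : Measure (E d)).real (Metric.ball 0 δ) : ℂ)⁻¹) •
      innerSL ℂ (toL2 (ballMeasure d) ((Metric.ball (c i) δ).indicator 1))
    have h : IsCompactOperator l := isCompactOperator_of_locallyCompactSpace_dom l
    exact h.clm_comp (ContinuousLinearMap.toSpanSingleton ℂ
      (toL2 (ballMeasure d) ((disjointed (fun i => Metric.ball (c i) δ) i).indicator 1)))
  exact this

theorem memLp_indicator_one {A : Set (E d)} (hA : MeasurableSet A) :
    MemLp (A.indicator (1 : E d → ℂ)) 2 (ballMeasure d) :=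
  (memLp_const (1 : ℂ)).indicator hA

/-- Each point of the ball lies in exactly one of the disjointed pieces, and that piece is contained
in its ball. The value there is therefore the mean of φ over a ball of radius δ containing the
point. -/
theorem IsTestFunction.coeFn_averaging {φ : E d → ℂ} (hφ : IsTestFunction φ) {δ : ℝ} {c : ℕ → E d}
    {n : ℕ} (hc : ball d ⊆ ⋃ i ∈ Finset.range n, Metric.ball (c i) δ) :
    ∃ e : E d → ℂ, averaging d δ c n (toL2 (ballMeasure d) φ) = toL2 (ballMeasure d) e ∧
      MemLp e 2 (ballMeasure d) ∧
      ∀ x ∈ ball d, ∃ i, x ∈ Metric.ball (c i) δ ∧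
        e x = ((volume : Measure (E d)).real (Metric.ball 0 δ) : ℂ)⁻¹ *
          ∫ y in Metric.ball (c i) δ, φ y := by
  set A := disjointed (fun i => Metric.ball (c i) δ) with hA
  have hAm : ∀ i, MeasurableSet (A i) := fun i =>
    MeasurableSet.disjointed (fun i => measurableSet_ball) i
  set a : ℕ → ℂ := fun i => ((volume : Measure (E d)).real (Metric.ball 0 δ) : ℂ)⁻¹ *
          ∫ y in Metric.ball (c i) δ, φ y with ha
  have hinner : ∀ i, inner ℂ (toL2 (ballMeasure d) ((Metric.ball (c i) δ).indicator 1))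
      (toL2 (ballMeasure d) φ) = ∫ y in Metric.ball (c i) δ, φ y := fun i => by
    rw [inner_toL2 (memLp_indicator_one measurableSet_ball) (memLp_of_contDiff hφ.smooth),
      setIntegral_eq_integral_of_forall_compl_eq_zero fun x hx => by rw [hφ.eq_zero hx, mul_zero],
      ← integral_indicator measurableSet_ball]
    congr 1
    ext x
    by_cases hx : x ∈ Metric.ball (c i) δ <;> simp [hx]
  have hm : ∀ i, MemLp (a i • (A i).indicator (1 : E d → ℂ)) 2 (ballMeasure d) := fun i =>
    (memLp_indicator_one (hAm i)).const_smul (a i)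
  refine ⟨fun x => ∑ i ∈ Finset.range n, (a i • (A i).indicator (1 : E d → ℂ)) x, ?_, ?_, ?_⟩
  · refine eq_toL2_of_ae_eq ?_
    have h1 : averaging d δ c n (toL2 (ballMeasure d) φ) =
        ∑ i ∈ Finset.range n, toL2 (ballMeasure d) (a i • (A i).indicator (1 : E d → ℂ)) := by
      simp only [averaging, sum_apply, ContinuousLinearMap.comp_apply,
        smul_apply, innerSL_apply_apply, hinner,
        ContinuousLinearMap.toSpanSingleton_apply]
      refine Finset.sum_congr rfl fun i _ => ?_
      rw [toL2_smul _ (memLp_indicator_one (hAm i))]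
      rfl
    rw [h1]
    have h2 := Lp.coeFn_finsetSum (p := 2) (μ := ballMeasure d) (Finset.range n) 
      (fun i => toL2 (ballMeasure d) (a i • (A i).indicator (1 : E d → ℂ)))
    have h3 := fun i => coeFn_toL2 (hm i)
    filter_upwards [h2, ae_all_iff.2 h3] with x hx hy
    rw [hx, Finset.sum_apply]
    exact Finset.sum_congr rfl fun i _ => hy i
  · exact memLp_finsetSum _ fun i _ => hm i
  · intro x hx
    obtain ⟨j, hj, hxj⟩ : ∃ j ∈ Finset.range n, x ∈ Metric.ball (c j) δ := by simpa using hc hx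
    have hxU : x ∈ ⋃ i, A i := by
      rw [hA, iUnion_disjointed]; exact Set.mem_iUnion.2 ⟨j, hxj⟩
    obtain ⟨i, hi⟩ := Set.mem_iUnion.1 hxU
    have hdisj : Pairwise (Function.onFun Disjoint A) := disjoint_disjointed _
    -- Piece `i` excludes all earlier balls and x already lies in ball `j` with `j < n`, so the
    -- piece containing x occurs in the sum.
    have hin : i < n := by
      by_contra h
      have hlt : j < i := (Finset.mem_range.1 hj).trans_le (not_lt.1 h)
      rw [hA, disjointed_eq_inter_compl] at hi
      exact (Set.mem_iInter₂.1 hi.2 j hlt) hxj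
    refine ⟨i, disjointed_subset (fun i => Metric.ball (c i) δ) i hi, ?_⟩
    simp only
    rw [Finset.sum_eq_single i]
    · simp [hi, ha]
    · intro k _ hk
      have : x ∉ A k := fun h => Set.disjoint_left.1 (hdisj hk) h hi
      simp [this]
    · intro h; exact absurd (Finset.mem_range.2 hin) h

/-- At x the difference is the mean of φ(x) - φ(y) over y in a ball of radius δ containing x, so
that |y - x| < 2δ. By Cauchy–Schwarz its square is at most the integral of |φ(x + z) - φ(x)|² over
|z| < 2δ, divided by the volume of the δ-ball. Integrating in x, the translation estimate gives
(2δ)², and the ratio of the volumes of the two balls gives 2^d. -/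
theorem IsTestFunction.norm_sub_averaging_le {φ : E d → ℂ} (hφ : IsTestFunction φ) {δ : ℝ}
    (hδ : 0 < δ) {c : ℕ → E d} {n : ℕ} (hc : ball d ⊆ ⋃ i ∈ Finset.range n, Metric.ball (c i) δ) :
    ‖toL2 (ballMeasure d) φ - averaging d δ c n (toL2 (ballMeasure d) φ)‖ ^ 2 ≤
      2 ^ d * (2 * δ) ^ 2 * ‖jet φ‖ ^ 2 := by
  obtain ⟨e, he, hem, hex⟩ := hφ.coeFn_averaging hc
  have hφm := memLp_of_contDiff hφ.smooth
  have hcont := hφ.smooth.continuous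
  set m := (volume : Measure (E d)) (Metric.ball 0 δ) with hm
  have hm0 : m ≠ 0 := (Metric.measure_ball_pos _ _ hδ).ne'
  have hmt : m ≠ ⊤ := measure_ball_lt_top.ne
  have hpt : ∀ x ∈ ball d, ‖φ x - e x‖ₑ ^ 2 ≤
      m⁻¹ * ∫⁻ z in Metric.ball (0 : E d) (2 * δ), ‖φ (x + z) - φ x‖ₑ ^ 2 := fun x hx => by
    obtain ⟨i, hi, hei⟩ := hex x hx
    have hmi : (volume : Measure (E d)) (Metric.ball (c i) δ) = m := Measure.addHaar_ball_center _ _ _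
    have hint : IntegrableOn φ (Metric.ball (c i) δ) :=
      (hcont.integrable_of_hasCompactSupport hφ.compact).integrableOn
    have hmr : ((volume : Measure (E d)).real (Metric.ball 0 δ) : ℂ) ≠ 0 := by
      rw [measureReal_def]
      exact_mod_cast (ENNReal.toReal_pos hm0 hmt).ne'
    have h1 : φ x - e x = ((volume : Measure (E d)).real (Metric.ball 0 δ) : ℂ)⁻¹ *
        ∫ y in Metric.ball (c i) δ, (φ x - φ y) := by
      have hconst : IntegrableOn (fun _ => φ x) (Metric.ball (c i) δ) :=
        integrableOn_const (by rw [hmi]; exact hmt)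
      rw [integral_sub hconst hint, mul_sub, ← hei,
        setIntegral_const, show (volume : Measure (E d)).real (Metric.ball (c i) δ) =
          (volume : Measure (E d)).real (Metric.ball 0 δ) by rw [measureReal_def, hmi, measureReal_def],
        Complex.real_smul, ← mul_assoc, inv_mul_cancel₀ hmr, one_mul]
    have h2 : ‖((volume : Measure (E d)).real (Metric.ball 0 δ) : ℂ)⁻¹‖ₑ = m⁻¹ := by
      rw [enorm_inv hmr, measureReal_def, ← hm]
      congr 1
      rw [← ofReal_norm, Complex.norm_real, Real.norm_of_nonneg ENNReal.toReal_nonneg,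
        ENNReal.ofReal_toReal hmt]
    have h3 := enorm_integral_sq_le (μ := volume.restrict (Metric.ball (c i) δ))
      (f := fun y => φ x - φ y) (continuous_const.sub hcont).aestronglyMeasurable
    rw [Measure.restrict_apply_univ, hmi] at h3
    have h4 : ∫⁻ y in Metric.ball (c i) δ, ‖φ x - φ y‖ₑ ^ 2 ≤
        ∫⁻ z in Metric.ball (0 : E d) (2 * δ), ‖φ (x + z) - φ x‖ₑ ^ 2 := by
      rw [← lintegral_indicator measurableSet_ball, ← lintegral_indicator measurableSet_ball,
        ← lintegral_add_left_eq_self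
          ((Metric.ball (c i) δ).indicator fun y => ‖φ x - φ y‖ₑ ^ 2) x]
      refine lintegral_mono fun z => ?_
      by_cases hz : x + z ∈ Metric.ball (c i) δ
      · have hz2 : z ∈ Metric.ball (0 : E d) (2 * δ) := by
          rw [mem_ball_zero_iff]
          calc ‖z‖ = dist (x + z) x := by rw [dist_eq_norm, add_sub_cancel_left]
            _ ≤ dist (x + z) (c i) + dist x (c i) := dist_triangle_right _ _ _
            _ < 2 * δ := by linarith [Metric.mem_ball.1 hz, Metric.mem_ball.1 hi]
        rw [Set.indicator_of_mem hz, Set.indicator_of_mem hz2, enorm_sub_rev]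
      · rw [Set.indicator_of_notMem hz]
        exact zero_le
    rw [h1, enorm_mul, mul_pow, h2]
    calc m⁻¹ ^ 2 * ‖∫ y in Metric.ball (c i) δ, (φ x - φ y)‖ₑ ^ 2
        ≤ m⁻¹ ^ 2 * (m * ∫⁻ z in Metric.ball (0 : E d) (2 * δ), ‖φ (x + z) - φ x‖ₑ ^ 2) := by
          gcongr; exact h3.trans (by gcongr)
      _ = _ := by
          rw [← mul_assoc, sq, mul_assoc m⁻¹, ENNReal.inv_mul_cancel hm0 hmt, mul_one]
  have h5 : ENNReal.ofReal (‖toL2 (ballMeasure d) φ - averaging d δ c n (toL2 (ballMeasure d) φ)‖ ^ 2) ≤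
      ENNReal.ofReal (2 ^ d * (2 * δ) ^ 2 * ‖jet φ‖ ^ 2) := by
    rw [he, ← toL2_sub hφm hem, norm_sq_toL2_eq_lintegral (hφm.sub hem)]
    calc ∫⁻ x in ball d, ‖(φ - e) x‖ₑ ^ 2
        ≤ ∫⁻ x in ball d, m⁻¹ * ∫⁻ z in Metric.ball (0 : E d) (2 * δ), ‖φ (x + z) - φ x‖ₑ ^ 2 :=
          setLIntegral_mono' measurableSet_ball hpt
      _ ≤ ∫⁻ x, m⁻¹ * ∫⁻ z in Metric.ball (0 : E d) (2 * δ), ‖φ (x + z) - φ x‖ₑ ^ 2 :=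
          setLIntegral_le_lintegral _ _
      _ = m⁻¹ * ∫⁻ z in Metric.ball (0 : E d) (2 * δ), ∫⁻ x, ‖φ (x + z) - φ x‖ₑ ^ 2 := by
          have hmeas : Measurable fun p : E d × E d => ‖φ (p.1 + p.2) - φ p.1‖ₑ ^ 2 :=
            ((hcont.comp continuous_add).sub (hcont.comp continuous_fst)).enorm.measurable.pow_const 2
          rw [lintegral_const_mul' _ _ (ENNReal.inv_ne_top.2 hm0),
            lintegral_lintegral_swap hmeas.aemeasurable]
      _ ≤ m⁻¹ * ∫⁻ z in Metric.ball (0 : E d) (2 * δ),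
            ENNReal.ofReal ((2 * δ) ^ 2 * ‖jet φ‖ ^ 2) := by
          gcongr m⁻¹ * ?_
          refine setLIntegral_mono' measurableSet_ball fun z hz => ?_
          refine ((lintegral_translate_sub_sq_le hφ.smooth z).trans
            (hφ.lintegral_fderiv_sq_le z)).trans (ENNReal.ofReal_le_ofReal ?_)
          gcongr
          exact (mem_ball_zero_iff.1 hz).le
      _ = _ := by
          rw [setLIntegral_const, Measure.addHaar_ball_mul_of_pos _ _ (by norm_num : (0 : ℝ) < 2),
            ← hm, finrank_euclideanSpace_fin, mul_comm (ENNReal.ofReal ((2 * δ) ^ 2 * ‖jet φ‖ ^ 2)),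
            mul_comm (ENNReal.ofReal (2 ^ d)) m, mul_assoc m, ← mul_assoc,
            ENNReal.inv_mul_cancel hm0 hmt, one_mul, ← ENNReal.ofReal_mul (by positivity), mul_assoc]
  exact (ENNReal.ofReal_le_ofReal_iff (by positivity)).1 h5

/-- The inclusion of `H¹₀(𝔹^d)` into `L²(𝔹^d)`. -/
def inclH10 (d : ℕ) : H10 d →L[ℂ] L2Ball d :=
  (PiLp.proj 2 (fun _ : Option (Fin d) => L2Ball d) none).comp (H10 d).subtypeL

@[simp] theorem inclH10_apply (v : H10 d) : inclH10 d v = (v : JetSpace d) none := rfl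

theorem exists_finite_cover_ball (d : ℕ) {δ : ℝ} (hδ : 0 < δ) :
    ∃ (c : ℕ → E d) (n : ℕ), ball d ⊆ ⋃ i ∈ Finset.range n, Metric.ball (c i) δ := by
  have htb : TotallyBounded (ball d) :=
    (isCompact_closedBall (0 : E d) 1).totallyBounded.subset Metric.ball_subset_closedBall
  obtain ⟨t, ht, hcov⟩ := Metric.totallyBounded_iff.1 htb δ hδ
  obtain ⟨n, f, -, hf⟩ := ht.fin_param
  refine ⟨fun i => if h : i < n then f ⟨i, h⟩ else 0, n, fun x hx => ?_⟩
  obtain ⟨y, hy, hxy⟩ := Set.mem_iUnion₂.1 (hcov hx)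
  rw [← hf] at hy
  obtain ⟨i, rfl⟩ := hy
  exact Set.mem_iUnion₂.2 ⟨i, Finset.mem_range.2 i.2, by simpa using hxy⟩

/-- The inclusion is the norm limit of its compositions with averaging operators of radius 1/(n +
1). The error bound holds on test functions and extends to `H10 d` by continuity. -/
theorem isCompactOperator_inclH10 (d : ℕ) : IsCompactOperator (inclH10 d) := by
  have hpos : ∀ n : ℕ, (0 : ℝ) < 1 / (n + 1) := fun n => by positivity
  choose c N hc using fun n => exists_finite_cover_ball d (hpos n)
  let T : ℕ → (H10 d →L[ℂ] L2Ball d) := fun n => (averaging d (1 / (n + 1)) (c n) (N n)).comp (inclH10 d)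
  refine isCompactOperator_of_tendsto (l := atTop) (F := T) ?_
    (Eventually.of_forall fun n => (isCompactOperator_averaging _ _ _).comp_clm (inclH10 d))
  set C : ℝ := Real.sqrt (2 ^ d) * 2 with hC
  have hbound : ∀ n, ‖T n - inclH10 d‖ ≤ C * (1 / (n + 1)) := fun n => by
    refine ContinuousLinearMap.opNorm_le_bound _ (by positivity) fun v => ?_
    obtain ⟨φ, hφ, hlim⟩ := exists_seq_of_mem_H10 v.2
    have hl0 := tendsto_jetSpace_iff.1 hlim none
    have l1 := (hl0.sub (((averaging d (1 / (n + 1)) (c n) (N n)).continuous.tendsto _).comp hl0)).norm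
    have l2 := hlim.norm.const_mul (C * (1 / ((n : ℝ) + 1)))
    rw [← norm_neg]
    have : -((T n - inclH10 d) v) = (v : JetSpace d) none -
        averaging d (1 / (n + 1)) (c n) (N n) ((v : JetSpace d) none) := by
      simp [T]
    rw [this]
    refine le_of_tendsto_of_tendsto' l1 l2 fun k => ?_
    refine abs_le_of_sq_le_sq' ?_ (by positivity) |>.2
    refine ((hφ k).norm_sub_averaging_le (hpos n) (hc n)).trans (le_of_eq ?_)
    have hC2 : C ^ 2 = 2 ^ d * 4 := by
      rw [hC, mul_pow, Real.sq_sqrt (by positivity)]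
      norm_num
    rw [mul_pow (C * _), mul_pow C, hC2]
    ring
  refine (tendsto_iff_norm_sub_tendsto_zero (f := T) (b := inclH10 d)).2 ?_
  refine squeeze_zero (fun n => norm_nonneg (T n - inclH10 d)) hbound ?_
  simpa using tendsto_one_div_add_atTop_nhds_zero_nat.const_mul C

/-! ### Polynomials on the sphere -/

/-- The function on `ℝ^d` defined by a complex polynomial. -/
def polyFun (p : MvPolynomial (Fin d) ℂ) (x : E d) : ℂ :=
  MvPolynomial.eval (fun i => (x i : ℂ)) p

theorem contDiff_coord (i : Fin d) : ContDiff ℝ ∞ fun x : E d => (x i : ℂ) :=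
  Complex.ofRealCLM.contDiff.comp (by fun_prop : ContDiff ℝ ∞ fun x : E d => x i)

theorem polyFun_C (a : ℂ) : polyFun (MvPolynomial.C a : MvPolynomial (Fin d) ℂ) = fun _ => a := by
  ext x; simp [polyFun]

theorem polyFun_X (i : Fin d) : polyFun (MvPolynomial.X i) = fun x : E d => (x i : ℂ) := by
  ext x; simp [polyFun]

theorem polyFun_add (p q : MvPolynomial (Fin d) ℂ) : polyFun (p + q) = polyFun p + polyFun q := by
  ext x; simp [polyFun]

theorem polyFun_mul (p q : MvPolynomial (Fin d) ℂ) :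
    polyFun (p * q) = fun x => polyFun p x * polyFun q x := by
  ext x; simp [polyFun]

theorem contDiff_polyFun (p : MvPolynomial (Fin d) ℂ) : ContDiff ℝ ∞ (polyFun p) := by
  induction p using MvPolynomial.induction_on with
  | C a => rw [polyFun_C]; exact contDiff_const
  | add p q hp hq => rw [polyFun_add]; exact hp.add hq
  | mul_X p i hp => rw [polyFun_mul, polyFun_X]; exact hp.mul (contDiff_coord i)

/-- Restriction of polynomials to the sphere. -/
def polySphere (d : ℕ) : MvPolynomial (Fin d) ℂ →ₐ[ℂ] C(Sphere d, ℂ) :=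
  MvPolynomial.aeval fun i => ⟨fun y => ((y : E d) i : ℂ),
    (contDiff_coord i).continuous.comp continuous_subtype_val⟩

theorem polySphere_apply (p : MvPolynomial (Fin d) ℂ) (y : Sphere d) :
    polySphere d p y = polyFun p y := by
  induction p using MvPolynomial.induction_on with
  | C a => simp [polySphere, polyFun]
  | add p q hp hq => rw [map_add, ContinuousMap.add_apply, hp, hq]; simp [polyFun]
  | mul_X p i hp =>
    rw [map_mul, ContinuousMap.mul_apply, hp]
    simp [polySphere, polyFun]

theorem polyFun_map_conj (p : MvPolynomial (Fin d) ℂ) (x : E d) :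
    polyFun (MvPolynomial.map (starRingEnd ℂ) p) x = conj (polyFun p x) := by
  induction p using MvPolynomial.induction_on with
  | C a => simp [polyFun]
  | add p q hp hq =>
    simp only [polyFun, map_add] at *
    rw [hp, hq]
  | mul_X p i hp =>
    simp only [polyFun, map_mul] at *
    rw [hp]
    simp

/-- Stone–Weierstrass: the coordinates separate points, and conjugating the coefficients of a
polynomial conjugates its values, as the points are real. -/
theorem denseRange_polySphere (d : ℕ) : DenseRange (polySphere d) := by
  let A : StarSubalgebra ℂ C(Sphere d, ℂ) :=
    { (polySphere d).range with
      star_mem' := by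
        rintro _ ⟨p, rfl⟩
        refine ⟨MvPolynomial.map (starRingEnd ℂ) p, ?_⟩
        ext y
        simp only [AlgHom.toRingHom_eq_coe, RingHom.coe_coe, ContinuousMap.star_apply]
        rw [polySphere_apply, polySphere_apply, polyFun_map_conj]
        rfl }
  have hsep : A.SeparatesPoints := by
    intro x y hxy
    obtain ⟨i, hi⟩ : ∃ i, (x : E d) i ≠ (y : E d) i := by
      by_contra! h
      exact hxy (Subtype.ext (PiLp.ext h))
    refine ⟨_, ⟨polySphere d (MvPolynomial.X i), ⟨MvPolynomial.X i, rfl⟩, rfl⟩, ?_⟩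
    change polySphere d (MvPolynomial.X i) x ≠ polySphere d (MvPolynomial.X i) y
    rw [polySphere_apply, polySphere_apply]
    simpa [polyFun] using hi
  have h := ContinuousMap.starSubalgebra_topologicalClosure_eq_top_of_separatesPoints A hsep
  intro f
  have hf : f ∈ A.topologicalClosure := by rw [h]; trivial
  exact hf

theorem memLp_sphere {F : E d → ℂ} (hF : Continuous F) :
    MemLp (fun y : Sphere d => F y) 2 (sphereMeasure d) :=
  MemLp.of_bound (hF.comp continuous_subtype_val).aestronglyMeasurable _
    (Eventually.of_forall (ContinuousMap.mk (fun y : Sphere d => F y)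
      (hF.comp continuous_subtype_val)).norm_coe_le_norm)

theorem continuous_of_mem_smoothSpace {F : E d → ℂ} (hF : F ∈ smoothSpace d) : Continuous F :=
  ContDiff.continuous (𝕜 := ℝ) (n := ∞) hF

/-- Restriction of smooth functions to the sphere. -/
def restₗ (d : ℕ) : smoothSpace d →ₗ[ℂ] L2Sphere d where
  toFun F := toL2 (sphereMeasure d) fun y => F.1 y
  map_add' F H := toL2_add (memLp_sphere (continuous_of_mem_smoothSpace F.2))
    (memLp_sphere (continuous_of_mem_smoothSpace H.2))
  map_smul' c F := toL2_smul c (memLp_sphere (continuous_of_mem_smoothSpace F.2))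

/-- The class in `L²(𝕊^{d-1})` of the restriction of `F`. -/
def rest (F : E d → ℂ) : L2Sphere d := toL2 (sphereMeasure d) fun y => F y

theorem coeFn_rest {F : E d → ℂ} (hF : Continuous F) :
    ∀ᵐ y ∂sphereMeasure d, rest F y = F y := coeFn_toL2 (memLp_sphere hF)

theorem eq_rest {F : E d → ℂ} {f : L2Sphere d} (h : ∀ᵐ y ∂sphereMeasure d, f y = F y) :
    f = rest F := eq_toL2_of_ae_eq h

theorem rest_add {F H : E d → ℂ} (hF : Continuous F) (hH : Continuous H) :
    rest (F + H) = rest F + rest H := toL2_add (memLp_sphere hF) (memLp_sphere hH)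

theorem rest_smul (c : ℂ) {F : E d → ℂ} (hF : Continuous F) :
    rest (c • F) = c • rest F := toL2_smul c (memLp_sphere hF)

theorem denseRange_rest_polyFun (d : ℕ) :
    DenseRange fun p : MvPolynomial (Fin d) ℂ => rest (polyFun p) := by
  have h1 := ContinuousMap.toLp_denseRange ℂ (sphereMeasure d) ℂ (p := 2) (by norm_num)
  have h2 := h1.comp (denseRange_polySphere d) (ContinuousLinearMap.continuous _)
  convert h2 using 1
  ext1 p
  symm
  refine eq_rest ?_
  filter_upwards [ContinuousMap.coeFn_toLp (p := 2) (𝕜 := ℂ) (sphereMeasure d) (polySphere d p)] with y hy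
  rw [Function.comp_apply, hy, polySphere_apply]

theorem denseRange_restₗ (d : ℕ) : DenseRange (restₗ d) :=
  (denseRange_rest_polyFun d).mono (by
    rintro _ ⟨p, rfl⟩
    exact ⟨⟨polyFun p, contDiff_polyFun p⟩, rfl⟩)

theorem norm_sq_rest {F : E d → ℂ} (hF : Continuous F) :
    ‖rest F‖ ^ 2 = ∫ y : Sphere d, ‖F y‖ ^ 2 ∂sphereMeasure d := norm_sq_toL2 (memLp_sphere hF)

theorem inner_rest {F H : E d → ℂ} (hF : Continuous F) (hH : Continuous H) :
    inner ℂ (rest F) (rest H) = ∫ y : Sphere d, conj (F y) * H y ∂sphereMeasure d :=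
  inner_toL2 (memLp_sphere hF) (memLp_sphere hH)

/-! ### The Poisson operator and the solution operator of `-Δ + 1` -/

/-- The jet of the solution of `-Δu + u = 0` with boundary values `F`. -/
def poissonJet (F : E d → ℂ) : JetSpace d := jet F - (H10 d).starProjection (jet F)

theorem inner_poissonJet {v : JetSpace d} (hv : v ∈ H10 d) (F : E d → ℂ) :
    inner ℂ v (poissonJet F) = 0 :=
  (Submodule.mem_orthogonal _ _).1 (Submodule.sub_starProjection_mem_orthogonal (jet F)) v hv

theorem inner_poissonJet_right {v : JetSpace d} (hv : v ∈ H10 d) (F : E d → ℂ) :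
    inner ℂ (poissonJet F) v = 0 := by
  rw [← inner_conj_symm, inner_poissonJet hv, map_zero]

theorem jet_sub_poissonJet_mem (F : E d → ℂ) : jet F - poissonJet F ∈ H10 d := by
  rw [poissonJet, sub_sub_cancel]
  exact Submodule.starProjection_apply_mem _ _

/-- The function component of `poissonJet`, as a linear map. -/
def poissonₗ (d : ℕ) : smoothSpace d →ₗ[ℂ] L2Ball d :=
  ((PiLp.proj 2 (fun _ : Option (Fin d) => L2Ball d) none).comp
    (ContinuousLinearMap.id ℂ (JetSpace d) - (H10 d).starProjection)).toLinearMap.comp (jetₗ d)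

/-- This bound by the L² norm of the boundary values alone is what extends the Poisson operator to
all of L² of the sphere, and hence makes the difference of Dirichlet-to-Neumann maps bounded. -/
theorem norm_poissonₗ_le (hd : 0 < d) (F : smoothSpace d) :
    ‖poissonₗ d F‖ ≤ 1 * ‖restₗ d F‖ := by
  have h := norm_sq_le_of_orthogonal hd (F := F.1) F.2 (X := poissonJet F.1)
    (fun v hv => inner_poissonJet hv _) (jet_sub_poissonJet_mem _)
  rw [← norm_sq_rest (continuous_of_mem_smoothSpace F.2)] at h
  have h1 : (1 : ℝ) ≤ d := by exact_mod_cast hd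
  have h2 : ‖poissonJet F.1 none‖ ^ 2 ≤ ‖rest F.1‖ ^ 2 := by
    nlinarith [sq_nonneg ‖poissonJet F.1 none‖]
  rw [one_mul]
  exact (abs_le_of_sq_le_sq' h2 (norm_nonneg _)).2

/-- The Poisson operator of `-Δ + 1` from `L²(𝕊^{d-1})` to `L²(𝔹^d)`. -/
def poisson (d : ℕ) : L2Sphere d →L[ℂ] L2Ball d := (poissonₗ d).extendOfNorm (restₗ d)

theorem poisson_rest (hd : 0 < d) {F : E d → ℂ} (hF : ContDiff ℝ ∞ F) :
    poisson d (rest F) = poissonJet F none :=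
  LinearMap.extendOfNorm_eq (denseRange_restₗ d) ⟨1, norm_poissonₗ_le hd⟩ (⟨F, hF⟩ : smoothSpace d)

/-- The adjoint of the inclusion of `H¹₀` into `L²`: the jet of the solution of `-Δu + u = f` with
zero boundary values. -/
def solJet (d : ℕ) : L2Ball d →L[ℂ] H10 d := (inclH10 d).adjoint

/-- The solution operator of `-Δu + u = f` with zero boundary values. -/
def solOp (d : ℕ) : L2Ball d →L[ℂ] L2Ball d := (inclH10 d).comp (solJet d)

theorem inner_solJet {v : JetSpace d} (hv : v ∈ H10 d) (f : L2Ball d) :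
    inner ℂ v (solJet d f : JetSpace d) = inner ℂ (v none) f := by
  have := ContinuousLinearMap.adjoint_inner_right (inclH10 d) ⟨v, hv⟩ f
  rwa [Submodule.coe_inner] at this

/-- Uniqueness for -Δ + 1: the difference lies in `H10 d` and is orthogonal to all of it, in
particular to itself. -/
theorem eq_solJet {w : JetSpace d} (hw : w ∈ H10 d) {f : L2Ball d}
    (h : ∀ v ∈ H10 d, inner ℂ v w = inner ℂ (v none) f) : w = solJet d f := by
  have : w - solJet d f ∈ H10 d := Submodule.sub_mem _ hw (solJet d f).2
  rw [← sub_eq_zero, ← inner_self_eq_zero (𝕜 := ℂ), inner_sub_right, h _ this, inner_solJet this,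
    sub_self]

theorem solJet_none (f : L2Ball d) : (solJet d f : JetSpace d) none = solOp d f := rfl

theorem isCompactOperator_solOp (d : ℕ) : IsCompactOperator (solOp d) :=
  (isCompactOperator_inclH10 d).comp_clm (solJet d)

/-- `solOp d` is the inclusion composed with its adjoint. -/
theorem inner_solOp_left (f g : L2Ball d) : inner ℂ (solOp d f) g = inner ℂ f (solOp d g) := by
  have h1 := ContinuousLinearMap.adjoint_inner_right (inclH10 d) (solJet d f) g
  have h2 := ContinuousLinearMap.adjoint_inner_left (inclH10 d) (solJet d g) f
  exact h1.symm.trans h2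

/-- Representation of a smooth function through its boundary values and `-Δ + 1`. -/
theorem toL2_sub_solOp (hd : 0 < d) {F : E d → ℂ} (hF : ContDiff ℝ ∞ F) :
    toL2 (ballMeasure d) F - solOp d (toL2 (ballMeasure d) fun x => F x - lap F x) =
      poisson d (rest F) := by
  have h := eq_solJet (jet_sub_poissonJet_mem F) (f := toL2 (ballMeasure d) fun x => F x - lap F x)
    fun v hv => by rw [inner_sub_right, inner_poissonJet hv, sub_zero, inner_jet_of_mem_H10 hv hF]
  rw [poisson_rest hd hF, ← solJet_none, ← h]
  simp

/-! ### Weak solutions in terms of operators on `L²(𝔹^d)` -/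

/-- Multiplication by `q - κ - 1`. -/
def potOp (κ : ℂ) (q : Potential d) : L2Ball d →L[ℂ] L2Ball d :=
  mulOp d q - (κ + 1) • ContinuousLinearMap.id ℂ (L2Ball d)

/-- The operator `1 + (-Δ + 1)⁻¹ (q - κ - 1)`. -/
def helmholtzOp (κ : ℂ) (q : Potential d) : L2Ball d →L[ℂ] L2Ball d :=
  1 + solOp d * potOp κ q

theorem coeFn_potOp (κ : ℂ) (q : Potential d) {u : E d → ℂ} (hu : MemLp u 2 (ballMeasure d)) :
    potOp κ q (toL2 (ballMeasure d) u) =ᵐ[ballMeasure d]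
      fun x => ((q x : ℂ) - κ - 1) * u x := by
  have h1 := Lp.coeFn_sub (mulOp d q (toL2 (ballMeasure d) u)) ((κ + 1) • toL2 (ballMeasure d) u)
  filter_upwards [h1, coeFn_mulOp q (toL2 (ballMeasure d) u), coeFn_toL2 hu,
    Lp.coeFn_smul (κ + 1) (toL2 (ballMeasure d) u)] with x h1 h2 h3 h4
  change (mulOp d q (toL2 (ballMeasure d) u) - (κ + 1) • toL2 (ballMeasure d) u : L2Ball d) x = _
  rw [h1, Pi.sub_apply, h2, h4, Pi.smul_apply, h3, smul_eq_mul]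
  ring

/-- The energy form is bilinear and the inner product sesquilinear, hence the conjugate on h. The H¹
inner product already contains ∫ u h, which is compensated by the -1 in `potOp`. -/
theorem energyForm_eq (κ : ℂ) (q : Potential d) {u : E d → ℂ} {G : Fin d → E d → ℂ}
    (hu : IsH1 u G) {h : E d → ℂ} (hh : ContDiff ℝ ∞ h) :
    energyForm κ q u G h = inner ℂ (jet fun x => conj (h x)) (weakJet u G) +
      inner ℂ (toL2 (ballMeasure d) fun x => conj (h x)) (potOp κ q (toL2 (ballMeasure d) u)) := by
  have hc := contDiff_conj hh
  have hm := memLp_of_contDiff hh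
  have hm' := memLp_of_contDiff hc
  have e0 : inner ℂ (toL2 (ballMeasure d) fun x => conj (h x)) (toL2 (ballMeasure d) u) =
      ∫ x in ball d, h x * u x := by
    rw [inner_toL2 hm' hu.memLp]; simp
  have e1 : ∀ i : Fin d, inner ℂ (toL2 (ballMeasure d) (partialDeriv i fun x => conj (h x)))
      (toL2 (ballMeasure d) (G i)) = ∫ x in ball d, G i x * partialDeriv i h x := fun i => by
    rw [inner_toL2 (memLp_partialDeriv hc i) (hu.memLp_grad i)]
    simp [partialDeriv_conj, mul_comm]
  have e2 : inner ℂ (toL2 (ballMeasure d) fun x => conj (h x)) (potOp κ q (toL2 (ballMeasure d) u)) =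
      ∫ x in ball d, h x * (((q x : ℂ) - κ - 1) * u x) := by
    rw [inner_eq_integral_of_ae (coeFn_toL2 hm') (coeFn_potOp κ q hu.memLp)]; simp
  have m1 : MemLp (fun x => ((q x : ℂ) - κ - 1) * u x) 2 (ballMeasure d) :=
    (memLp_congr_ae (coeFn_potOp κ q hu.memLp)).1 (Lp.memLp _)
  have i0 : Integrable (fun x => h x * u x) (ballMeasure d) := hm.integrable_mul hu.memLp
  have i1 : ∀ i, Integrable (fun x => G i x * partialDeriv i h x) (ballMeasure d) := fun i =>
    (hu.memLp_grad i).integrable_mul (memLp_partialDeriv hh i)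
  have i2 : Integrable (fun x => h x * (((q x : ℂ) - κ - 1) * u x)) (ballMeasure d) :=
    hm.integrable_mul m1
  rw [inner_jetSpace, e2]
  simp only [jet_none, jet_some, weakJet_none, weakJet_some]
  rw [e0]
  simp_rw [e1]
  rw [← integral_finsetSum _ fun i _ => i1 i, ← integral_add i0 (integrable_finsetSum _ fun i _ => i1 i),
    ← integral_add (f := fun x => h x * u x + ∑ i, G i x * partialDeriv i h x)
      (i0.add (integrable_finsetSum _ fun i _ => i1 i)) i2]
  unfold energyForm
  congr 1
  ext x
  ring

theorem isWeakSolution_iff (κ : ℂ) (q : Potential d) {u : E d → ℂ} {G : Fin d → E d → ℂ}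
    (hu : IsH1 u G) : IsWeakSolution κ q u G ↔ ∀ v ∈ H10 d, inner ℂ v (weakJet u G) +
      inner ℂ (v none) (potOp κ q (toL2 (ballMeasure d) u)) = 0 := by
  constructor
  · intro h v hv
    obtain ⟨φ, hφ, hlim⟩ := exists_seq_of_mem_H10 hv
    have l := (hlim.inner (𝕜 := ℂ) (tendsto_const_nhds (x := weakJet u G))).add
      ((tendsto_jetSpace_iff.1 hlim none).inner (𝕜 := ℂ)
        (tendsto_const_nhds (x := potOp κ q (toL2 (ballMeasure d) u))))
    refine tendsto_nhds_unique l (tendsto_const_nhds.congr fun n => ?_)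
    have := energyForm_eq κ q hu (hφ n).conj.smooth
    simp only [Complex.conj_conj] at this
    rw [← h _ (hφ n).conj, this]
    rfl
  · intro h φ hφ
    rw [energyForm_eq κ q hu hφ.smooth]
    exact h _ (jet_mem_H10 hφ.conj)

/-- The weak equation says that the jet of u is `solJet` applied to -(q - κ - 1)u. Conversely, a
kernel vector U is the function component of the jet `solJet d (-potOp κ q U)`, which lies in `H10
d` and supplies the missing gradient. -/
theorem isDirichletEigenvalue_iff (κ : ℂ) (q : Potential d) :
    IsDirichletEigenvalue κ q ↔ ∃ U : L2Ball d, U ≠ 0 ∧ helmholtzOp κ q U = 0 := by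
  constructor
  · rintro ⟨u, G, h0, hw, hne⟩
    rw [isWeakSolution_iff κ q h0.isH1] at hw
    refine ⟨toL2 (ballMeasure d) u, fun h => hne ?_, ?_⟩
    · have := coeFn_toL2 h0.isH1.memLp
      rw [h] at this
      exact this.symm.trans (Lp.coeFn_zero _ _ _)
    · have := eq_solJet (mem_H10_of_isH10 h0) (f := -potOp κ q (toL2 (ballMeasure d) u)) fun v hv => by
        rw [inner_neg_right]; exact eq_neg_of_add_eq_zero_left (hw v hv)
      have h1 := congrArg (fun w : JetSpace d => w none) this
      simp only [weakJet_none, solJet_none] at h1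
      change toL2 (ballMeasure d) u + solOp d (potOp κ q (toL2 (ballMeasure d) u)) = 0
      nth_rewrite 1 [h1]
      simp
  · rintro ⟨U, hU, h⟩
    have h' : U + solOp d (potOp κ q U) = 0 := h
    obtain ⟨v, hv⟩ : ∃ v : JetSpace d, v = solJet d (-potOp κ q U) := ⟨_, rfl⟩
    have hvU : v none = U := by
      rw [hv, solJet_none, map_neg]; exact (eq_neg_of_add_eq_zero_left h').symm
    have h0 := isH10_of_mem_H10 (v := v) (hv ▸ (solJet d _).2)
    refine ⟨_, _, h0, (isWeakSolution_iff κ q h0.isH1).2 fun w hw => ?_, fun hz => hU ?_⟩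
    · rw [weakJet_coeFn, toL2_coeFn, hvU, hv, inner_solJet hw, inner_neg_right, neg_add_cancel]
    · rw [hvU] at hz
      exact Lp.ext (hz.trans (Lp.coeFn_zero _ _ _).symm)

theorem potOp_zero (κ : ℂ) : potOp κ (0 : Potential d) =
    -(κ + 1) • ContinuousLinearMap.id ℂ (L2Ball d) := by
  rw [potOp, map_zero, zero_sub, neg_smul]

theorem helmholtzOp_zero (κ : ℂ) : helmholtzOp κ (0 : Potential d) = 1 - (κ + 1) • solOp d := by
  rw [helmholtzOp, potOp_zero]
  ext1 u
  change u + solOp d (-(κ + 1) • u) = u - (κ + 1) • solOp d u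
  rw [map_smul, neg_smul, sub_eq_add_neg]

/-- Fredholm alternative: for κ ≠ -1 the operator is κ + 1 times (κ + 1)⁻¹ - `solOp d`, and a
nonzero number is either an eigenvalue of a compact operator or in its resolvent set. For κ = -1 it
is the identity. -/
theorem isUnit_helmholtzOp_zero {κ : ℂ} (h : ¬ IsDirichletEigenvalue κ (0 : Potential d)) :
    IsUnit (helmholtzOp κ (0 : Potential d)) := by
  rw [helmholtzOp_zero]
  by_cases hk : κ + 1 = 0
  · simp [hk]
  rcases (isCompactOperator_solOp d).hasEigenvalue_or_mem_resolventSet (inv_ne_zero hk) with h1 | h1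
  · obtain ⟨u, hu⟩ := h1.exists_hasEigenvector
    refine absurd ((isDirichletEigenvalue_iff κ 0).2 ⟨u, hu.2, ?_⟩) h
    have h2 : solOp d u = (κ + 1)⁻¹ • u := hu.apply_eq_smul
    rw [helmholtzOp_zero]
    simp [h2, smul_smul, hk]
  · rw [spectrum.mem_resolventSet_iff] at h1
    have h2 : (1 : L2Ball d →L[ℂ] L2Ball d) - (κ + 1) • solOp d =
        (κ + 1) • (algebraMap ℂ (L2Ball d →L[ℂ] L2Ball d) (κ + 1)⁻¹ - solOp d) := by
      rw [smul_sub, Algebra.algebraMap_eq_smul_one, smul_smul, mul_inv_cancel₀ hk, one_smul]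
    rw [h2]
    rw [Algebra.smul_def]
    exact ((IsUnit.mk0 _ hk).map (algebraMap ℂ _)).mul h1

/-- The resolvent `(1 + (-Δ + 1)⁻¹ (q - κ - 1))⁻¹`. -/
def resolvOp (κ : ℂ) (q : Potential d) : L2Ball d →L[ℂ] L2Ball d := Ring.inverse (helmholtzOp κ q)

theorem resolvOp_helmholtzOp {κ : ℂ} {q : Potential d} (h : IsUnit (helmholtzOp κ q))
    (U : L2Ball d) : resolvOp κ q (helmholtzOp κ q U) = U := by
  have := Ring.inverse_mul_cancel _ h
  exact congrArg (fun T : L2Ball d →L[ℂ] L2Ball d => T U) this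

theorem not_isDirichletEigenvalue_of_isUnit {κ : ℂ} {q : Potential d}
    (h : IsUnit (helmholtzOp κ q)) : ¬ IsDirichletEigenvalue κ q := by
  rw [isDirichletEigenvalue_iff]
  rintro ⟨U, hU, h0⟩
  exact hU (by rw [← resolvOp_helmholtzOp h U, h0, map_zero])

theorem helmholtzOp_resolvOp {κ : ℂ} {q : Potential d} (h : IsUnit (helmholtzOp κ q))
    (U : L2Ball d) : helmholtzOp κ q (resolvOp κ q U) = U := by
  have := Ring.mul_inverse_cancel _ h
  exact congrArg (fun T : L2Ball d →L[ℂ] L2Ball d => T U) this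

theorem weakJet_sub {F : E d → ℂ} (hF : ContDiff ℝ ∞ F) {u : E d → ℂ} {G : Fin d → E d → ℂ}
    (hu : IsH1 u G) :
    weakJet (fun x => u x - F x) (fun i x => G i x - partialDeriv i F x) = weakJet u G - jet F := by
  ext1 o
  cases o with
  | none => exact toL2_sub hu.memLp (memLp_of_contDiff hF)
  | some i => exact toL2_sub (hu.memLp_grad i) (memLp_partialDeriv hF i)

/-- Subtracting the Poisson extension leaves an element of `H10 d` that solves -Δw + w = -(q - κ -
1)u weakly. -/
theorem IsDirichletSolution.weakJet_eq {κ : ℂ} {q : Potential d} {F : E d → ℂ}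
    (hF : ContDiff ℝ ∞ F) {u : E d → ℂ} {G : Fin d → E d → ℂ} (h : IsDirichletSolution κ q F u G) :
    weakJet u G = poissonJet F - solJet d (potOp κ q (toL2 (ballMeasure d) u)) := by
  have hw := (isWeakSolution_iff κ q h.isH1).1 h.weak_eq
  have hb := mem_H10_of_isH10 h.boundary
  rw [weakJet_sub hF h.isH1] at hb
  have hm : weakJet u G - poissonJet F ∈ H10 d := by
    have := Submodule.add_mem _ hb (jet_sub_poissonJet_mem F)
    rwa [sub_add_sub_cancel] at this
  have := eq_solJet hm (f := -potOp κ q (toL2 (ballMeasure d) u)) fun v hv => by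
    rw [inner_sub_right, inner_poissonJet hv, sub_zero, inner_neg_right]
    exact eq_neg_of_add_eq_zero_left (hw v hv)
  rw [sub_eq_iff_eq_add] at this
  rw [this, map_neg, Submodule.coe_neg]
  abel

theorem IsDirichletSolution.toL2_eq (hd : 0 < d) {κ : ℂ} {q : Potential d}
    (hq : IsUnit (helmholtzOp κ q)) {F : E d → ℂ} (hF : ContDiff ℝ ∞ F) {u : E d → ℂ}
    {G : Fin d → E d → ℂ} (h : IsDirichletSolution κ q F u G) :
    toL2 (ballMeasure d) u = resolvOp κ q (poisson d (rest F)) := by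
  have h1 := congrArg (fun w : JetSpace d => w none) (h.weakJet_eq hF)
  simp only [weakJet_none, PiLp.sub_apply, solJet_none, ← poisson_rest hd hF] at h1
  have h2 : helmholtzOp κ q (toL2 (ballMeasure d) u) = poisson d (rest F) := by
    change toL2 (ballMeasure d) u + solOp d (potOp κ q (toL2 (ballMeasure d) u)) = _
    nth_rewrite 1 [h1]
    simp
  rw [← h2, resolvOp_helmholtzOp hq]

theorem exists_isDirichletSolution (hd : 0 < d) {κ : ℂ} {q : Potential d}
    (hq : IsUnit (helmholtzOp κ q)) {F : E d → ℂ} (hF : ContDiff ℝ ∞ F) :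
    ∃ u G, IsDirichletSolution κ q F u G := by
  set U := resolvOp κ q (poisson d (rest F)) with hU
  -- The full jet is rebuilt from the L² function U. Its function component is again U by the
  -- equation (1 + S V)U = P f.
  set X : JetSpace d := poissonJet F - solJet d (potOp κ q U) with hX
  have hXU : X none = U := by
    have := helmholtzOp_resolvOp hq (poisson d (rest F))
    rw [← hU] at this
    change U + solOp d (potOp κ q U) = _ at this
    rw [hX, PiLp.sub_apply, solJet_none, ← poisson_rest hd hF, ← this]
    simp
  have hm : X - jet F ∈ H10 d := by
    have h1 := Submodule.neg_mem _ (jet_sub_poissonJet_mem F)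
    have h2 := Submodule.sub_mem _ h1 (solJet d (potOp κ q U)).2
    have h3 : -(jet F - poissonJet F) - solJet d (potOp κ q U) = X - jet F := by rw [hX]; abel
    rwa [h3] at h2
  have hb := isH10_of_mem_H10 hm
  have hFm := isH1_of_contDiff hF
  have h1 := hb.isH1.add hFm
  refine ⟨_, _, h1, ?_, ?_⟩
  · simpa only [add_sub_cancel_right] using hb
  · refine (isWeakSolution_iff κ q h1).2 fun v hv => ?_
    have e0 : toL2 (ballMeasure d) (fun x => (X - jet F) none x + F x) = U := by
      have := toL2_add hb.isH1.memLp hFm.memLp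
      rw [toL2_coeFn] at this
      refine this.trans ?_
      simp [hXU]
    have e1 : weakJet (fun x => (X - jet F) none x + F x)
        (fun i x => (X - jet F) (some i) x + partialDeriv i F x) = X := by
      ext1 o
      cases o with
      | none => rw [weakJet_none, e0, hXU]
      | some i =>
        have := toL2_add (hb.isH1.memLp_grad i) (hFm.memLp_grad i)
        rw [toL2_coeFn] at this
        refine this.trans ?_
        simp
    rw [e0, e1, hX, inner_sub_right, inner_poissonJet hv, inner_solJet hv]
    simp

/-- The jet of the conjugate of H is its Poisson extension plus an element of `H10 d`, and the weak
equation removes the latter. Against a Poisson extension, the H¹ inner product sees only the Poisson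
part of u, as the rest of u lies in `H10 d`. So the gradient term does not depend on q or κ. -/
theorem IsDirichletSolution.energyForm_eq (hd : 0 < d) {κ : ℂ} {q : Potential d}
    (hq : IsUnit (helmholtzOp κ q)) {F H : E d → ℂ} (hF : ContDiff ℝ ∞ F) (hH : ContDiff ℝ ∞ H)
    {u : E d → ℂ} {G : Fin d → E d → ℂ} (h : IsDirichletSolution κ q F u G) :
    energyForm κ q u G H = inner ℂ (poissonJet fun x => conj (H x)) (poissonJet F) +
      inner ℂ (poisson d (rest fun x => conj (H x)))
        (potOp κ q (resolvOp κ q (poisson d (rest F)))) := by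
  have hw := (isWeakSolution_iff κ q h.isH1).1 h.weak_eq _
    (jet_sub_poissonJet_mem fun x => conj (H x))
  rw [RadialCalderon.energyForm_eq κ q h.isH1 hH, ← h.toL2_eq hd hq hF,
    poisson_rest hd (contDiff_conj hH)]
  rw [inner_sub_left, PiLp.sub_apply, inner_sub_left, jet_none] at hw
  have h1 : inner ℂ (poissonJet fun x => conj (H x)) (weakJet u G) =
      inner ℂ (poissonJet fun x => conj (H x)) (poissonJet F) := by
    rw [h.weakJet_eq hF, inner_sub_right, inner_poissonJet_right (solJet d _).2, sub_zero]
  rw [← h1]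
  linear_combination hw

/-- The operator that represents `Λ_{q,κ} - Λ_{0,κ}`. -/
def dtnDiff (κ : ℂ) (q : Potential d) : L2Sphere d →L[ℂ] L2Sphere d :=
  (poisson d).adjoint.comp
    ((potOp κ q * resolvOp κ q - potOp κ 0 * resolvOp κ 0).comp (poisson d))

theorem integral_mul_rest (f : L2Sphere d) {H : E d → ℂ} (hH : ContDiff ℝ ∞ H) :
    ∫ y, f y * H y ∂sphereMeasure d = inner ℂ (rest fun x => conj (H x)) f := by
  rw [rest, inner_toL2_left (memLp_sphere (contDiff_conj hH).continuous)]
  simp [mul_comm]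

theorem clm_ext_of_rest {T S : L2Sphere d →L[ℂ] L2Sphere d}
    (h : ∀ F H : E d → ℂ, ContDiff ℝ ∞ F → ContDiff ℝ ∞ H →
      inner ℂ (rest H) (T (rest F)) = inner ℂ (rest H) (S (rest F))) : T = S := by
  have h1 : ∀ f, T f = S f := by
    refine congrFun ((denseRange_restₗ d).equalizer T.continuous S.continuous (funext fun F => ?_))
    refine ext_inner_left ℂ fun g => ?_
    have h2 : (fun g => inner ℂ g (T (restₗ d F))) = fun g => inner ℂ g (S (restₗ d F)) :=
      (denseRange_restₗ d).equalizer (continuous_id.inner continuous_const)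
        (continuous_id.inner continuous_const) (funext fun H => h F.1 H.1 F.2 H.2)
    exact congrFun h2 g
  exact ContinuousLinearMap.ext h1

theorem inner_adjoint_comp_comp (Z : L2Ball d →L[ℂ] L2Ball d) (f g : L2Sphere d) :
    inner ℂ g ((poisson d).adjoint.comp (Z.comp (poisson d)) f) =
      inner ℂ (poisson d g) (Z (poisson d f)) :=
  ContinuousLinearMap.adjoint_inner_right (poisson d) g (Z (poisson d f))

/-- The q-independent Poisson terms cancel in the difference of the two energy forms, leaving the
matrix elements of `dtnDiff`. Uniqueness holds since restrictions of smooth functions are dense. -/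
theorem isDtNDifference_iff (hd : 0 < d) {κ : ℂ} {q : Potential d}
    (hq : IsUnit (helmholtzOp κ q)) (h0 : IsUnit (helmholtzOp κ (0 : Potential d)))
    (T : L2Sphere d →L[ℂ] L2Sphere d) : IsDtNDifference κ q T ↔ T = dtnDiff κ q := by
  have key : ∀ F H : E d → ℂ, inner ℂ (rest H) (dtnDiff κ q (rest F)) =
      inner ℂ (poisson d (rest H)) (potOp κ q (resolvOp κ q (poisson d (rest F)))) -
      inner ℂ (poisson d (rest H)) (potOp κ 0 (resolvOp κ 0 (poisson d (rest F)))) := fun F H => by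
    rw [← inner_sub_right]
    exact inner_adjoint_comp_comp _ _ _
  constructor
  · intro hT
    refine clm_ext_of_rest fun F H hF hH => ?_
    obtain ⟨z₁, z₀, ⟨u, G, hs, hz⟩, ⟨u', G', hs', hz'⟩, h⟩ :=
      hT F _ hF (contDiff_conj hH) (rest F) (coeFn_rest hF.continuous)
    rw [integral_mul_rest _ (contDiff_conj hH), hz, hz',
      hs.energyForm_eq hd hq hF (contDiff_conj hH), hs'.energyForm_eq hd h0 hF (contDiff_conj hH)] at h
    simp only [Complex.conj_conj] at h
    rw [key, h]
    ring
  · rintro rfl F H hF hH f hf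
    obtain ⟨u, G, hs⟩ := exists_isDirichletSolution hd hq hF
    obtain ⟨u', G', hs'⟩ := exists_isDirichletSolution hd h0 hF
    refine ⟨_, _, ⟨u, G, hs, rfl⟩, ⟨u', G', hs', rfl⟩, ?_⟩
    rw [eq_rest hf, integral_mul_rest _ hH, key, hs.energyForm_eq hd hq hF hH,
      hs'.energyForm_eq hd h0 hF hH]
    ring

theorem phi_eq_dtnDiff (hd : 0 < d) {κ : ℂ} {q : Potential d}
    (hq : IsUnit (helmholtzOp κ q)) (h0 : IsUnit (helmholtzOp κ (0 : Potential d))) :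
    Phi d κ q = dtnDiff κ q := by
  have h : ∃ T : L2Sphere d →L[ℂ] L2Sphere d, IsDtNDifference κ q T :=
    ⟨_, (isDtNDifference_iff hd hq h0 _).2 rfl⟩
  rw [Phi, dif_pos h]
  exact (isDtNDifference_iff hd hq h0 _).1 h.choose_spec

/-! ### Differentiability -/

/-- The derivative of `Phi` at `0` in the direction `q`. -/
def dPhi (κ : ℂ) (q : Potential d) : L2Sphere d →L[ℂ] L2Sphere d :=
  (poisson d).adjoint.comp ((resolvOp κ 0 * mulOp d q * resolvOp κ 0).comp (poisson d))

theorem continuous_helmholtzOp (κ : ℂ) : Continuous (helmholtzOp (d := d) κ) := by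
  unfold helmholtzOp potOp
  fun_prop

theorem eventually_isUnit_helmholtzOp {κ : ℂ} (h0 : IsUnit (helmholtzOp κ (0 : Potential d))) :
    ∀ᶠ q : Potential d in 𝓝 0, IsUnit (helmholtzOp κ q) :=
  (continuous_helmholtzOp κ).continuousAt.eventually (Units.isOpen.mem_nhds h0)

theorem resolvOp_zero_eq {κ : ℂ} (h0 : IsUnit (helmholtzOp κ (0 : Potential d))) :
    resolvOp κ (0 : Potential d) = 1 + (κ + 1) • (resolvOp κ (0 : Potential d) * solOp d) := by
  have := Ring.inverse_mul_cancel _ h0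
  rw [helmholtzOp_zero, mul_sub, mul_one, mul_smul_comm, sub_eq_iff_eq_add, ← helmholtzOp_zero] at this
  exact this

/-- Product rule together with d(w⁻¹) = -w⁻¹ dw w⁻¹. The common right factor M q · (1 + N K)⁻¹ is
pulled out. -/
theorem hasFDerivAt_mul_ringInverse {A V : Type*} [NormedRing A] [NormedAlgebra ℝ A]
    [HasSummableGeomSeries A] [NormedAddCommGroup V] [NormedSpace ℝ V] (M : V →L[ℝ] A) (N K : A)
    (h : IsUnit (1 + N * K)) :
    ∃ D : V →L[ℝ] A, HasFDerivAt (fun q => (M q + K) * Ring.inverse (1 + N * (M q + K))) D 0 ∧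
      ∀ q, D q = (1 - K * Ring.inverse (1 + N * K) * N) * M q * Ring.inverse (1 + N * K) := by
  obtain ⟨w, hw⟩ := h
  have h1 : HasFDerivAt (fun q => M q + K) M 0 := M.hasFDerivAt.add_const K
  have h2 : HasFDerivAt (fun q => 1 + N * (M q + K)) ((ContinuousLinearMap.mul ℝ A N).comp M) 0 :=
    ((ContinuousLinearMap.mul ℝ A N).hasFDerivAt.comp 0 h1).const_add 1
  have h3 : HasFDerivAt Ring.inverse
      (-ContinuousLinearMap.mulLeftRight ℝ A ↑w⁻¹ ↑w⁻¹) (1 + N * (M 0 + K)) := by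
    rw [map_zero, zero_add, ← hw]
    exact hasFDerivAt_ringInverse w
  have h4 := HasFDerivAt.comp (g := Ring.inverse) (f := fun q => 1 + N * (M q + K)) (0 : V) h3 h2
  refine ⟨_, h1.mul' h4, fun q => ?_⟩
  simp only [map_zero, zero_add, ← hw, Ring.inverse_unit, add_apply, smul_apply,
    ContinuousLinearMap.comp_apply, neg_apply, ContinuousLinearMap.mulLeftRight_apply,
    ContinuousLinearMap.mul_apply', smul_eq_mul, op_smul_eq_mul]
  noncomm_ring

/-- `Phi` is known to equal `dtnDiff` only near 0, which suffices for the derivative. Sandwiching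
with the Poisson operator and its adjoint is linear and continuous. -/
theorem hasFDerivAt_Phi (hd : 0 < d) {κ : ℂ} (h0 : IsUnit (helmholtzOp κ (0 : Potential d))) :
    ∃ D : Potential d →L[ℝ] (L2Sphere d →L[ℂ] L2Sphere d), HasFDerivAt (Phi d κ) D 0 ∧
      ∀ q, D q = dPhi κ q := by
  have hev : Phi d κ =ᶠ[𝓝 0] dtnDiff κ := by
    filter_upwards [eventually_isUnit_helmholtzOp h0] with q hq
    exact phi_eq_dtnDiff hd hq h0
  have hpot : ∀ q : Potential d, mulOp d q + potOp κ 0 = potOp κ q := fun q => by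
    rw [potOp_zero, potOp, neg_smul, sub_eq_add_neg]
  obtain ⟨D, hD, hDq⟩ := hasFDerivAt_mul_ringInverse (mulOp d) (solOp d) (potOp κ 0) h0
  have hfun : (fun q => (mulOp d q + potOp κ 0) *
      Ring.inverse (1 + solOp d * (mulOp d q + potOp κ 0))) =
      fun q => potOp κ q * resolvOp κ q := by
    ext1 q
    rw [hpot, resolvOp, helmholtzOp]
  let S : (L2Ball d →L[ℂ] L2Ball d) →L[ℝ] (L2Sphere d →L[ℂ] L2Sphere d) :=
    ((ContinuousLinearMap.compL ℂ (L2Sphere d) (L2Ball d) (L2Sphere d) (poisson d).adjoint).comp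
      ((ContinuousLinearMap.compL ℂ (L2Sphere d) (L2Ball d) (L2Ball d)).flip
        (poisson d))).restrictScalars ℝ
  have hD2 : HasFDerivAt (fun q => potOp κ q * resolvOp κ q) D 0 := hfun ▸ hD
  have hmul := S.hasFDerivAt.comp 0 (hD2.sub_const (potOp κ 0 * resolvOp κ 0))
  refine ⟨S.comp D, hmul.congr_of_eventuallyEq hev, fun q => ?_⟩
  change (poisson d).adjoint.comp ((D q).comp (poisson d)) = _
  rw [dPhi, hDq]
  congr 2
  change (1 - potOp κ 0 * resolvOp κ 0 * solOp d) * mulOp d q * resolvOp κ 0 = _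
  congr 2
  -- At q = 0 the multiplier V₀ is the scalar -(κ + 1), so the left factor 1 - V₀ R₀ S equals 1 + (κ
  -- + 1) R₀ S, which is R₀ again. This makes the differential symmetric in form.
  have hp : potOp κ (0 : Potential d) = -((κ + 1) • (1 : L2Ball d →L[ℂ] L2Ball d)) := by
    rw [potOp_zero, neg_smul]; rfl
  conv_rhs => rw [resolvOp_zero_eq h0]
  rw [hp, neg_mul, neg_mul, sub_neg_eq_add, smul_mul_assoc, smul_mul_assoc, one_mul]

/-! ### Harmonic polynomials -/

theorem partialDeriv_polyFun (i : Fin d) (p : MvPolynomial (Fin d) ℂ) :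
    partialDeriv i (polyFun p) = polyFun (MvPolynomial.pderiv i p) := by
  induction p using MvPolynomial.induction_on with
  | C a =>
    ext x
    rw [polyFun_C]
    simp [partialDeriv, polyFun]
  | add p q hp hq =>
    rw [polyFun_add, map_add, polyFun_add, ← hp, ← hq,
      partialDeriv_add (contDiff_polyFun p) (contDiff_polyFun q)]
  | mul_X p j hp =>
    ext x
    have hX : partialDeriv i (polyFun (MvPolynomial.X j)) x = if j = i then 1 else 0 := by
      rw [polyFun_X, partialDeriv]
      have : HasFDerivAt (fun x : E d => (x j : ℂ))
          (Complex.ofRealCLM.comp (EuclideanSpace.proj j : E d →L[ℝ] ℝ)) x :=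
        (Complex.ofRealCLM.comp (EuclideanSpace.proj j : E d →L[ℝ] ℝ)).hasFDerivAt
      rw [this.fderiv]
      simp only [ContinuousLinearMap.comp_apply]
      split_ifs with h <;> simp [h]
    rw [polyFun_mul, partialDeriv_mul (contDiff_polyFun p) (contDiff_polyFun _), hX, hp,
      Derivation.leibniz, MvPolynomial.pderiv_X]
    simp only [polyFun, smul_eq_mul, map_add, map_mul, MvPolynomial.eval_X, Pi.single_apply]
    split_ifs <;> simp_all

/-- The Laplacian of polynomials. -/
def lapP (d : ℕ) : MvPolynomial (Fin d) ℂ →ₗ[ℂ] MvPolynomial (Fin d) ℂ :=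
  ∑ i, (MvPolynomial.pderiv i).toLinearMap ∘ₗ (MvPolynomial.pderiv i).toLinearMap

theorem lapP_apply (p : MvPolynomial (Fin d) ℂ) :
    lapP d p = ∑ i, MvPolynomial.pderiv i (MvPolynomial.pderiv i p) := by
  simp [lapP]

theorem polyFun_zero : polyFun (0 : MvPolynomial (Fin d) ℂ) = 0 := by
  ext x; simp [polyFun]

theorem polyFun_smul (c : ℂ) (p : MvPolynomial (Fin d) ℂ) : polyFun (c • p) = c • polyFun p := by
  ext x; simp [polyFun]

theorem lap_polyFun (p : MvPolynomial (Fin d) ℂ) : lap (polyFun p) = polyFun (lapP d p) := by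
  ext x
  simp only [lap, partialDeriv_polyFun, lapP_apply]
  simp [polyFun]

theorem lapP_mul (p q : MvPolynomial (Fin d) ℂ) : lapP d (p * q) = lapP d p * q +
    2 * ∑ i, MvPolynomial.pderiv i p * MvPolynomial.pderiv i q + p * lapP d q := by
  simp only [lapP_apply, Finset.sum_mul, Finset.mul_sum, ← Finset.sum_add_distrib]
  refine Finset.sum_congr rfl fun i _ => ?_
  simp only [Derivation.leibniz, smul_eq_mul, map_add]
  ring

/-- The polynomial `|x|²`. -/
def normSqP (d : ℕ) : MvPolynomial (Fin d) ℂ := ∑ i, MvPolynomial.X i ^ 2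

theorem isHomogeneous_normSqP (d : ℕ) : (normSqP d).IsHomogeneous 2 :=
  MvPolynomial.IsHomogeneous.sum _ _ _ fun i _ => by
    simpa using (MvPolynomial.isHomogeneous_X ℂ i).pow 2

theorem polyFun_normSqP (x : E d) : polyFun (normSqP d) x = ((‖x‖ ^ 2 : ℝ) : ℂ) := by
  rw [EuclideanSpace.real_norm_sq_eq]
  simp [polyFun, normSqP]

theorem polyFun_pow (p : MvPolynomial (Fin d) ℂ) (n : ℕ) (x : E d) :
    polyFun (p ^ n) x = polyFun p x ^ n := by simp [polyFun]

theorem pderiv_normSqP (i : Fin d) :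
    MvPolynomial.pderiv i (normSqP d) = 2 * MvPolynomial.X i := by
  simp only [normSqP, map_sum, Derivation.leibniz_pow, MvPolynomial.pderiv_X]
  rw [Finset.sum_eq_single i]
  · simp
  · intro j _ hj; simp [hj]
  · simp

theorem pderiv_normSqP_pow (i : Fin d) (n : ℕ) :
    MvPolynomial.pderiv i (normSqP d ^ (n + 1)) =
      2 * ((n : MvPolynomial (Fin d) ℂ) + 1) * normSqP d ^ n * MvPolynomial.X i := by
  rw [Derivation.leibniz_pow, pderiv_normSqP]
  simp
  ring

theorem sum_X_mul_pderiv_normSqP_pow (n : ℕ) :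
    ∑ i, MvPolynomial.X i * MvPolynomial.pderiv i (normSqP d ^ n) =
      2 * (n : MvPolynomial (Fin d) ℂ) * normSqP d ^ n := by
  have := ((isHomogeneous_normSqP d).pow n).sum_X_mul_pderiv
  rw [this]
  simp

theorem lapP_normSqP_pow (n : ℕ) : lapP d (normSqP d ^ (n + 1)) =
    2 * ((n : MvPolynomial (Fin d) ℂ) + 1) * (2 * n + d) * normSqP d ^ n := by
  have h : ∀ i : Fin d, MvPolynomial.pderiv i (MvPolynomial.pderiv i (normSqP d ^ (n + 1))) =
      2 * ((n : MvPolynomial (Fin d) ℂ) + 1) *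
        (normSqP d ^ n + MvPolynomial.X i * MvPolynomial.pderiv i (normSqP d ^ n)) := fun i => by
    rw [pderiv_normSqP_pow]
    have h2 : MvPolynomial.pderiv i (2 * ((n : MvPolynomial (Fin d) ℂ) + 1)) = 0 := by
      have : (2 * ((n : MvPolynomial (Fin d) ℂ) + 1)) = MvPolynomial.C (2 * ((n : ℂ) + 1)) := by
        simp [map_ofNat MvPolynomial.C 2]
      rw [this, MvPolynomial.pderiv_C]
    rw [mul_assoc, Derivation.leibniz, h2, Derivation.leibniz, MvPolynomial.pderiv_X_self]
    simp
  rw [lapP_apply, Finset.sum_congr rfl fun i _ => h i, ← Finset.mul_sum, Finset.sum_add_distrib,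
    sum_X_mul_pderiv_normSqP_pow]
  simp
  ring

/-- `p` is a harmonic homogeneous polynomial of degree `ℓ`. -/
structure IsHarmonicPoly (ℓ : ℕ) (p : MvPolynomial (Fin d) ℂ) : Prop where
  homogeneous : p.IsHomogeneous ℓ
  harmonic : lapP d p = 0

/-- Leibniz rule. The term with the Laplacian of p vanishes, and Euler's identity evaluates the
mixed gradient term. -/
theorem IsHarmonicPoly.lapP_mul_normSqP_pow {ℓ : ℕ} {p : MvPolynomial (Fin d) ℂ}
    (hp : IsHarmonicPoly ℓ p) (n : ℕ) : lapP d (p * normSqP d ^ (n + 1)) =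
      ((2 * (n + 1) * (2 * n + 2 * ℓ + d) : ℝ) : ℂ) • (p * normSqP d ^ n) := by
  have h : ∑ i, MvPolynomial.pderiv i p * MvPolynomial.pderiv i (normSqP d ^ (n + 1)) =
      2 * ((n : MvPolynomial (Fin d) ℂ) + 1) * normSqP d ^ n * (ℓ * p) := by
    rw [← nsmul_eq_mul, ← hp.homogeneous.sum_X_mul_pderiv, Finset.mul_sum]
    exact Finset.sum_congr rfl fun i _ => by rw [pderiv_normSqP_pow]; ring
  rw [lapP_mul, hp.harmonic, h, lapP_normSqP_pow, MvPolynomial.smul_eq_C_mul]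
  simp [map_ofNat MvPolynomial.C 2]
  ring

/-! ### The coefficients of the Bessel function -/

/-- Taylor coefficients of `t ↦ 2^(ℓ+ν) φ_ℓ(√t) / t^(ℓ/2)`. -/
def besselCoef (d ℓ n : ℕ) : ℝ :=
  (-1) ^ n / (n.factorial * Real.Gamma ((ℓ : ℝ) + ((d : ℝ) - 2) / 2 + (n : ℝ) + 1) * 4 ^ n)

/-- The factor is the one in `IsHarmonicPoly.lapP_mul_normSqP_pow`, so this recursion is the
Helmholtz equation on the level of coefficients. It is Γ(a + 1) = aΓ(a) at a = ℓ + ν + n + 1, where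
2a = 2n + 2ℓ + d. -/
theorem besselCoef_succ (hd : 0 < d) (ℓ n : ℕ) :
    besselCoef d ℓ (n + 1) * (2 * (n + 1) * (2 * n + 2 * ℓ + d)) = -besselCoef d ℓ n := by
  have hd' : (0 : ℝ) < d := by exact_mod_cast hd
  have hl : (0 : ℝ) ≤ ℓ := by positivity
  have hn : (0 : ℝ) ≤ n := by positivity
  have ha : (0 : ℝ) < (ℓ : ℝ) + ((d : ℝ) - 2) / 2 + (n : ℝ) + 1 := by linarith
  have hG := Real.Gamma_add_one ha.ne'
  have hG0 := (Real.Gamma_pos_of_pos ha).ne'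
  unfold besselCoef
  push_cast
  rw [show (ℓ : ℝ) + ((d : ℝ) - 2) / 2 + ((n : ℝ) + 1) + 1 =
    (ℓ : ℝ) + ((d : ℝ) - 2) / 2 + (n : ℝ) + 1 + 1 by ring, hG, Nat.factorial_succ]
  have hf : (n.factorial : ℝ) ≠ 0 := by positivity
  have hn1 : (n : ℝ) + 1 ≠ 0 := by positivity
  push_cast
  generalize hg : Real.Gamma ((ℓ : ℝ) + ((d : ℝ) - 2) / 2 + (n : ℝ) + 1) = g at *
  have e : (2 * (n : ℝ) + 2 * ℓ + d) = 2 * ((ℓ : ℝ) + ((d : ℝ) - 2) / 2 + (n : ℝ) + 1) := by ring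
  rw [e]
  generalize (ℓ : ℝ) + ((d : ℝ) - 2) / 2 + (n : ℝ) + 1 = a at *
  have ha' := ha.ne'
  field_simp
  ring

theorem besselCoef_zero_pos (hd : 0 < d) (ℓ : ℕ) : 0 < besselCoef d ℓ 0 := by
  have hd' : (0 : ℝ) < d := by exact_mod_cast hd
  have hl : (0 : ℝ) ≤ ℓ := by positivity
  have := Real.Gamma_pos_of_pos (show (0 : ℝ) < (ℓ : ℝ) + ((d : ℝ) - 2) / 2 + ((0 : ℕ) : ℝ) + 1 by
    push_cast; linarith)
  unfold besselCoef
  simp only [pow_zero, Nat.factorial_zero, Nat.cast_one, one_mul, mul_one]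
  positivity

/-- The factor in the recursion is at least n + 1, so all convergence questions reduce to the
exponential series without estimates of Γ. -/
theorem abs_besselCoef_le (hd : 0 < d) (ℓ n : ℕ) :
    |besselCoef d ℓ n| ≤ besselCoef d ℓ 0 / n.factorial := by
  induction n with
  | zero => simp [abs_of_pos (besselCoef_zero_pos hd ℓ)]
  | succ n ih =>
    have h := congrArg abs (besselCoef_succ hd ℓ n)
    have hd' : (1 : ℝ) ≤ d := by exact_mod_cast hd
    have hl : (0 : ℝ) ≤ ℓ := by positivity
    have hn : (0 : ℝ) ≤ n := by positivity
    rw [abs_neg, abs_mul, abs_of_nonneg (show (0 : ℝ) ≤ 2 * (n + 1) * (2 * n + 2 * ℓ + d) by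
      positivity)] at h
    have h2 : |besselCoef d ℓ (n + 1)| * (n + 1) ≤ |besselCoef d ℓ n| := by
      rw [← h]
      refine mul_le_mul_of_nonneg_left ?_ (abs_nonneg _)
      nlinarith
    rw [Nat.factorial_succ, mul_comm, Nat.cast_mul, ← div_div, le_div_iff₀ (by positivity)]
    push_cast
    exact h2.trans ih

theorem norm_besselCoef_mul_pow_le (hd : 0 < d) (ℓ n : ℕ) (t : ℂ) :
    ‖(besselCoef d ℓ n : ℂ) * t ^ n‖ ≤ besselCoef d ℓ 0 * (‖t‖ ^ n / n.factorial) := by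
  rw [norm_mul, norm_pow, Complex.norm_real, Real.norm_eq_abs]
  calc _ ≤ besselCoef d ℓ 0 / n.factorial * ‖t‖ ^ n :=
        mul_le_mul_of_nonneg_right (abs_besselCoef_le hd ℓ n) (by positivity)
    _ = _ := by ring

/-- The entire function `t ↦ 2^(ℓ+ν) φ_ℓ(√t) / t^(ℓ/2)`. -/
def besselSeries (d ℓ : ℕ) (t : ℂ) : ℂ := ∑' n : ℕ, (besselCoef d ℓ n : ℂ) * t ^ n

theorem summable_besselBound (d ℓ : ℕ) (r : ℝ) :
    Summable fun n : ℕ => besselCoef d ℓ 0 * (r ^ n / n.factorial) :=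
  (Real.summable_pow_div_factorial r).mul_left _

theorem hasSum_besselSeries (hd : 0 < d) (ℓ : ℕ) (t : ℂ) :
    HasSum (fun n : ℕ => (besselCoef d ℓ n : ℂ) * t ^ n) (besselSeries d ℓ t) :=
  (Summable.of_norm_bounded (summable_besselBound d ℓ ‖t‖)
    fun n => norm_besselCoef_mul_pow_le hd ℓ n t).hasSum

theorem norm_sum_besselCoef_le (hd : 0 < d) (ℓ N : ℕ) {t : ℂ} {r : ℝ} (h : ‖t‖ ≤ r) :
    ‖∑ n ∈ Finset.range N, (besselCoef d ℓ n : ℂ) * t ^ n‖ ≤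
      ∑' n : ℕ, besselCoef d ℓ 0 * (r ^ n / n.factorial) := by
  have h0 : 0 ≤ r := (norm_nonneg t).trans h
  have hc := besselCoef_zero_pos hd ℓ
  refine (norm_sum_le _ _).trans ((Finset.sum_le_sum fun n _ => ?_).trans
    ((summable_besselBound d ℓ r).sum_le_tsum _ fun n _ => by positivity))
  exact (norm_besselCoef_mul_pow_le hd ℓ n t).trans (by gcongr)

theorem continuous_besselSeries (hd : 0 < d) (ℓ : ℕ) : Continuous (besselSeries d ℓ) := by
  rw [continuous_iff_continuousAt]
  intro t
  have hc := besselCoef_zero_pos hd ℓ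
  have h : ContinuousOn (besselSeries d ℓ) (Metric.ball 0 (‖t‖ + 1)) :=
    continuousOn_tsum (fun n => by fun_prop) (summable_besselBound d ℓ (‖t‖ + 1)) fun n s hs => by
      refine (norm_besselCoef_mul_pow_le hd ℓ n s).trans ?_
      have : ‖s‖ ≤ ‖t‖ + 1 := (mem_ball_zero_iff.1 hs).le
      gcongr
  exact h.continuousAt (Metric.isOpen_ball.mem_nhds (by simp))

theorem besselSeries_zero (d ℓ : ℕ) : besselSeries d ℓ 0 = besselCoef d ℓ 0 := by
  rw [besselSeries, tsum_eq_single 0 fun n hn => by simp [hn]]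
  simp

theorem conj_besselSeries (d ℓ : ℕ) (t : ℂ) :
    conj (besselSeries d ℓ t) = besselSeries d ℓ (conj t) := by
  simp [besselSeries, Complex.conj_tsum]

theorem phi_eq (d ℓ : ℕ) (z : ℂ) : phi d ℓ z =
    z ^ ℓ / (((2 : ℝ) ^ ((ℓ : ℝ) + ((d : ℝ) - 2) / 2) : ℝ) : ℂ) * besselSeries d ℓ (z ^ 2) := by
  unfold phi besselSeries
  congr 2
  ext n
  unfold besselCoef
  push_cast
  rw [div_pow, pow_mul 2 2 n, show (2 : ℂ) ^ 2 = 4 by norm_num, pow_mul]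
  field_simp

theorem csqrt_sq (κ : ℂ) : csqrt κ ^ 2 = κ := by
  rw [csqrt, ← Complex.cpow_nat_mul]
  simp

/-! ### Separated solutions of the Helmholtz equation -/

/-- Partial sums of `helmholtzSol`, as polynomials. -/
def helmholtzPoly (ℓ : ℕ) (κ : ℂ) (p : MvPolynomial (Fin d) ℂ) (N : ℕ) : MvPolynomial (Fin d) ℂ :=
  ∑ n ∈ Finset.range N, ((besselCoef d ℓ n : ℂ) * κ ^ n) • (p * normSqP d ^ n)

/-- The solution `|x|^(-ν-ℓ) J_(ℓ+ν)(√κ |x|) p(x)` of `-Δu = κ u`, up to a constant factor. -/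
def helmholtzSol (ℓ : ℕ) (κ : ℂ) (p : MvPolynomial (Fin d) ℂ) (x : E d) : ℂ :=
  polyFun p x * besselSeries d ℓ (κ * ((‖x‖ ^ 2 : ℝ) : ℂ))

theorem continuous_polyFun (p : MvPolynomial (Fin d) ℂ) : Continuous (polyFun p) :=
  (contDiff_polyFun p).continuous

theorem continuous_helmholtzSol (hd : 0 < d) (ℓ : ℕ) (κ : ℂ) (p : MvPolynomial (Fin d) ℂ) :
    Continuous (helmholtzSol ℓ κ p) :=
  (continuous_polyFun p).mul ((continuous_besselSeries hd ℓ).comp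
    (continuous_const.mul (Complex.continuous_ofReal.comp (continuous_norm.pow 2))))

/-- The term n = 0 is harmonic, and each later term is sent to -κ times its predecessor, so one term
is lost. -/
theorem lapP_helmholtzPoly (hd : 0 < d) {ℓ : ℕ} (κ : ℂ) {p : MvPolynomial (Fin d) ℂ}
    (hp : IsHarmonicPoly ℓ p) (N : ℕ) :
    lapP d (helmholtzPoly ℓ κ p (N + 1)) = -κ • helmholtzPoly ℓ κ p N := by
  unfold helmholtzPoly
  rw [Finset.sum_range_succ', map_add, map_smul, pow_zero (normSqP d), mul_one, hp.harmonic, smul_zero,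
    add_zero, map_sum, Finset.smul_sum]
  refine Finset.sum_congr rfl fun n _ => ?_
  rw [map_smul, hp.lapP_mul_normSqP_pow, smul_smul, smul_smul]
  congr 1
  have h := congrArg (fun r : ℝ => (r : ℂ)) (besselCoef_succ hd ℓ n)
  simp only [Complex.ofReal_mul, Complex.ofReal_neg] at h ⊢
  rw [pow_succ]
  linear_combination κ ^ n * κ * h

theorem polyFun_helmholtzPoly (ℓ : ℕ) (κ : ℂ) (p : MvPolynomial (Fin d) ℂ) (N : ℕ) (x : E d) :
    polyFun (helmholtzPoly ℓ κ p N) x = polyFun p x *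
      ∑ n ∈ Finset.range N, (besselCoef d ℓ n : ℂ) * (κ * ((‖x‖ ^ 2 : ℝ) : ℂ)) ^ n := by
  rw [← polyFun_normSqP, Finset.mul_sum]
  simp only [polyFun, helmholtzPoly, map_sum, MvPolynomial.smul_eval, map_mul, map_pow]
  exact Finset.sum_congr rfl fun n _ => by ring

theorem tendsto_polyFun_helmholtzPoly (hd : 0 < d) (ℓ : ℕ) (κ : ℂ) (p : MvPolynomial (Fin d) ℂ)
    (x : E d) : Tendsto (fun N => polyFun (helmholtzPoly ℓ κ p N) x) atTop
      (𝓝 (helmholtzSol ℓ κ p x)) := by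
  simp_rw [polyFun_helmholtzPoly]
  exact ((hasSum_besselSeries hd ℓ _).tendsto_sum_nat).const_mul _

theorem tendsto_toL2_helmholtzPoly (hd : 0 < d) (ℓ : ℕ) (κ : ℂ) (p : MvPolynomial (Fin d) ℂ) :
    Tendsto (fun N => toL2 (ballMeasure d) (polyFun (helmholtzPoly ℓ κ p N))) atTop
      (𝓝 (toL2 (ballMeasure d) (helmholtzSol ℓ κ p))) := by
  obtain ⟨C, hC0, hC⟩ := exists_bound_on_ball (continuous_polyFun p)
  refine (tendsto_toL2_of_dominated
    (C * ∑' n : ℕ, besselCoef d ℓ 0 * (‖κ‖ ^ n / n.factorial))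
    (fun n => (continuous_polyFun _).aestronglyMeasurable) (fun n => ?_)
    (Eventually.of_forall fun x => tendsto_polyFun_helmholtzPoly hd ℓ κ p x)).2
  filter_upwards [ae_restrict_mem measurableSet_ball] with x hx
  rw [polyFun_helmholtzPoly, norm_mul]
  refine mul_le_mul (hC x hx) (norm_sum_besselCoef_le hd ℓ n ?_) (norm_nonneg _) hC0
  rw [norm_mul, Complex.norm_real, Real.norm_of_nonneg (by positivity)]
  have : ‖x‖ ^ 2 ≤ 1 := pow_le_one₀ (norm_nonneg x) (mem_ball_zero_iff.1 hx).le
  nlinarith [norm_nonneg κ]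

theorem norm_coe_sphere (y : Sphere d) : ‖(y : E d)‖ = 1 := by simp

theorem rest_helmholtzPoly (ℓ : ℕ) (κ : ℂ) (p : MvPolynomial (Fin d) ℂ) (N : ℕ) :
    rest (polyFun (helmholtzPoly ℓ κ p N)) =
      (∑ n ∈ Finset.range N, (besselCoef d ℓ n : ℂ) * κ ^ n) • rest (polyFun p) := by
  rw [← rest_smul _ (continuous_polyFun p)]
  refine toL2_congr (memLp_sphere (continuous_polyFun _)) (Eventually.of_forall fun y => ?_)
  simp only [polyFun_helmholtzPoly, norm_coe_sphere, Pi.smul_apply, smul_eq_mul]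
  simp [mul_comm]

/-- The partial sums are polynomials, so the representation `toL2_sub_solOp` applies to them. Here
(1 - Δ) of the sum with N + 1 terms is that sum plus κ times the sum with N terms. On the sphere the
sum is p times a partial sum of the series at κ. Only L² limits are then taken, and the series is
never differentiated. -/
theorem helmholtzOp_helmholtzSol (hd : 0 < d) {ℓ : ℕ} (κ : ℂ) {p : MvPolynomial (Fin d) ℂ}
    (hp : IsHarmonicPoly ℓ p) :
    helmholtzOp κ 0 (toL2 (ballMeasure d) (helmholtzSol ℓ κ p)) =
      besselSeries d ℓ κ • poisson d (rest (polyFun p)) := by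
  have hU := tendsto_toL2_helmholtzPoly hd ℓ κ p
  have hU' := (tendsto_add_atTop_iff_nat 1).2 hU
  have l1 := hU'.sub (((solOp d).continuous.tendsto _).comp (hU'.add (hU.const_smul κ)))
  have l2 := ((tendsto_add_atTop_iff_nat 1).2 (hasSum_besselSeries hd ℓ κ).tendsto_sum_nat).smul_const
    (poisson d (rest (polyFun p)))
  have h : helmholtzOp κ 0 (toL2 (ballMeasure d) (helmholtzSol ℓ κ p)) =
      toL2 (ballMeasure d) (helmholtzSol ℓ κ p) - solOp d (toL2 (ballMeasure d) (helmholtzSol ℓ κ p) +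
        κ • toL2 (ballMeasure d) (helmholtzSol ℓ κ p)) := by
    rw [helmholtzOp_zero, add_comm κ 1, add_smul, one_smul, map_add, map_smul]
    rfl
  rw [h]
  refine tendsto_nhds_unique l1 (l2.congr fun N => ?_)
  rw [← map_smul, ← rest_helmholtzPoly, ← toL2_sub_solOp hd (contDiff_polyFun _), lap_polyFun,
    lapP_helmholtzPoly hd κ hp, Function.comp_apply,
    ← toL2_smul κ (memLp_of_contDiff (contDiff_polyFun _)), ← toL2_add
      (memLp_of_contDiff (contDiff_polyFun _)) ((memLp_of_contDiff (contDiff_polyFun _)).const_smul κ)]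
  congr 3
  ext x
  rw [neg_smul, ← neg_smul, polyFun_smul]
  simp

/-- The linear form L = x_a + i x_b is harmonic and isotropic: ∇L·∇L = 1 + i² = 0. Hence all its
powers are harmonic. -/
theorem isHarmonicPoly_pow {a b : Fin d} (hab : a ≠ b) (ℓ : ℕ) :
    IsHarmonicPoly ℓ ((MvPolynomial.X a + MvPolynomial.C Complex.I * MvPolynomial.X b) ^ ℓ :
      MvPolynomial (Fin d) ℂ) := by
  set L : MvPolynomial (Fin d) ℂ := MvPolynomial.X a + MvPolynomial.C Complex.I * MvPolynomial.X b
    with hL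
  have hL1 : L.IsHomogeneous 1 := (MvPolynomial.isHomogeneous_X ℂ a).add
    (by simpa using (MvPolynomial.isHomogeneous_C (Fin d) Complex.I).mul (MvPolynomial.isHomogeneous_X ℂ b))
  have hg : ∀ i, MvPolynomial.pderiv i L =
      MvPolynomial.C ((if a = i then 1 else 0) + Complex.I * (if b = i then 1 else 0)) := fun i => by
    rw [hL, map_add, MvPolynomial.pderiv_C_mul, MvPolynomial.pderiv_X, MvPolynomial.pderiv_X]
    simp only [Pi.single_apply]
    split_ifs <;> simp
  have hL2 : lapP d L = 0 := by
    rw [lapP_apply]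
    exact Finset.sum_eq_zero fun i _ => by rw [hg, MvPolynomial.pderiv_C]
  have hs : ∑ i, MvPolynomial.pderiv i L * MvPolynomial.pderiv i L = 0 := by
    simp only [hg, ← map_mul, ← map_sum]
    have : ∀ i : Fin d, (((if a = i then 1 else 0) + Complex.I * (if b = i then 1 else 0)) *
        ((if a = i then 1 else 0) + Complex.I * (if b = i then 1 else 0)) : ℂ) =
        (if a = i then 1 else 0) - if b = i then 1 else 0 := fun i => by
      split_ifs with h1 h2
      · exact absurd (h1.trans h2.symm) hab
      · simp
      · simp
      · simp
    rw [Finset.sum_congr rfl fun i _ => this i]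
    simp
  refine ⟨by simpa using hL1.pow ℓ, ?_⟩
  induction ℓ with
  | zero => rw [pow_zero, lapP_apply]; simp
  | succ n ih =>
    have : ∑ i, MvPolynomial.pderiv i (L ^ n) * MvPolynomial.pderiv i L = 0 := by
      simp only [Derivation.leibniz_pow, smul_eq_mul, nsmul_eq_mul, mul_assoc, ← Finset.mul_sum, hs,
        mul_zero]
    rw [pow_succ, lapP_mul, ih, this, hL2]
    simp

/-- If the series vanished at κ, the separated solution built on (x_a + i x_b)^ℓ would lie in the
kernel of an invertible operator, hence vanish on the ball by continuity. On the positive x_a-axis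
the polynomial is t^ℓ ≠ 0, so the series would vanish at κt² for 0 < t < 1. Letting t tend to 0
contradicts the positive constant coefficient. -/
theorem besselSeries_ne_zero (hd : 2 ≤ d) (ℓ : ℕ) {κ : ℂ}
    (h0 : IsUnit (helmholtzOp κ (0 : Potential d))) : besselSeries d ℓ κ ≠ 0 := by
  intro hz
  have hd0 : 0 < d := by omega
  let a : Fin d := ⟨0, hd0⟩
  let b : Fin d := ⟨1, hd⟩
  have hab : a ≠ b := by simp [a, b]
  set p : MvPolynomial (Fin d) ℂ :=
    (MvPolynomial.X a + MvPolynomial.C Complex.I * MvPolynomial.X b) ^ ℓ with hp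
  have h1 := helmholtzOp_helmholtzSol hd0 κ (isHarmonicPoly_pow hab ℓ)
  rw [hz, zero_smul] at h1
  have h2 : toL2 (ballMeasure d) (helmholtzSol ℓ κ p) = 0 := by
    rw [← resolvOp_helmholtzOp h0 (toL2 _ _), h1, map_zero]
  have hc := continuous_helmholtzSol hd0 ℓ κ p
  have h3 : helmholtzSol ℓ κ p =ᵐ[ballMeasure d] fun _ => 0 := by
    have := coeFn_toL2 (memLp_ball hc 2)
    rw [h2] at this
    exact this.symm.trans (Lp.coeFn_zero _ _ _)
  have h4 := Measure.eqOn_open_of_ae_eq h3 Metric.isOpen_ball hc.continuousOn continuousOn_const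
  have h5 : ∀ t ∈ Set.Ioo (0 : ℝ) 1, besselSeries d ℓ (κ * ((t ^ 2 : ℝ) : ℂ)) = 0 := fun t ht => by
    have hn : ‖(EuclideanSpace.single a t : E d)‖ = t := by
      simp [abs_of_pos ht.1]
    have := h4 (show (EuclideanSpace.single a t : E d) ∈ Metric.ball 0 1 by
      rw [mem_ball_zero_iff, hn]; exact ht.2)
    rw [helmholtzSol, hn] at this
    refine (mul_eq_zero.1 this).resolve_left ?_
    rw [hp, polyFun_pow]
    refine pow_ne_zero _ ?_
    simp [polyFun, hab.symm, ht.1.ne']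
  have h6 : Tendsto (fun t : ℝ => besselSeries d ℓ (κ * ((t ^ 2 : ℝ) : ℂ))) (𝓝[>] 0)
      (𝓝 (besselSeries d ℓ (κ * (((0 : ℝ) ^ 2 : ℝ) : ℂ)))) :=
    (((continuous_besselSeries hd0 ℓ).comp (continuous_const.mul (Complex.continuous_ofReal.comp
      (continuous_id.pow 2)))).tendsto 0).mono_left nhdsWithin_le_nhds
  have h7 := tendsto_nhds_unique h6 (tendsto_const_nhds.congr' (by
    filter_upwards [Ioo_mem_nhdsGT (show (0 : ℝ) < 1 by norm_num)] with t ht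
    exact (h5 t ht).symm))
  rw [zero_pow two_ne_zero, Complex.ofReal_zero, mul_zero, besselSeries_zero, Complex.ofReal_eq_zero] at h7
  exact (besselCoef_zero_pos hd0 ℓ).ne' h7

theorem phi_ne_zero (hd : 2 ≤ d) (ℓ : ℕ) {κ : ℂ} (hκ : κ ≠ 0)
    (h0 : IsUnit (helmholtzOp κ (0 : Potential d))) : phi d ℓ (csqrt κ) ≠ 0 := by
  rw [phi_eq, csqrt_sq]
  refine mul_ne_zero (div_ne_zero (pow_ne_zero _ ?_) ?_) (besselSeries_ne_zero hd ℓ h0)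
  · intro h
    exact hκ (by rw [← csqrt_sq κ, h]; simp)
  · exact Complex.ofReal_ne_zero.2 (by positivity)

/-! ### Matrix elements of the differential -/

theorem inner_helmholtzOp_conj (κ : ℂ) (f g : L2Ball d) :
    inner ℂ (helmholtzOp (conj κ) 0 f) g = inner ℂ f (helmholtzOp κ 0 g) := by
  rw [helmholtzOp_zero, helmholtzOp_zero]
  change inner ℂ (f - (conj κ + 1) • solOp d f) g = inner ℂ f (g - (κ + 1) • solOp d g)
  rw [inner_sub_left, inner_sub_right, inner_smul_left, inner_smul_right, inner_solOp_left]
  simp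

/-- On the right, R₀ P turns p into its separated solution. On the left, R₀ is moved across the
inner product, which produces the separated solution of h for the conjugate of κ. The conjugation in
the inner product restores κ in the series, whose coefficients are real, and stays only on the
polynomial h. -/
theorem inner_dPhi (hd : 0 < d) {κ : ℂ} (h0 : IsUnit (helmholtzOp κ (0 : Potential d)))
    (q : Potential d) {m ℓ : ℕ} {h p : MvPolynomial (Fin d) ℂ} (hh : IsHarmonicPoly m h)
    (hp : IsHarmonicPoly ℓ p) :
    besselSeries d m κ * besselSeries d ℓ κ *
        inner ℂ (rest (polyFun h)) (dPhi κ q (rest (polyFun p))) =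
      ∫ x in ball d, (q x : ℂ) * besselSeries d m (κ * ((‖x‖ ^ 2 : ℝ) : ℂ)) *
        besselSeries d ℓ (κ * ((‖x‖ ^ 2 : ℝ) : ℂ)) * (conj (polyFun h x) * polyFun p x) := by
  have e1 : besselSeries d ℓ κ • resolvOp κ 0 (poisson d (rest (polyFun p))) =
      toL2 (ballMeasure d) (helmholtzSol ℓ κ p) := by
    rw [← map_smul, ← helmholtzOp_helmholtzSol hd κ hp, resolvOp_helmholtzOp h0]
  -- Moving `helmholtzOp` across the inner product replaces κ by its conjugate. Since R₀ is a right
  -- inverse at κ, invertibility at the conjugate of κ is not used.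
  have e2 : ∀ V : L2Ball d, besselSeries d m κ * inner ℂ (poisson d (rest (polyFun h)))
      (resolvOp κ 0 V) = inner ℂ (toL2 (ballMeasure d) (helmholtzSol m (conj κ) h)) V := fun V => by
    have : besselSeries d m κ = conj (besselSeries d m (conj κ)) := by
      rw [conj_besselSeries, Complex.conj_conj]
    rw [this, ← inner_smul_left, ← helmholtzOp_helmholtzSol hd (conj κ) hh, inner_helmholtzOp_conj,
      helmholtzOp_resolvOp h0]
  rw [dPhi, inner_adjoint_comp_comp]
  change _ * inner ℂ _ (resolvOp κ 0 (mulOp d q (resolvOp κ 0 (poisson d (rest (polyFun p)))))) = _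
  rw [mul_right_comm, e2, mul_comm, ← inner_smul_right, ← map_smul, e1,
    inner_eq_integral_of_ae (coeFn_toL2 (memLp_ball (continuous_helmholtzSol hd _ _ _) 2))
      (coeFn_mulOp _ _)]
  refine integral_congr_ae ?_
  filter_upwards [coeFn_toL2 (memLp_ball (continuous_helmholtzSol hd ℓ κ p) 2)] with x hx
  rw [hx, helmholtzSol, helmholtzSol, map_mul, conj_besselSeries, map_mul, Complex.conj_conj,
    Complex.conj_ofReal]
  ring

/-! ### Spherical harmonics -/

theorem polyFun_smul_point {n : ℕ} {p : MvPolynomial (Fin d) ℂ} (hp : p.IsHomogeneous n) (r : ℝ)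
    (x : E d) : polyFun p (r • x) = (r : ℂ) ^ n * polyFun p x := by
  simp only [polyFun, MvPolynomial.eval_eq', Finset.mul_sum]
  refine Finset.sum_congr rfl fun s hs => ?_
  have h : ∑ i, s i = n := by
    have := hp (MvPolynomial.mem_support_iff.1 hs)
    simpa [Finsupp.weight_apply, Finsupp.sum_fintype] using this
  rw [← h, ← Finset.prod_pow_eq_pow_sum]
  simp only [PiLp.smul_apply, smul_eq_mul, Complex.ofReal_mul, mul_pow, Finset.prod_mul_distrib]
  ring

/-- Integrals over the ball of products of a radial and a homogeneous function. -/
theorem integral_ball_radial_mul (hd : 0 < d) {f b : E d → ℂ} {ρ : ℝ → ℂ} {n : ℕ}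
    (hf : Integrable f (ballMeasure d)) (hb : ∀ (r : ℝ) (x : E d), b (r • x) = (r : ℂ) ^ n * b x)
    (h : ∀ᵐ x ∂ballMeasure d, f x = ρ ‖x‖ * b x) :
    ∫ x in ball d, f x = (∫ r in Set.Ioo (0 : ℝ) 1, ((r ^ (d - 1) : ℝ) : ℂ) * (ρ r * (r : ℂ) ^ n)) *
      ∫ y, b y ∂sphereMeasure d := by
  rw [integral_ball_eq_polar hd hf, ← integral_const_mul]
  refine integral_congr_ae ?_
  filter_upwards [ae_polar hd h] with y hy
  rw [← integral_mul_const]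
  refine integral_congr_ae ?_
  filter_upwards [hy, ae_restrict_mem measurableSet_Ioo] with r hr hr0
  rw [hr, hb, norm_smul, norm_coe_sphere, mul_one, Real.norm_of_nonneg hr0.1.le]
  ring

/-- Green's formula for (1 - |x|²)h, in H¹₀, against the harmonic p. The derivative of 1 - |x|²
produces x·∇p, which is ℓp by Euler's identity. -/
theorem integral_conj_mul_defFun {ℓ : ℕ} {h p : MvPolynomial (Fin d) ℂ} (hp : IsHarmonicPoly ℓ p) :
    ∫ x in ball d, defFun x * ∑ i, conj (partialDeriv i (polyFun h) x) * partialDeriv i (polyFun p) x =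
      2 * ℓ * ∫ x in ball d, conj (polyFun h x) * polyFun p x := by
  have hH : ContDiff ℝ ∞ fun x : E d => defFun x * polyFun h x := contDiff_defFun.mul (contDiff_polyFun h)
  have hP := contDiff_polyFun p
  have h1 := inner_jet_of_mem_H10 (jet_defFun_mul_mem_H10 (contDiff_polyFun h)) hP
  have h2 : (fun x => polyFun p x - lap (polyFun p) x) = polyFun p := by
    rw [lap_polyFun, hp.harmonic, polyFun_zero]; simp
  rw [h2, inner_jetSpace] at h1
  simp only [jet_none, jet_some, add_eq_left] at h1
  have e : ∀ i, inner ℂ (toL2 (ballMeasure d) (partialDeriv i fun x => defFun x * polyFun h x))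
      (toL2 (ballMeasure d) (partialDeriv i (polyFun p))) =
      ∫ x in ball d, conj (partialDeriv i (fun x => defFun x * polyFun h x) x) *
        partialDeriv i (polyFun p) x := fun i =>
    inner_toL2 (memLp_partialDeriv hH i) (memLp_partialDeriv hP i)
  have hci : ∀ i, Continuous fun x => conj (partialDeriv i (fun x => defFun x * polyFun h x) x) *
        partialDeriv i (polyFun p) x := fun i =>
    (Complex.continuous_conj.comp (contDiff_partialDeriv hH i).continuous).mul
      (contDiff_partialDeriv hP i).continuous
  rw [Finset.sum_congr rfl fun i _ => e i, ← integral_finsetSum _ fun i _ => integrable_ball (hci i)] at h1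
  have hE : ∀ x, ∑ i, (x i : ℂ) * partialDeriv i (polyFun p) x = ℓ * polyFun p x := fun x => by
    have := congrArg (MvPolynomial.eval fun i => (x i : ℂ)) hp.homogeneous.sum_X_mul_pderiv
    simp only [map_sum, map_mul, MvPolynomial.eval_X, nsmul_eq_mul, map_natCast] at this
    simp only [partialDeriv_polyFun]
    exact this
  have hx : ∀ x : E d, ∑ i, conj (partialDeriv i (fun x => defFun x * polyFun h x) x) *
      partialDeriv i (polyFun p) x =
      defFun x * ∑ i, conj (partialDeriv i (polyFun h) x) * partialDeriv i (polyFun p) x -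
        2 * ℓ * (conj (polyFun h x) * polyFun p x) := fun x => by
    have : (2 * ℓ * (conj (polyFun h x) * polyFun p x) : ℂ) =
        2 * conj (polyFun h x) * ∑ i, (x i : ℂ) * partialDeriv i (polyFun p) x := by rw [hE]; ring
    rw [this, Finset.mul_sum, Finset.mul_sum, ← Finset.sum_sub_distrib]
    refine Finset.sum_congr rfl fun i _ => ?_
    rw [partialDeriv_mul contDiff_defFun (contDiff_polyFun h), partialDeriv_defFun]
    simp only [map_add, map_mul, defFun, Complex.conj_ofReal, map_neg, map_ofNat]
    ring
  simp_rw [hx] at h1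
  have hc1 : Continuous fun x : E d =>
      defFun x * ∑ i, conj (partialDeriv i (polyFun h) x) * partialDeriv i (polyFun p) x :=
    contDiff_defFun.continuous.mul (continuous_finsetSum _ fun i _ =>
      (Complex.continuous_conj.comp (contDiff_partialDeriv (contDiff_polyFun h) i).continuous).mul
      (contDiff_partialDeriv hP i).continuous)
  have hc2 : Continuous fun x : E d => 2 * ℓ * (conj (polyFun h x) * polyFun p x) :=
    continuous_const.mul ((Complex.continuous_conj.comp (continuous_polyFun h)).mul (continuous_polyFun p))
  rw [integral_sub (integrable_ball hc1) (integrable_ball hc2), integral_const_mul, sub_eq_zero] at h1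
  exact h1

/-- The weighted gradient integral in `integral_conj_mul_defFun` is Hermitian in h and p, so it
equals both 2ℓ and 2m times the integral in question. -/
theorem integral_ball_conj_mul_eq_zero {m ℓ : ℕ} (hne : m ≠ ℓ) {h p : MvPolynomial (Fin d) ℂ}
    (hh : IsHarmonicPoly m h) (hp : IsHarmonicPoly ℓ p) :
    ∫ x in ball d, conj (polyFun h x) * polyFun p x = 0 := by
  have h1 := integral_conj_mul_defFun (h := h) hp
  have h2 := congrArg conj (integral_conj_mul_defFun (h := p) hh)
  rw [← integral_conj, map_mul, ← integral_conj] at h2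
  simp only [map_mul, map_sum, Complex.conj_conj, defFun, Complex.conj_ofReal, map_ofNat,
    Complex.conj_natCast, mul_comm (polyFun p _)] at h1 h2
  simp only [mul_comm (partialDeriv _ (polyFun p) _)] at h2
  have h3 := h1.symm.trans h2
  rw [← sub_eq_zero, ← sub_mul, mul_eq_zero] at h3
  refine h3.resolve_left fun h4 => hne ?_
  rw [← mul_sub, mul_eq_zero, sub_eq_zero] at h4
  exact_mod_cast (h4.resolve_left two_ne_zero).symm

theorem conj_mul_smul_point {m ℓ : ℕ} {h p : MvPolynomial (Fin d) ℂ} (hh : h.IsHomogeneous m)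
    (hp : p.IsHomogeneous ℓ) (r : ℝ) (x : E d) : conj (polyFun h (r • x)) * polyFun p (r • x) =
      (r : ℂ) ^ (m + ℓ) * (conj (polyFun h x) * polyFun p x) := by
  rw [polyFun_smul_point hh, polyFun_smul_point hp, map_mul, map_pow, Complex.conj_ofReal, pow_add]
  ring

/-- Spherical harmonics of different degrees are orthogonal. -/
theorem inner_rest_eq_zero (hd : 0 < d) {m ℓ : ℕ} (hne : m ≠ ℓ) {h p : MvPolynomial (Fin d) ℂ}
    (hh : IsHarmonicPoly m h) (hp : IsHarmonicPoly ℓ p) :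
    inner ℂ (rest (polyFun h)) (rest (polyFun p)) = 0 := by
  rw [inner_rest (continuous_polyFun h) (continuous_polyFun p)]
  have h1 := integral_ball_radial_mul hd (ρ := fun _ => 1)
    (f := fun x => conj (polyFun h x) * polyFun p x) (b := fun x => conj (polyFun h x) * polyFun p x) (n := m + ℓ) (integrable_ball
    ((Complex.continuous_conj.comp (continuous_polyFun h)).mul (continuous_polyFun p)))
    (conj_mul_smul_point hh.homogeneous hp.homogeneous) (Eventually.of_forall fun x => (one_mul _).symm)
  have h2 := integral_ball_conj_mul_eq_zero hne hh hp
  rw [h2, eq_comm, mul_eq_zero] at h1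
  refine h1.resolve_left fun h3 => ?_
  -- The radial factor between ball and sphere integrals is 1/(d + m + ℓ), which is not zero.
  have h4 : ∀ r : ℝ, ((r ^ (d - 1) : ℝ) : ℂ) * (1 * (r : ℂ) ^ (m + ℓ)) =
      ((r ^ (d - 1 + (m + ℓ)) : ℝ) : ℂ) := fun r => by push_cast; ring
  simp_rw [h4] at h3
  rw [integral_complex_ofReal, Complex.ofReal_eq_zero, ← integral_Ioc_eq_integral_Ioo,
    ← intervalIntegral.integral_of_le zero_le_one, integral_pow] at h3
  have : ((d - 1 + (m + ℓ) : ℕ) : ℝ) + 1 ≠ 0 := by positivity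
  rw [one_pow, zero_pow (Nat.succ_ne_zero _), sub_zero, one_div, inv_eq_zero] at h3
  exact this h3

/-- The polynomials of degree `k` spanned by products of harmonic polynomials and powers of
`|x|²`. -/
def harmonicSpan (d k : ℕ) : Submodule ℂ (MvPolynomial (Fin d) ℂ) :=
  Submodule.span ℂ {x | ∃ (ℓ j : ℕ) (H : MvPolynomial (Fin d) ℂ),
    IsHarmonicPoly ℓ H ∧ ℓ + 2 * j = k ∧ x = H * normSqP d ^ j}

theorem isHomogeneous_of_mem_harmonicSpan {k : ℕ} {p : MvPolynomial (Fin d) ℂ}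
    (hp : p ∈ harmonicSpan d k) : p.IsHomogeneous k := by
  have h : harmonicSpan d k ≤ MvPolynomial.homogeneousSubmodule (Fin d) ℂ k := by
    refine Submodule.span_le.2 ?_
    rintro _ ⟨ℓ, j, H, hH, rfl, rfl⟩
    exact hH.homogeneous.mul ((isHomogeneous_normSqP d).pow j)
  exact h hp

/-- On the spanning products with a fixed harmonic factor, the Laplacian lowers the power of |x|² by
one with a nonzero factor, so a preimage is explicit. -/
theorem exists_lapP_eq (hd : 0 < d) {k : ℕ} {f : MvPolynomial (Fin d) ℂ}
    (hf : f ∈ harmonicSpan d k) : ∃ t ∈ harmonicSpan d (k + 2), lapP d t = f := by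
  induction hf using Submodule.span_induction with
  | mem x hx =>
    obtain ⟨ℓ, j, H, hH, rfl, rfl⟩ := hx
    have hc : ((2 * (j + 1) * (2 * j + 2 * ℓ + d) : ℝ) : ℂ) ≠ 0 :=
      Complex.ofReal_ne_zero.2 (by positivity)
    refine ⟨((2 * (j + 1) * (2 * j + 2 * ℓ + d) : ℝ) : ℂ)⁻¹ • (H * normSqP d ^ (j + 1)),
      Submodule.smul_mem _ _ (Submodule.subset_span ⟨ℓ, j + 1, H, hH, by ring, rfl⟩), ?_⟩
    rw [map_smul, hH.lapP_mul_normSqP_pow, inv_smul_smul₀ hc]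
  | zero => exact ⟨0, Submodule.zero_mem _, map_zero _⟩
  | add x y _ _ hx hy =>
    obtain ⟨t, ht, rfl⟩ := hx
    obtain ⟨s, hs, rfl⟩ := hy
    exact ⟨t + s, Submodule.add_mem _ ht hs, map_add _ _ _⟩
  | smul c x _ hx =>
    obtain ⟨t, ht, rfl⟩ := hx
    exact ⟨c • t, Submodule.smul_mem _ c ht, map_smul _ _ _⟩

theorem IsHarmonicPoly.mem_harmonicSpan {k : ℕ} {p : MvPolynomial (Fin d) ℂ}
    (hp : IsHarmonicPoly k p) : p ∈ harmonicSpan d k :=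
  Submodule.subset_span ⟨k, 0, p, hp, by ring, by simp⟩

theorem lapP_eq_zero_of_lt_two {n : ℕ} (hn : n < 2) {p : MvPolynomial (Fin d) ℂ}
    (hp : p.IsHomogeneous n) : lapP d p = 0 := by
  rw [lapP_apply]
  refine Finset.sum_eq_zero fun i _ => ?_
  have h : (MvPolynomial.pderiv i p).IsHomogeneous 0 := by
    have := hp.pderiv (i := i)
    rwa [show n - 1 = 0 by omega] at this
  rw [MvPolynomial.totalDegree_eq_zero_iff_eq_C.1 (Nat.le_zero.1 h.totalDegree_le),
    MvPolynomial.pderiv_C]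

/-- Induction in steps of two: the Laplacian of p lies in the span of degree n, hence has a preimage
t in the span of degree n + 2, and p - t is harmonic. -/
theorem mem_harmonicSpan (hd : 0 < d) (n : ℕ) : ∀ p : MvPolynomial (Fin d) ℂ,
    p.IsHomogeneous n → p ∈ harmonicSpan d n := by
  induction n using Nat.twoStepInduction with
  | zero => exact fun p hp => IsHarmonicPoly.mem_harmonicSpan ⟨hp, lapP_eq_zero_of_lt_two (by norm_num) hp⟩
  | one => exact fun p hp => IsHarmonicPoly.mem_harmonicSpan ⟨hp, lapP_eq_zero_of_lt_two (by norm_num) hp⟩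
  | more n ih _ =>
    intro p hp
    have h1 : (lapP d p).IsHomogeneous n := by
      rw [lapP_apply]
      exact MvPolynomial.IsHomogeneous.sum _ _ _ fun i _ => hp.pderiv.pderiv
    obtain ⟨t, ht, htp⟩ := exists_lapP_eq hd (ih _ h1)
    have h2 : IsHarmonicPoly (n + 2) (p - t) :=
      ⟨hp.sub (isHomogeneous_of_mem_harmonicSpan ht), by rw [map_sub, htp, sub_self]⟩
    rw [← sub_add_cancel p t]
    exact Submodule.add_mem _ h2.mem_harmonicSpan ht

/-- Restrictions to the sphere of harmonic homogeneous polynomials. -/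
def sphericalHarmonics (d : ℕ) : Set (L2Sphere d) :=
  {f | ∃ (ℓ : ℕ) (H : MvPolynomial (Fin d) ℂ), IsHarmonicPoly ℓ H ∧ f = rest (polyFun H)}

/-- Restriction of polynomials to the sphere, as a linear map into `L²`. -/
def restPoly (d : ℕ) : MvPolynomial (Fin d) ℂ →ₗ[ℂ] L2Sphere d where
  toFun p := rest (polyFun p)
  map_add' p q := by rw [polyFun_add, rest_add (continuous_polyFun p) (continuous_polyFun q)]
  map_smul' c p := by rw [polyFun_smul, rest_smul c (continuous_polyFun p), RingHom.id_apply]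

/-- Spherical harmonics span a dense subspace of `L²(𝕊^{d-1})`. -/
theorem dense_span_sphericalHarmonics (hd : 0 < d) :
    Dense (Submodule.span ℂ (sphericalHarmonics d) : Set (L2Sphere d)) := by
  refine (denseRange_rest_polyFun d).mono ?_
  have hk : ∀ k, harmonicSpan d k ≤ (Submodule.span ℂ (sphericalHarmonics d)).comap (restPoly d) := by
    intro k
    refine Submodule.span_le.2 ?_
    rintro _ ⟨ℓ, j, H, hH, rfl, rfl⟩
    refine Submodule.subset_span ⟨ℓ, H, hH, ?_⟩
    refine toL2_congr (memLp_sphere (continuous_polyFun _)) (Eventually.of_forall fun y => ?_)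
    simp only [polyFun_mul, polyFun_pow, polyFun_normSqP, norm_coe_sphere]
    simp
  rintro _ ⟨p, rfl⟩
  change restPoly d p ∈ Submodule.span ℂ (sphericalHarmonics d)
  rw [← MvPolynomial.sum_homogeneousComponent p, map_sum]
  exact Submodule.sum_mem _ fun i _ =>
    hk i (mem_harmonicSpan hd i _ (MvPolynomial.homogeneousComponent_isHomogeneous i p))

theorem eq_of_inner_harmonic (hd : 0 < d) {f g : L2Sphere d}
    (h : ∀ (m : ℕ) (H : MvPolynomial (Fin d) ℂ), IsHarmonicPoly m H →
      inner ℂ (rest (polyFun H)) f = inner ℂ (rest (polyFun H)) g) : f = g := by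
  refine (dense_span_sphericalHarmonics hd).eq_of_inner_right ℂ fun v hv => ?_
  induction hv using Submodule.span_induction with
  | mem x hx => obtain ⟨m, H, hH, rfl⟩ := hx; exact h m H hH
  | zero => simp
  | add x y _ _ hx hy => rw [inner_add_left, inner_add_left, hx, hy]
  | smul c x _ hx => rw [inner_smul_left, inner_smul_left, hx]

/-! ### The differential on spherical harmonics -/

theorem integrable_potential_mul (q : Potential d) {F : E d → ℂ} (hF : Continuous F) :
    Integrable (fun x => (q x : ℂ) * F x) (ballMeasure d) :=
  (integrable_ball hF).mul_of_top_right (Lp.memLp q).ofReal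

/-- The integral of a radial potential against the radial parts of two separated solutions. -/
def radialIntegral (d m ℓ : ℕ) (q₀ : ℝ → ℝ) (κ : ℂ) : ℂ :=
  ∫ r in Set.Ioo (0 : ℝ) 1, ((r ^ (d - 1) : ℝ) : ℂ) * ((q₀ r : ℂ) *
    besselSeries d m (κ * ((r ^ 2 : ℝ) : ℂ)) * besselSeries d ℓ (κ * ((r ^ 2 : ℝ) : ℂ)) *
      (r : ℂ) ^ (m + ℓ))

theorem continuous_besselSeries_norm (hd : 0 < d) (ℓ : ℕ) (κ : ℂ) :
    Continuous fun x : E d => besselSeries d ℓ (κ * ((‖x‖ ^ 2 : ℝ) : ℂ)) :=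
  (continuous_besselSeries hd ℓ).comp
    (continuous_const.mul (Complex.continuous_ofReal.comp (continuous_norm.pow 2)))

theorem inner_dPhi_of_radial (hd : 0 < d) {κ : ℂ} (h0 : IsUnit (helmholtzOp κ (0 : Potential d)))
    {q : Potential d} {q₀ : ℝ → ℝ} (hq : ∀ᵐ x ∂ballMeasure d, q x = q₀ ‖x‖) {m ℓ : ℕ}
    {h p : MvPolynomial (Fin d) ℂ} (hh : IsHarmonicPoly m h) (hp : IsHarmonicPoly ℓ p) :
    besselSeries d m κ * besselSeries d ℓ κ *
        inner ℂ (rest (polyFun h)) (dPhi κ q (rest (polyFun p))) =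
      radialIntegral d m ℓ q₀ κ * inner ℂ (rest (polyFun h)) (rest (polyFun p)) := by
  rw [inner_dPhi hd h0 q hh hp, inner_rest (continuous_polyFun h) (continuous_polyFun p)]
  refine integral_ball_radial_mul hd (b := fun x => conj (polyFun h x) * polyFun p x) (n := m + ℓ)
    (ρ := fun r => (q₀ r : ℂ) *
    besselSeries d m (κ * ((r ^ 2 : ℝ) : ℂ)) * besselSeries d ℓ (κ * ((r ^ 2 : ℝ) : ℂ))) ?_
    (conj_mul_smul_point hh.homogeneous hp.homogeneous) ?_
  · have := integrable_potential_mul q (F := fun x => besselSeries d m (κ * ((‖x‖ ^ 2 : ℝ) : ℂ)) *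
      besselSeries d ℓ (κ * ((‖x‖ ^ 2 : ℝ) : ℂ)) * (conj (polyFun h x) * polyFun p x)) (((continuous_besselSeries_norm hd m κ).mul
      (continuous_besselSeries_norm hd ℓ κ)).mul
      ((Complex.continuous_conj.comp (continuous_polyFun h)).mul (continuous_polyFun p)))
    simpa only [mul_assoc] using this
  · filter_upwards [hq] with x hx
    rw [hx]

/-- Both sides are tested against all spherical harmonics. In equal degree this is the radial matrix
element. In different degrees the matrix element vanishes because the series values at κ can be
divided out. -/
theorem dPhi_harmonic (hd : 2 ≤ d) {κ : ℂ} (h0 : IsUnit (helmholtzOp κ (0 : Potential d)))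
    {q : Potential d} {q₀ : ℝ → ℝ} (hq : ∀ᵐ x ∂ballMeasure d, q x = q₀ ‖x‖) {ℓ : ℕ}
    {p : MvPolynomial (Fin d) ℂ} (hp : IsHarmonicPoly ℓ p) :
    besselSeries d ℓ κ ^ 2 • dPhi κ q (rest (polyFun p)) =
      radialIntegral d ℓ ℓ q₀ κ • rest (polyFun p) := by
  have hd0 : 0 < d := by omega
  refine eq_of_inner_harmonic hd0 fun m h hh => ?_
  have key := inner_dPhi_of_radial hd0 h0 hq hh hp
  rw [inner_smul_right, inner_smul_right]
  by_cases hm : m = ℓ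
  · subst hm
    rw [sq, key]
  · rw [inner_rest_eq_zero hd0 hm hh hp, mul_zero, mul_eq_zero] at key
    rw [inner_rest_eq_zero hd0 hm hh hp, key.resolve_left
      (mul_ne_zero (besselSeries_ne_zero hd m h0) (besselSeries_ne_zero hd ℓ h0)), mul_zero, mul_zero]

/-- Squaring leaves only κ^ℓ, so the choice of square root drops out. -/
theorem phi_sq_eq (ℓ : ℕ) (κ : ℂ) (r : ℝ) : phi d ℓ (csqrt κ * (r : ℂ)) ^ 2 =
    κ ^ ℓ / (((2 : ℝ) ^ ((ℓ : ℝ) + ((d : ℝ) - 2) / 2) : ℝ) : ℂ) ^ 2 *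
      (besselSeries d ℓ (κ * ((r ^ 2 : ℝ) : ℂ)) ^ 2 * (r : ℂ) ^ (ℓ + ℓ)) := by
  rw [phi_eq, mul_pow (csqrt κ) _ 2, csqrt_sq, mul_pow, div_pow, ← pow_mul, mul_comm ℓ 2, pow_mul,
    mul_pow (csqrt κ), csqrt_sq, mul_pow]
  push_cast
  ring

theorem sphereMeasure_real_univ_ne_zero (hd : 0 < d) : (sphereMeasure d).real Set.univ ≠ 0 := by
  have : Nonempty (Fin d) := ⟨⟨0, hd⟩⟩
  have h : sphereMeasure d ≠ 0 := Measure.toSphere_ne_zero _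
  exact (measureReal_ne_zero_iff (measure_ne_top _ _)).2 (Measure.measure_univ_ne_zero.2 h)

/-- The angular integral of 1 is the area of the sphere and cancels the normalisation of the moment.
-/
theorem kappaMoment_eq (hd : 0 < d) (κ : ℂ) {q : Potential d} {q₀ : ℝ → ℝ}
    (hq : ∀ᵐ x ∂ballMeasure d, q x = q₀ ‖x‖) (ℓ : ℕ) : kappaMoment ℓ q κ =
      κ ^ ℓ / (((2 : ℝ) ^ ((ℓ : ℝ) + ((d : ℝ) - 2) / 2) : ℝ) : ℂ) ^ 2 * radialIntegral d ℓ ℓ q₀ κ := by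
  have h := integral_ball_radial_mul hd (n := 0) (b := fun _ => 1)
    (f := fun x => (q x : ℂ) * phi d ℓ (csqrt κ * (‖x‖ : ℂ)) ^ 2)
    (ρ := fun r => (q₀ r : ℂ) * phi d ℓ (csqrt κ * (r : ℂ)) ^ 2)
    (integrable_potential_mul q (by
      simp_rw [phi_sq_eq]
      exact continuous_const.mul (((continuous_besselSeries_norm hd ℓ κ).pow 2).mul
        ((Complex.continuous_ofReal.comp continuous_norm).pow _)))) (by simp)
    (by filter_upwards [hq] with x hx; rw [hx, mul_one])
  have hS := Complex.ofReal_ne_zero.2 (sphereMeasure_real_univ_ne_zero hd)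
  rw [kappaMoment, h, integral_const, Complex.real_smul, mul_one, mul_comm, mul_assoc,
    mul_inv_cancel₀ hS, mul_one, radialIntegral, ← integral_const_mul]
  congr 1
  ext r
  rw [phi_sq_eq]
  ring

theorem phi_sq_smul_dPhi (hd : 2 ≤ d) {κ : ℂ} (h0 : IsUnit (helmholtzOp κ (0 : Potential d)))
    {q : Potential d} (hq : IsRadial q) {ℓ : ℕ} {Y : L2Sphere d} (hY : IsSphericalHarmonic ℓ Y) :
    phi d ℓ (csqrt κ) ^ 2 • dPhi κ q Y = kappaMoment ℓ q κ • Y := by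
  obtain ⟨q₀, hq⟩ := hq
  obtain ⟨p, hp, hl, hYp⟩ := hY
  obtain rfl : Y = rest (polyFun p) := eq_rest hYp
  have h1 := dPhi_harmonic hd h0 hq ⟨hp, (lapP_apply p).trans hl⟩
  -- At r = 1 the square of φ_ℓ(√κ) carries the same prefactor κ^ℓ/2^(2(ℓ+ν)) as the moment. Nothing
  -- is divided by it, so κ = 0 is included.
  have h2 := phi_sq_eq (d := d) ℓ κ 1
  simp only [Complex.ofReal_one, one_pow, mul_one] at h2
  rw [h2, kappaMoment_eq (by omega) κ hq, mul_smul, mul_smul, h1]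

/-! ### Rotation invariance -/

/-- The matrix of a linear isometry. -/
def isometryCoef (R : E d ≃ₗᵢ[ℝ] E d) (i j : Fin d) : ℝ := R.symm (EuclideanSpace.single i 1) j

theorem isometry_apply_eq_sum (R : E d ≃ₗᵢ[ℝ] E d) (x : E d) (i : Fin d) :
    R x i = ∑ j, isometryCoef R i j * x j := by
  have h : inner ℝ (EuclideanSpace.single i (1 : ℝ)) (R x) =
      inner ℝ (R.symm (EuclideanSpace.single i (1 : ℝ))) x := by
    rw [← R.inner_map_map (R.symm _), R.apply_symm_apply]
  rw [EuclideanSpace.inner_single_left] at h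
  simpa [PiLp.inner_apply, mul_comm, isometryCoef] using h

theorem sum_isometryCoef_mul (R : E d ≃ₗᵢ[ℝ] E d) (i k : Fin d) :
    ∑ j, isometryCoef R i j * isometryCoef R k j = if i = k then 1 else 0 := by
  have h := R.symm.inner_map_map (EuclideanSpace.single i (1 : ℝ)) (EuclideanSpace.single k (1 : ℝ))
  rw [PiLp.inner_apply, EuclideanSpace.inner_single_left] at h
  simpa [PiLp.inner_apply, mul_comm, isometryCoef, Pi.single_apply] using h

/-- Composition of a polynomial with a linear isometry. -/
def rotPoly (R : E d ≃ₗᵢ[ℝ] E d) : MvPolynomial (Fin d) ℂ →ₐ[ℂ] MvPolynomial (Fin d) ℂ :=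
  MvPolynomial.aeval fun i => ∑ j, MvPolynomial.C (isometryCoef R i j : ℂ) * MvPolynomial.X j

theorem polyFun_rotPoly (R : E d ≃ₗᵢ[ℝ] E d) (p : MvPolynomial (Fin d) ℂ) (x : E d) :
    polyFun (rotPoly R p) x = polyFun p (R x) := by
  induction p using MvPolynomial.induction_on with
  | C a => simp [rotPoly, polyFun]
  | add p q hp hq => rw [map_add, polyFun_add, polyFun_add, Pi.add_apply, Pi.add_apply, hp, hq]
  | mul_X p i hp =>
    simp only [map_mul, polyFun_mul, hp]
    simp [rotPoly, polyFun, isometry_apply_eq_sum R x i]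

theorem pderiv_rotPoly (R : E d ≃ₗᵢ[ℝ] E d) (p : MvPolynomial (Fin d) ℂ) (j : Fin d) :
    MvPolynomial.pderiv j (rotPoly R p) =
      ∑ i, (isometryCoef R i j : ℂ) • rotPoly R (MvPolynomial.pderiv i p) := by
  induction p using MvPolynomial.induction_on with
  | C a => simp [rotPoly]
  | add p q hp hq => simp only [map_add, hp, hq, smul_add, Finset.sum_add_distrib]
  | mul_X p k hp =>
    have h1 : MvPolynomial.pderiv j (rotPoly R (MvPolynomial.X k)) =
        MvPolynomial.C (isometryCoef R k j : ℂ) := by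
      simp only [rotPoly, MvPolynomial.aeval_X, map_sum, MvPolynomial.pderiv_C_mul,
        MvPolynomial.pderiv_X, Pi.single_apply]
      simp
    have h2 : ∀ i, rotPoly R (MvPolynomial.pderiv i (MvPolynomial.X k)) = if k = i then 1 else 0 :=
      fun i => by
        rw [MvPolynomial.pderiv_X, Pi.single_apply]
        split_ifs <;> simp
    simp only [map_mul, Derivation.leibniz, hp, h1, h2, smul_eq_mul, map_add, smul_add,
      Finset.sum_add_distrib, Finset.mul_sum]
    congr 1
    · simp [MvPolynomial.smul_eq_C_mul, mul_comm]
    · simp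

/-- Chain rule twice; the orthonormality of the rows of the matrix collapses the double sum to the
diagonal. -/
theorem lapP_rotPoly (R : E d ≃ₗᵢ[ℝ] E d) (p : MvPolynomial (Fin d) ℂ) :
    lapP d (rotPoly R p) = rotPoly R (lapP d p) := by
  simp only [lapP_apply, pderiv_rotPoly, map_sum, Derivation.map_smul,
    Finset.smul_sum, smul_smul]
  rw [Finset.sum_comm]
  refine Finset.sum_congr rfl fun i _ => ?_
  rw [Finset.sum_comm]
  have h : ∀ k, ∑ j, (isometryCoef R i j : ℂ) * (isometryCoef R k j : ℂ) = if i = k then 1 else 0 :=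
    fun k => by simpa [apply_ite] using congrArg (fun r : ℝ => (r : ℂ)) (sum_isometryCoef_mul R i k)
  simp only [← Finset.sum_smul, h]
  simp

theorem IsHarmonicPoly.rotPoly {ℓ : ℕ} {p : MvPolynomial (Fin d) ℂ} (hp : IsHarmonicPoly ℓ p)
    (R : E d ≃ₗᵢ[ℝ] E d) : IsHarmonicPoly ℓ (rotPoly R p) := by
  refine ⟨?_, by rw [lapP_rotPoly, hp.harmonic, map_zero]⟩
  rw [← one_mul ℓ]
  refine hp.homogeneous.aeval _ fun i => MvPolynomial.IsHomogeneous.sum _ _ _ fun j _ => ?_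
  simpa using (MvPolynomial.isHomogeneous_C (Fin d) _).mul (MvPolynomial.isHomogeneous_X ℂ j)

theorem continuous_sphereMap (R : E d ≃ₗᵢ[ℝ] E d) : Continuous (sphereMap R) :=
  (R.continuous.comp continuous_subtype_val).subtype_mk _

open scoped Pointwise in
-- Surface measure is, up to a constant, the volume of the cone over a set. A linear isometry
-- preserves volume and takes cones to cones.
theorem measurePreserving_sphereMap (R : E d ≃ₗᵢ[ℝ] E d) :
    MeasurePreserving (sphereMap R) (sphereMeasure d) (sphereMeasure d) := by
  have hm := (continuous_sphereMap R).measurable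
  refine ⟨hm, ?_⟩
  ext s hs
  rw [Measure.map_apply hm hs, Measure.toSphere_apply' _ hs, Measure.toSphere_apply' _ (hm hs)]
  congr 1
  have h : R ⁻¹' (Set.Ioo (0 : ℝ) 1 • ((↑) '' s : Set (E d))) =
      Set.Ioo (0 : ℝ) 1 • ((↑) '' (sphereMap R ⁻¹' s) : Set (E d)) := by
    ext x
    constructor
    · rintro ⟨r, hr, _, ⟨y, hy, rfl⟩, hx⟩
      have hx : r • (y : E d) = R x := hx
      have hy1 : R.symm (y : E d) ∈ Metric.sphere (0 : E d) 1 := by simp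
      refine ⟨r, hr, _, ⟨⟨R.symm y, hy1⟩, ?_, rfl⟩, ?_⟩
      · have : sphereMap R ⟨R.symm y, hy1⟩ = y := Subtype.ext (R.apply_symm_apply _)
        rwa [Set.mem_preimage, this]
      · change r • R.symm (y : E d) = x
        rw [← map_smul, hx, R.symm_apply_apply]
    · rintro ⟨r, hr, _, ⟨y, hy, rfl⟩, rfl⟩
      exact ⟨r, hr, _, ⟨_, hy, rfl⟩, (map_smul R r (y : E d)).symm⟩
  rw [← h]
  exact R.measurePreserving.measure_preimage_emb R.toHomeomorph.measurableEmbedding _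

/-- The operator `f ↦ f ∘ R` on `L²(𝕊^{d-1})`. -/
def rotOp (R : E d ≃ₗᵢ[ℝ] E d) : L2Sphere d →L[ℂ] L2Sphere d :=
  (Lp.compMeasurePreservingₗᵢ ℂ (sphereMap R)
    (measurePreserving_sphereMap R)).toContinuousLinearMap

theorem coeFn_rotOp (R : E d ≃ₗᵢ[ℝ] E d) (f : L2Sphere d) :
    ∀ᵐ y ∂sphereMeasure d, rotOp R f y = f (sphereMap R y) :=
  Lp.coeFn_compMeasurePreserving f (measurePreserving_sphereMap R)

theorem rotOp_rest (R : E d ≃ₗᵢ[ℝ] E d) (p : MvPolynomial (Fin d) ℂ) :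
    rotOp R (rest (polyFun p)) = rest (polyFun (rotPoly R p)) := by
  refine eq_rest ?_
  filter_upwards [coeFn_rotOp R (rest (polyFun p)),
    (measurePreserving_sphereMap R).quasiMeasurePreserving.ae
      (coeFn_rest (continuous_polyFun p))] with y h1 h2
  rw [h1, h2, polyFun_rotPoly]
  rfl

/-- Rotations preserve the degree of a spherical harmonic, and on each degree the differential is a
scalar, also for κ = 0 since the series value never vanishes. So the two operators commute on a
dense span. -/
theorem isRotationInvariant_dPhi (hd : 2 ≤ d) {κ : ℂ}
    (h0 : IsUnit (helmholtzOp κ (0 : Potential d))) {q : Potential d} (hq : IsRadial q) :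
    IsRotationInvariant (dPhi κ q) := by
  obtain ⟨q₀, hq⟩ := hq
  intro R f g hfg
  have hg : g = rotOp R f := by
    refine Lp.ext ?_
    filter_upwards [hfg, coeFn_rotOp R f] with y h1 h2
    rw [h1, h2]
  have hT : ∀ {ℓ : ℕ} {p : MvPolynomial (Fin d) ℂ}, IsHarmonicPoly ℓ p →
      dPhi κ q (rest (polyFun p)) = ((besselSeries d ℓ κ ^ 2)⁻¹ * radialIntegral d ℓ ℓ q₀ κ) •
        rest (polyFun p) := fun {ℓ p} hp => by
    rw [mul_smul, ← dPhi_harmonic hd h0 hq hp,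
      inv_smul_smul₀ (pow_ne_zero 2 (besselSeries_ne_zero hd ℓ h0))]
  have hcomm : (dPhi κ q).comp (rotOp R) = (rotOp R).comp (dPhi κ q) := by
    refine ContinuousLinearMap.ext_on (dense_span_sphericalHarmonics (by omega)) ?_
    rintro _ ⟨ℓ, p, hp, rfl⟩
    rw [ContinuousLinearMap.comp_apply, ContinuousLinearMap.comp_apply, hT hp, rotOp_rest,
      hT (hp.rotPoly R), map_smul, rotOp_rest]
  have := congrArg (fun S : L2Sphere d →L[ℂ] L2Sphere d => S f) hcomm
  simp only [ContinuousLinearMap.comp_apply] at this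
  rw [hg, this]
  exact coeFn_rotOp R _

end RadialCalderon

end

/-! ### Assembly of the main theorem -/

theorem mainTheorem9 (d : ℕ) (hd : 2 ≤ d) (κ : ℂ)
    (hκ : ¬ RadialCalderon.IsDirichletEigenvalue κ (0 : RadialCalderon.Potential d)) :
    (∀ᶠ q : RadialCalderon.Potential d in 𝓝 0,
      ¬ RadialCalderon.IsDirichletEigenvalue κ q ∧
      ∀ T : RadialCalderon.L2Sphere d →L[ℂ] RadialCalderon.L2Sphere d,
        RadialCalderon.IsDtNDifference κ q T ↔ T = RadialCalderon.Phi d κ q) ∧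
    DifferentiableAt ℝ (RadialCalderon.Phi d κ) 0 ∧
    ∀ q : RadialCalderon.Potential d, RadialCalderon.IsRadial q →
      RadialCalderon.IsRotationInvariant (fderiv ℝ (RadialCalderon.Phi d κ) 0 q) ∧
      ∀ ℓ : ℕ,
        (κ ≠ 0 → RadialCalderon.phi d ℓ (RadialCalderon.csqrt κ) ≠ 0) ∧
        ∀ Y : RadialCalderon.L2Sphere d, RadialCalderon.IsSphericalHarmonic ℓ Y →
          RadialCalderon.phi d ℓ (RadialCalderon.csqrt κ) ^ 2 •
              fderiv ℝ (RadialCalderon.Phi d κ) 0 q Y =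
            RadialCalderon.kappaMoment ℓ q κ • Y := by
  have hd0 : 0 < d := by omega
  have h0 := RadialCalderon.isUnit_helmholtzOp_zero hκ
  obtain ⟨D, hD, hDq⟩ := RadialCalderon.hasFDerivAt_Phi hd0 h0
  refine ⟨?_, hD.differentiableAt, fun q hq => ?_⟩
  · filter_upwards [RadialCalderon.eventually_isUnit_helmholtzOp h0] with q hq
    refine ⟨RadialCalderon.not_isDirichletEigenvalue_of_isUnit hq, fun T => ?_⟩
    rw [RadialCalderon.phi_eq_dtnDiff hd0 hq h0]
    exact RadialCalderon.isDtNDifference_iff hd0 hq h0 T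
  · rw [hD.fderiv, hDq]
    exact ⟨RadialCalderon.isRotationInvariant_dPhi hd h0 hq, fun ℓ =>
      ⟨fun hκ0 => RadialCalderon.phi_ne_zero hd ℓ hκ0 h0,
        fun Y hY => RadialCalderon.phi_sq_smul_dPhi hd h0 hq hY⟩⟩
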